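/- Let $R$ be a commutative ring. Let $A=\bigoplus_{n\ge 0}A_n$ be a quadratic $R$-algebra, i.e. $A=T_R(A_1)/(Q_2)$ with $Q_2=\ker(A_1\otimes_R A_1\to A_2)$, with the induced grading, and assume that every $A_n$ is a flat $R$-module. All tensor products are over $R$. **Koszulness.** For a graded left $A$-module $M$, $\operatorname{Tor}^A_i(R,M)_d$ is the degree $d$ part of the homology in degree $i$ of the reduced bar complex $A_+^{\otimes \bullet}\otimes M$ (for $M=R$: of $A_+^{\otimes\bullet}$). $A$ is *Koszul* if $\operatorname{Tor}^A_i(R,R)_d=0$ for all $d>i$. If $M_j=0$ for $j<t$ ("$M$ has initial degree $t$"), $M$ is *Koszul* if $\operatorname{Tor}_i^A(R,M)_{t+j}=0$ for all $j>i$. **Distributivity.** Let $N_1,\dots,N_m$ be submodules of an $R$-module $W$. For $I\subseteq[m]$ let $C^\bullet_I$ be the cochain complex $C^k_I=\bigoplus_{J\supseteq I,\,|J|=|I|+k} W/\sum_{j\in J}N_j$ and $C_\bullet^I$ the chain complex $C^I_k=\bigoplus_{J\supseteq I,\,|J|=|I|+k}\bigcap_{j\in J}N_j$, with differentials the signed sums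 of the canonical surjections, respectively inclusions. The collection is *distributive* if $C^\bullet_I$ and $C_\bullet^I$ are exact in all positive degrees for every $I$. **Submodules.** $S^n_{A,i}=A_1^{\otimes i-1}\otimes Q_2\otimes A_1^{\otimes n-i-1}\subseteq A_1^{\otimes n}$ for $1\le i\le n-1$. For $M$ of initial degree $t$ let $Q^M_{t+d}=\ker(A_1^{\otimes d}\otimes M_t\to M_{t+d})$, and let $S^n_{A,M,i}\subseteq A_1^{\otimes n-1}\otimes M_t$ be $A_1^{\otimes i-1}\otimes Q_2\otimes A_1^{\otimes n-i-2}\otimes M_t$ for $i<n-1$ and $A_1^{\otimes n-2}\otimes Q^M_{t+1}$ for $i=n-1$. $M$ is *quadratic* if $A_1^{\otimes d}\otimes M_t\to M_{t+d}$ is surjective and $Q^M_{t+d}=\sum_{i=1}^{d} S^{d+1}_{A,M,i}$ for all $d\ge 0$. **Refinement complexes.** Write $\beta\ge\alpha$ if the composition $\beta$ arises from $\alpha$ by adding up neighbouring parts, and let $\ell$ denote length. For a composition $\alpha$ with positive parts, $R^\bullet_A(\alpha)$ is the cochain complex with terms $R_A^k(\alpha)=\bigoplus_{\beta\ge\alpha,\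 \ell(\alpha)-\ell(\beta)=k}A_{\beta_1}\otimes\cdots\otimes A_{\beta_{\ell(\beta)}}$ and the bar differential; $R^A_\bullet(\alpha)$ is the chain complex with terms $R^A_k(\alpha)=\bigoplus_{\beta\ge\alpha,\ \ell(\alpha)-\ell(\beta)=k}C_{\beta_1}\otimes\cdots\otimes C_{\beta_{\ell(\beta)}}$, where $C_n=((A^!)^*)_n=\bigcap_i S^n_{A,i}\subseteq A_1^{\otimes n}$ is the graded dual of the quadratic dual of $A$, and with the cobar differential, whose components are the signed inclusions $C_{a+b}\subseteq C_a\otimes C_b$. For a module $M$ of initial degree $t$ and $\alpha=(\alpha_1,\dots,\alpha_n,t+r)$ with $\alpha_i>0$ and $r\ge 0$, the complexes $R^\bullet_{A,M}(\alpha)$ and $R_\bullet^{A,M}(\alpha)$ are defined in the same way, the last factors being $M_{t+u}$, respectively $D_{t+u}=((M^!)^*)_{t+u}=\bigcap_{i=1}^{u} S^{u+1}_{A,M,i}\subseteq A_1^{\otimes u}\otimes M_t$. **Theorem.** 1. $A$ is Koszul if and only if for every $n>0$ the collection $S^n_{A,1},\dots,S^n_{A,n-1}\subseteq A_1^{\otimes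 n}$ is distributive. 2. If $A$ is Koszul, then for every composition $\alpha$ the complexes $R^\bullet_A(\alpha)$ and $R_\bullet^A(\alpha)$ are exact in all positive (co)homological degrees. (Here and in 3, that the chain complex is well defined is part of the claim: its terms, which are tensor products, embed into a tensor power of $A_1$, respectively its tensor product with $M_t$, and there the asserted inclusions hold.) 3. Let $A$ be Koszul and let $M$ be a $\mathbb Z$-graded left $A$-module with all $M_j$ flat over $R$ and $M_j=0$ for $j<t$. Then $M$ is Koszul if and only if $M$ is quadratic and for every $n>0$ the collection $S^n_{A,M,1},\dots,S^n_{A,M,n-1}\subseteq A_1^{\otimes n-1}\otimes M_t$ is distributive. If $M$ is Koszul, then for all $\alpha=(\alpha_1,\dots,\alpha_n,t+r)$ with $n\ge0$, $\alpha_i>0$ and $r\ge 0$ the complexes $R^\bullet_{A,M}(\alpha)$ and $R_\bullet^{A,M}(\alpha)$ are exact in all positive (co)homological degrees. 4. The statement of 3 also holds for graded right $A$-modules, regarded as left modules over the opposite algebra $A^{\mathrm{op}}$ (all the above notions being formed over $A^{\mathrm{op}}$), when $A$ is Koszul. -/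

import Mathlib

open scoped TensorProduct

noncomputable section

namespace KoszulDistributive

universe u v w

/-! ## Complexes of a finite collection of submodules -/

section Collections

variable {R : Type u} [CommRing R] {W : Type v} [AddCommGroup W] [Module R W] {m : ℕ}

/-- The sign of the permutation sorting the tuple `(J, j)` (`J` in ascending order, `j ∉ J`). -/
def sgn (j : Fin m) (J : Finset (Fin m)) : ℤ := (-1) ^ (J.filter (fun x => j < x)).card

/-- The subsets `J ⊇ I` of `{1, …, m}` with `|J| = |I| + k`. -/
abbrev Face (I : Finset (Fin m)) (k : ℕ) : Type :=
  {J : Finset (Fin m) // I ⊆ J ∧ J.card = I.card + k}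

/-- `J ∪ {j}` for `j ∉ J`. -/
def Face.insert {I : Finset (Fin m)} {k : ℕ} (J : Face I k) (j : {j : Fin m // j ∉ J.1}) :
    Face I (k + 1) :=
  ⟨Insert.insert j.1 J.1, J.2.1.trans (Finset.subset_insert _ _), by
    rw [Finset.card_insert_of_notMem j.2, J.2.2]; omega⟩

/-- `K \ {j}` for `j ∈ K \ I`. -/
def Face.erase {I : Finset (Fin m)} {k : ℕ} (K : Face I (k + 1))
    (j : {j : Fin m // j ∈ K.1 ∧ j ∉ I}) : Face I k :=
  ⟨K.1.erase j.1, fun _ hx => Finset.mem_erase.2 ⟨fun h => j.2.2 (h ▸ hx), K.2.1 hx⟩, by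
    rw [Finset.card_erase_of_mem j.2.1, K.2.2]; omega⟩

/-- `C^k_I = ⨁_{J ⊇ I, |J| = |I| + k} W / ∑_{j ∈ J} N_j`. -/
abbrev QuotCochain (N : Fin m → Submodule R W) (I : Finset (Fin m)) (k : ℕ) : Type v :=
  (J : Face I k) → W ⧸ (⨆ j ∈ J.1, N j)

/-- The differential of `C^•_I`: the signed sum of the canonical surjections
`W / ∑_{K \ j} N → W / ∑_K N`. -/
def quotD (N : Fin m → Submodule R W) (I : Finset (Fin m)) (k : ℕ) :
    QuotCochain N I k →ₗ[R] QuotCochain N I (k + 1) :=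
  LinearMap.pi fun K => ∑ j : {j : Fin m // j ∈ K.1 ∧ j ∉ I},
    sgn j.1 (K.1.erase j.1) •
      (Submodule.factor (biSup_mono (f := N) fun _ h => Finset.mem_of_mem_erase h) ∘ₗ
        (LinearMap.proj (K.erase j) :
          QuotCochain N I k →ₗ[R] W ⧸ (⨆ i ∈ (K.erase j).1, N i)))

/-- The signed sum of inclusions, in the direction of smaller subsets. -/
def cubeD (R : Type u) [CommRing R] (W : Type v) [AddCommGroup W] [Module R W]
    (I : Finset (Fin m)) (k : ℕ) : (Face I (k + 1) → W) →ₗ[R] (Face I k → W) :=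
  LinearMap.pi fun J => ∑ j : {j : Fin m // j ∉ J.1},
    sgn j.1 J.1 • (LinearMap.proj (J.insert j) : (Face I (k + 1) → W) →ₗ[R] W)

/-- For a family of submodules `X J ⊆ W` with `X K ⊆ X J` for `J ⊆ K`, the chain complex
`C_k = ⨁_{J ⊇ I, |J| = |I| + k} X J` (differential: signed sum of inclusions) is exact in all
positive degrees. -/
def CubeChainExact (X : Finset (Fin m) → Submodule R W) (I : Finset (Fin m)) : Prop :=
  ∀ (k : ℕ) (c : Face I (k + 1) → W), (∀ J, c J ∈ X J.1) → cubeD R W I k c = 0 →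
    ∃ b : Face I (k + 2) → W, (∀ J, b J ∈ X J.1) ∧ cubeD R W I (k + 1) b = c

/-- A collection `N_1, …, N_m ⊆ W` is distributive if for every `I` the cochain complex `C^•_I`
(terms `W / ∑_{j ∈ J} N_j`) and the chain complex `C_•^I` (terms `⋂_{j ∈ J} N_j`), `J ⊇ I`, are
exact in positive degrees. -/
def IsDistributive (N : Fin m → Submodule R W) : Prop :=
  ∀ I : Finset (Fin m),
    (∀ k : ℕ, Function.Exact (quotD N I k) (quotD N I (k + 1))) ∧
      CubeChainExact (fun J => ⨅ j ∈ J, N j) I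

end Collections

/-! ## Homology of a subcomplex -/

section Homology

variable {R : Type u} [CommRing R] {B : ℕ → Type v} [∀ k, AddCommGroup (B k)]
  [∀ k, Module R (B k)]

/-- Cycles in degree `k` of the subcomplex `F ⊆ (B, d)`. -/
def cycles (d : ∀ k, B (k + 1) →ₗ[R] B k) (F : ∀ k, Submodule R (B k)) :
    ∀ k, Submodule R (B k)
  | 0 => F 0
  | k + 1 => F (k + 1) ⊓ LinearMap.ker (d k)

/-- Homology in degree `k` of the subcomplex `F ⊆ (B, d)`. -/
abbrev Homology (d : ∀ k, B (k + 1) →ₗ[R] B k) (F : ∀ k, Submodule R (B k)) (k : ℕ) : Type v :=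
  cycles d F k ⧸ ((F (k + 1)).map (d k)).submoduleOf (cycles d F k)

end Homology

/-! ## Compositions

A composition is a list of natural numbers. -/

/-- Sum up neighbouring parts: the `i`-th Boolean tells whether the comma after the `i`-th part
is replaced by a plus sign. -/
def merge : List Bool → List ℕ → List ℕ
  | true :: e, a :: b :: l => merge e ((a + b) :: l)
  | false :: e, a :: b :: l => a :: merge e (b :: l)
  | _, l => l

/-- The composition obtained from `α` by near-concatenating at the places in `J`. -/
def sigma (α : List ℕ) (J : Finset (Fin (α.length - 1))) : List ℕ :=
  merge (List.ofFn fun i => decide (i ∈ J)) α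

/-- `β ≥ α` in the refinement order. -/
def IsCoarsening (α β : List ℕ) : Prop := ∃ J, β = sigma α J

/-! ## Graded algebras and their bar complexes -/

section Algebra

variable {R : Type u} [CommRing R] {A : Type v} [Ring A] [Algebra R A]

/-- `(a_0, …, a_n) ↦ (a_0, …, a_j a_{j+1}, …, a_n)`. -/
def mulAt {n : ℕ} (j : Fin n) (a : Fin (n + 1) → A) : Fin n → A := fun k =>
  if k < j then a k.castSucc else if k = j then a k.castSucc * a k.succ else a k.succ

/-- The linear dependence of the entries of `mulAt j a` on the `i`-th entry of `a`. -/
def mulAtAux {n : ℕ} (j : Fin n) (a : Fin (n + 1) → A) (i : Fin (n + 1)) (x : A) : A :=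
  if i = j.castSucc then x * a j.succ else if i = j.succ then a j.castSucc * x else x

theorem mulAt_update {n : ℕ} (j : Fin n) (a : Fin (n + 1) → A) (i : Fin (n + 1)) (x : A) :
    mulAt j (Function.update a i x) =
      Function.update (mulAt j a) (j.predAbove i) (mulAtAux j a i x) := by
  funext k
  rcases lt_or_ge j.castSucc i with h | h
  · obtain ⟨i, rfl⟩ := Fin.exists_succ_eq.2 (Fin.ne_zero_of_lt h)
    rw [Fin.predAbove_succ_of_le _ _ (Fin.castSucc_lt_succ_iff.1 h)]
    simp only [mulAt, mulAtAux, Function.update_apply, Fin.ext_iff, Fin.lt_def, Fin.val_castSucc,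
      Fin.val_succ] at h ⊢
    split_ifs <;> first | rfl | omega | (obtain rfl : k = j := Fin.ext (by omega); rfl)
  · obtain ⟨i, rfl⟩ := Fin.exists_castSucc_eq.2 (h.trans_lt (Fin.castSucc_lt_last j)).ne
    rw [Fin.predAbove_castSucc_of_le _ _ (Fin.castSucc_le_castSucc_iff.1 h)]
    simp only [mulAt, mulAtAux, Function.update_apply, Fin.ext_iff, Fin.lt_def, Fin.le_def,
      Fin.val_castSucc, Fin.val_succ] at h ⊢
    split_ifs <;> first | rfl | omega | (obtain rfl : k = j := Fin.ext (by omega); rfl)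

theorem mulAtAux_add {n : ℕ} (j : Fin n) (a : Fin (n + 1) → A) (i : Fin (n + 1)) (x y : A) :
    mulAtAux j a i (x + y) = mulAtAux j a i x + mulAtAux j a i y := by
  unfold mulAtAux; split_ifs <;> simp [add_mul, mul_add]

theorem mulAtAux_smul {n : ℕ} (j : Fin n) (a : Fin (n + 1) → A) (i : Fin (n + 1)) (r : R) (x : A) :
    mulAtAux j a i (r • x) = r • mulAtAux j a i x := by
  unfold mulAtAux; split_ifs <;> simp

/-- The map `A^{⊗ (n+1)} → A^{⊗ n}` multiplying the `j`-th and `(j+1)`-st tensor factors. -/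
def mulFace (R : Type u) [CommRing R] (A : Type v) [Ring A] [Algebra R A] {n : ℕ} (j : Fin n) :
    (⨂[R] _ : Fin (n + 1), A) →ₗ[R] ⨂[R] _ : Fin n, A :=
  PiTensorProduct.lift
    { toFun := fun a => PiTensorProduct.tprod R (mulAt j a)
      map_update_add' := by
        intro inst a i x y
        obtain rfl : inst = instDecidableEqFin _ := Subsingleton.elim _ _
        simp only [mulAt_update, mulAtAux_add, MultilinearMap.map_update_add]
      map_update_smul' := by
        intro inst a i r x
        obtain rfl : inst = instDecidableEqFin _ := Subsingleton.elim _ _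
        simp only [mulAt_update, mulAtAux_smul, MultilinearMap.map_update_smul] }

/-- The bar differential `a_0 ⊗ ⋯ ⊗ a_n ↦ ∑_j (-1)^j a_0 ⊗ ⋯ ⊗ a_j a_{j+1} ⊗ ⋯ ⊗ a_n`. -/
def barD (R : Type u) [CommRing R] (A : Type v) [Ring A] [Algebra R A] (n : ℕ) :
    (⨂[R] _ : Fin (n + 1), A) →ₗ[R] ⨂[R] _ : Fin n, A :=
  ∑ j : Fin n, (-1 : ℤ) ^ (j : ℕ) • mulFace R A j

variable (𝒜 : ℕ → Submodule R A)

/-- The internal degree `d` part of `A_+^{⊗ n}`, as a submodule of `A^{⊗ n}`. -/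
def barStrand (d : ℕ) (n : ℕ) : Submodule R (⨂[R] _ : Fin n, A) :=
  Submodule.span R {x | ∃ (b : Fin n → ℕ) (a : Fin n → A),
    (∀ i, 0 < b i) ∧ ∑ i, b i = d ∧ (∀ i, a i ∈ 𝒜 (b i)) ∧ x = PiTensorProduct.tprod R a}

/-- `Tor_i^A(R, R)_d`, computed by the reduced bar complex `R ⊗_A Bar^A(R)`, which is `A_+^{⊗ n}`
in homological degree `n`. -/
abbrev TorAlg (i d : ℕ) : Type _ :=
  Homology (B := fun n => ⨂[R] _ : Fin n, A) (barD R A) (barStrand 𝒜 d) i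

/-- `A` is Koszul: `Tor_i^A(R, R)_d = 0` for all `d > i`. -/
def IsKoszul : Prop := ∀ i d : ℕ, i < d → Subsingleton (TorAlg 𝒜 i d)

/-- The submodule `A_β = A_{β_1} ⊗ ⋯ ⊗ A_{β_n}` of `A^{⊗ n}`, for `n` the length of `β`. -/
def tensorPiece (β : List ℕ) (n : ℕ) : Submodule R (⨂[R] _ : Fin n, A) :=
  Submodule.span R {x | ∃ a : Fin n → A,
    (∀ i : Fin n, a i ∈ 𝒜 (β.getD i 0)) ∧ x = PiTensorProduct.tprod R a}

/-- The part `⨁_{β ≥ α, ℓ(β) = n} A_β` of the refinement cochain complex `R^•_A(α)`; its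
cohomological degree is `ℓ(α) - n`. -/
def refCochain (α : List ℕ) (n : ℕ) : Submodule R (⨂[R] _ : Fin n, A) :=
  ⨆ (β : List ℕ) (_ : IsCoarsening α β ∧ β.length = n), tensorPiece 𝒜 β n

/-- `R^•_A(α)`, with the bar differential, is exact in positive cohomological degrees. -/
def RefCochainExact (α : List ℕ) : Prop :=
  ∀ n : ℕ, n < α.length →
    Subsingleton (Homology (B := fun n => ⨂[R] _ : Fin n, A) (barD R A) (refCochain 𝒜 α) n)

/-! ### Quadratic algebras -/

/-- The tensor algebra `T(A_1)`. -/
abbrev TA : Type _ := TensorAlgebra R (𝒜 1)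

/-- `A_1` as a submodule of `T(A_1)`; `V 𝒜 ^ n` is then the tensor power `A_1^{⊗ n}`. -/
def V : Submodule R (TA 𝒜) := LinearMap.range (TensorAlgebra.ι R)

/-- The canonical algebra map `T(A_1) → A`. -/
def can : TA 𝒜 →ₐ[R] A := TensorAlgebra.lift R (𝒜 1).subtype

/-- The quadratic relations `Q_2 = ker (A_1 ⊗ A_1 → A_2)`. -/
def Q2 : Submodule R (TA 𝒜) := V 𝒜 ^ 2 ⊓ LinearMap.ker (can 𝒜).toLinearMap

/-- `A = T(A_1) / (Q_2)`. -/
def IsQuadratic : Prop :=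
  Function.Surjective (can 𝒜) ∧
    TwoSidedIdeal.ker (can 𝒜) = TwoSidedIdeal.span (Q2 𝒜 : Set (TA 𝒜))

/-- `A_1^{⊗ i} ⊗ Q_2 ⊗ A_1^{⊗ (n-i-2)} ⊆ A_1^{⊗ n}`, for `0 ≤ i ≤ n - 2`. -/
def SAlg (n i : ℕ) : Submodule R (TA 𝒜) := V 𝒜 ^ i * Q2 𝒜 * V 𝒜 ^ (n - i - 2)

/-- The collection `S^n_{A,1}, …, S^n_{A,n-1}` of submodules of `A_1^{⊗ n}`. -/
def SAlgColl (n : ℕ) : Fin (n - 1) → Submodule R ↥(V 𝒜 ^ n) :=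
  fun i => (SAlg 𝒜 n i).submoduleOf (V 𝒜 ^ n)

/-- `((A^!)^*)_n`, the degree `n` part of the graded dual of the quadratic dual of `A`, i.e. the
kernel `⋂_i S^n_{A,i}` of
`A_1^{⊗ n} → ⨁_i A_1^{⊗ (i-1)} ⊗ A_2 ⊗ A_1^{⊗ (n-i-1)}`. -/
def coAlg (n : ℕ) : Submodule R (TA 𝒜) := V 𝒜 ^ n ⊓ ⨅ i : Fin (n - 1), SAlg 𝒜 n i

/-- The image of `((A^!)^*)_{β_1} ⊗ ⋯ ⊗ ((A^!)^*)_{β_n}` in `A_1^{⊗ |β|}`. -/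
def coAlgTerm : List ℕ → Submodule R (TA 𝒜)
  | [] => 1
  | b :: l => coAlg 𝒜 b * coAlgTerm l

/-- The canonical map `((A^!)^*)_{β_1} ⊗ ⋯ ⊗ ((A^!)^*)_{β_n} → coAlgTerm β` is injective, hence
an isomorphism. -/
def CoAlgTermIsTensor : List ℕ → Prop
  | [] => True
  | b :: l => Function.Injective (Submodule.mulMap (coAlg 𝒜 b) (coAlgTerm 𝒜 l)) ∧
      CoAlgTermIsTensor l

/-- The refinement chain complex `R_•^A(α)`, with terms
`R_k^A(α) = ⨁_{β ≥ α, ℓ(α) - ℓ(β) = k} ((A^!)^*)_β` and the cobar differential, whose components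
are the signed inclusions `((A^!)^*)_{a+b} ⊆ ((A^!)^*)_a ⊗ ((A^!)^*)_b`, is a well-defined
complex and is exact in positive homological degrees. -/
def RefChainExact (α : List ℕ) : Prop :=
  (∀ J, CoAlgTermIsTensor 𝒜 (sigma α J)) ∧
    (∀ J K, J ⊆ K → coAlgTerm 𝒜 (sigma α K) ≤ coAlgTerm 𝒜 (sigma α J)) ∧
    CubeChainExact (fun J => coAlgTerm 𝒜 (sigma α J)) ∅

end Algebra

/-! ## Graded modules -/

section GradedModules

variable {R : Type u} [CommRing R] {A : Type v} [Ring A] [Algebra R A]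
  (𝒜 : ℕ → Submodule R A)
  {M : Type w} [AddCommGroup M] [Module R M] [Module A M] [IsScalarTower R A M]
  (ℳ : ℤ → Submodule R M)

/-- `M = ⨁_j M_j` is a graded left `A`-module with `M_j = 0` for `j < t`. -/
structure IsGradedModule (t : ℤ) : Prop where
  isInternal : DirectSum.IsInternal ℳ
  smul_mem : ∀ (i : ℕ) (j : ℤ) (a : A) (x : M), a ∈ 𝒜 i → x ∈ ℳ j → a • x ∈ ℳ (i + j)
  eq_bot : ∀ j < t, ℳ j = ⊥

/-- The map `a_0 ⊗ ⋯ ⊗ a_n ⊗ x ↦ a_0 ⊗ ⋯ ⊗ a_{n-1} ⊗ a_n x`. -/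
def actFace (R : Type u) [CommRing R] (A : Type v) [Ring A] [Algebra R A]
    (M : Type w) [AddCommGroup M] [Module R M] [Module A M] [IsScalarTower R A M] (n : ℕ) :
    (⨂[R] _ : Fin (n + 1), A) ⊗[R] M →ₗ[R] (⨂[R] _ : Fin n, A) ⊗[R] M :=
  TensorProduct.lift (PiTensorProduct.lift
    { toFun := fun a => TensorProduct.mk R (⨂[R] _ : Fin n, A) M
          (PiTensorProduct.tprod R (Fin.init a)) ∘ₗ Algebra.lsmul R R M (a (Fin.last n))
      map_update_add' := by
        intro inst a i x y
        obtain rfl : inst = instDecidableEqFin _ := Subsingleton.elim _ _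
        refine LinearMap.ext fun z => ?_
        rcases Fin.eq_castSucc_or_eq_last i with ⟨i, rfl⟩ | rfl
        · have h (w : A) : Function.update a i.castSucc w (Fin.last n) = a (Fin.last n) :=
            Function.update_of_ne (Fin.castSucc_lt_last i).ne' _ _
          simp only [LinearMap.add_apply, LinearMap.comp_apply, TensorProduct.mk_apply,
            Fin.init_update_castSucc, MultilinearMap.map_update_add, TensorProduct.add_tmul, h]
        · simp [Fin.init_update_last, TensorProduct.tmul_add]
      map_update_smul' := by
        intro inst a i r x
        obtain rfl : inst = instDecidableEqFin _ := Subsingleton.elim _ _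
        refine LinearMap.ext fun z => ?_
        rcases Fin.eq_castSucc_or_eq_last i with ⟨i, rfl⟩ | rfl
        · have h (w : A) : Function.update a i.castSucc w (Fin.last n) = a (Fin.last n) :=
            Function.update_of_ne (Fin.castSucc_lt_last i).ne' _ _
          simp only [LinearMap.smul_apply, LinearMap.comp_apply, TensorProduct.mk_apply,
            Fin.init_update_castSucc, MultilinearMap.map_update_smul, TensorProduct.smul_tmul', h]
        · simp [Fin.init_update_last] })

/-- The differential of `R ⊗_A Bar^A(M)`, whose term in homological degree `n` is
`A_+^{⊗ n} ⊗ M`. -/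
def barModD (R : Type u) [CommRing R] (A : Type v) [Ring A] [Algebra R A]
    (M : Type w) [AddCommGroup M] [Module R M] [Module A M] [IsScalarTower R A M] (n : ℕ) :
    (⨂[R] _ : Fin (n + 1), A) ⊗[R] M →ₗ[R] (⨂[R] _ : Fin n, A) ⊗[R] M :=
  (barD R A n).rTensor M + (-1 : ℤ) ^ n • actFace R A M n

/-- The internal degree `d` part of `A_+^{⊗ n} ⊗ M`. -/
def barModStrand (d : ℤ) (n : ℕ) : Submodule R ((⨂[R] _ : Fin n, A) ⊗[R] M) :=
  Submodule.span R {x | ∃ (b : Fin n → ℕ) (s : ℤ) (a : Fin n → A) (y : M),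
    (∀ i, 0 < b i) ∧ (∑ i, (b i : ℤ)) + s = d ∧ (∀ i, a i ∈ 𝒜 (b i)) ∧ y ∈ ℳ s ∧
      x = PiTensorProduct.tprod R a ⊗ₜ[R] y}

/-- `Tor_i^A(R, M)_d`, computed by the reduced bar complex `R ⊗_A Bar^A(M)`. -/
abbrev TorMod (i : ℕ) (d : ℤ) : Type _ :=
  Homology (B := fun n => (⨂[R] _ : Fin n, A) ⊗[R] M) (barModD R A M) (barModStrand 𝒜 ℳ d) i

/-- `M`, of initial degree `t`, is Koszul: `Tor_i^A(R, M)_{t+j} = 0` for all `j > i`. -/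
def IsKoszulModule (t : ℤ) : Prop :=
  ∀ i j : ℕ, i < j → Subsingleton (TorMod 𝒜 ℳ i (t + j))

/-- The submodule `A_{β_1} ⊗ ⋯ ⊗ A_{β_n} ⊗ M_{t + β_{n+1}}`, for `β` of length `n + 1`. The last
part of `β` is counted from the initial degree `t`. -/
def tensorModPiece (t : ℤ) (β : List ℕ) (n : ℕ) : Submodule R ((⨂[R] _ : Fin n, A) ⊗[R] M) :=
  Submodule.span R {x | ∃ (a : Fin n → A) (y : M),
    (∀ i : Fin n, a i ∈ 𝒜 (β.getD i 0)) ∧ y ∈ ℳ (t + (β.getD n 0 : ℕ)) ∧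
      x = PiTensorProduct.tprod R a ⊗ₜ[R] y}

/-- The part `⨁_{β ≥ α, ℓ(β) = n + 1} (A ⊗ M)_β` of `R^•_{A,M}(α)`. -/
def refModCochain (t : ℤ) (α : List ℕ) (n : ℕ) :
    Submodule R ((⨂[R] _ : Fin n, A) ⊗[R] M) :=
  ⨆ (β : List ℕ) (_ : IsCoarsening α β ∧ β.length = n + 1), tensorModPiece 𝒜 ℳ t β n

/-- `R^•_{A,M}(α)`, with the bar differential, is exact in positive cohomological degrees. -/
def RefModCochainExact (t : ℤ) (α : List ℕ) : Prop :=
  ∀ n : ℕ, n + 1 < α.length →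
    Subsingleton (Homology (B := fun n => (⨂[R] _ : Fin n, A) ⊗[R] M) (barModD R A M)
      (refModCochain 𝒜 ℳ t α) n)

/-- `T(A_1) ⊗ M_t`. -/
abbrev TM (t : ℤ) : Type _ := TA 𝒜 ⊗[R] ℳ t

/-- The image of `P ⊗ M_t` in `T(A_1) ⊗ M_t`, for `P ⊆ T(A_1)`. -/
def tens (t : ℤ) (P : Submodule R (TA 𝒜)) : Submodule R (TM 𝒜 ℳ t) :=
  LinearMap.range (P.subtype.rTensor (ℳ t))

/-- The multiplication map `T(A_1) ⊗ M_t → M`. -/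
def canMod (t : ℤ) : TM 𝒜 ℳ t →ₗ[R] M :=
  TensorProduct.lift
    (((Algebra.lsmul R R M).toLinearMap ∘ₗ (can 𝒜).toLinearMap).compl₂ (ℳ t).subtype)

/-- `Q^M_{t+d} = ker (A_1^{⊗ d} ⊗ M_t → M_{t+d})`. -/
def QMod (t : ℤ) (d : ℕ) : Submodule R (TM 𝒜 ℳ t) :=
  tens 𝒜 ℳ t (V 𝒜 ^ d) ⊓ LinearMap.ker (canMod 𝒜 ℳ t)

/-- The submodules of `A_1^{⊗ n} ⊗ M_t`, for `0 ≤ i ≤ n - 1`: `A_1^{⊗ i} ⊗ Q_2 ⊗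
A_1^{⊗ (n-i-2)} ⊗ M_t` if `i < n - 1`, and `A_1^{⊗ (n-1)} ⊗ Q^M_{t+1}` if `i = n - 1`. -/
def SMod (t : ℤ) (n i : ℕ) : Submodule R (TM 𝒜 ℳ t) :=
  if i + 1 < n then tens 𝒜 ℳ t (SAlg 𝒜 n i) else V 𝒜 ^ i • QMod 𝒜 ℳ t 1

/-- `A_1^{⊗ n} ⊗ M_t`. -/
abbrev TensorPowMod (t : ℤ) (n : ℕ) : Type _ := ↥(tens 𝒜 ℳ t (V 𝒜 ^ n))

/-- The collection `S^n_{A,M,1}, …, S^n_{A,M,n-1}` of submodules of `A_1^{⊗ (n-1)} ⊗ M_t`. -/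
def SModColl (t : ℤ) (n : ℕ) : Fin (n - 1) → Submodule R (TensorPowMod 𝒜 ℳ t (n - 1)) :=
  fun i => (SMod 𝒜 ℳ t (n - 1) i).submoduleOf (tens 𝒜 ℳ t (V 𝒜 ^ (n - 1)))

/-- `M` is a quadratic module: generated by `M_t`, with relations generated by `Q_2` and
`Q^M_{t+1}`. -/
def IsQuadraticModule (t : ℤ) : Prop :=
  ∀ d : ℕ, (tens 𝒜 ℳ t (V 𝒜 ^ d)).map (canMod 𝒜 ℳ t) = ℳ (t + d) ∧
    QMod 𝒜 ℳ t d = ⨆ i : Fin d, SMod 𝒜 ℳ t d i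

/-- `((M^!)^*)_{t+n}`, i.e. the kernel `⋂_i S^{n+1}_{A,M,i}` of the map from `A_1^{⊗ n} ⊗ M_t` to
`⨁_i A_1^{⊗ (i-1)} ⊗ A_2 ⊗ A_1^{⊗ (n-i-1)} ⊗ M_t ⊕ A_1^{⊗ (n-1)} ⊗ M_{t+1}`. -/
def coMod (t : ℤ) (n : ℕ) : Submodule R (TM 𝒜 ℳ t) :=
  tens 𝒜 ℳ t (V 𝒜 ^ n) ⊓ ⨅ i : Fin n, SMod 𝒜 ℳ t n i

/-- The image of `((A^!)^*)_{β_1} ⊗ ⋯ ⊗ ((A^!)^*)_{β_n} ⊗ ((M^!)^*)_{t + β_{n+1}}` in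
`A_1^{⊗ |β|} ⊗ M_t`. -/
def coModTerm (t : ℤ) : List ℕ → Submodule R (TM 𝒜 ℳ t)
  | [] => ⊥
  | [r] => coMod 𝒜 ℳ t r
  | b :: c :: l => coAlg 𝒜 b • coModTerm t (c :: l)

/-- The canonical map `P ⊗ X → T(A_1) ⊗ M_t`, for `P ⊆ T(A_1)` and `X ⊆ T(A_1) ⊗ M_t`. -/
def smulMap (t : ℤ) (P : Submodule R (TA 𝒜)) (X : Submodule R (TM 𝒜 ℳ t)) :
    P ⊗[R] X →ₗ[R] TM 𝒜 ℳ t :=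
  TensorProduct.lift
    (((Algebra.lsmul R R (TM 𝒜 ℳ t)).toLinearMap ∘ₗ P.subtype).compl₂ X.subtype)

/-- The canonical map from the tensor product onto `coModTerm β` is injective. -/
def CoModTermIsTensor (t : ℤ) : List ℕ → Prop
  | [] => True
  | [_] => True
  | b :: c :: l =>
      Function.Injective (smulMap 𝒜 ℳ t (coAlg 𝒜 b) (coModTerm 𝒜 ℳ t (c :: l))) ∧
        CoModTermIsTensor t (c :: l)

/-- The refinement chain complex `R_•^{A,M}(α)`, with terms
`⨁_{β ≥ α, ℓ(α) - ℓ(β) = k} ((A^!)^* ⊗ (M^!)^*)_β` and the cobar differential, is a well-defined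
complex and is exact in positive homological degrees. -/
def RefModChainExact (t : ℤ) (α : List ℕ) : Prop :=
  (∀ J, CoModTermIsTensor 𝒜 ℳ t (sigma α J)) ∧
    (∀ J K, J ⊆ K → coModTerm 𝒜 ℳ t (sigma α K) ≤ coModTerm 𝒜 ℳ t (sigma α J)) ∧
    CubeChainExact (fun J => coModTerm 𝒜 ℳ t (sigma α J)) ∅

/-- The grading of the opposite algebra. Right `A`-modules are left `Aᵐᵒᵖ`-modules. -/
def opGrading (n : ℕ) : Submodule R Aᵐᵒᵖ :=
  (𝒜 n).map (MulOpposite.opLinearEquiv R : A ≃ₗ[R] Aᵐᵒᵖ).toLinearMap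

end GradedModules

end KoszulDistributive

end

open KoszulDistributive

/-!
The proof reduces every assertion to lattice identities between the submodules `S_{A,M,i}` of
`A_1^{⊗ n} ⊗ M_t`.

*Distributivity is a lattice property.* A collection of submodules is distributive if and only if
it is contained in a distributive sublattice of the lattice of all submodules
(`isDistributive_iff_isDistribSet`). The cube complexes of a collection are iterated mapping cones,
and the maps on (co)homology in degree zero that have to be injective, respectively surjective, are
so by the distributive law. Conversely, exactness of the chain complexes in degree one decomposes
relations between elements of the submodules, which is the distributive law for adjoining one more
member to a distributive set (`isDistribSet_insert`).

*Refinement complexes are mapping cones.* The refinement cochain complex `R(a, b, l)` of a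
composition is the mapping cone of the multiplication `A_a ⊗ R(b, l) → R(a + b, l)`. If `R(b, l)`
is exact in positive degrees, then `R(a, b, l)` is if and only if `R(a + b, l)` is and the cycles
in lowest cohomological degree of `A_a ⊗ R(b, l)` map onto those of `R(a + b, l)`
(`BarModel.refineExact_of_cons`, `BarModel.refineExact_cons`). The term in lowest degree is a
quotient of `A_1^{⊗ n} ⊗ M_t`. Its kernel is the sum of the `S_{A,M,i}` over the places `i` inside
the blocks of the composition (`topKer_eq`), and the preimage of the cycles is the intersection,
over the cuts `p` between blocks, of the sums of this kernel with `S_{A,M,p}` (`topCycles_eq`).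
Hence surjectivity on cycles becomes an inclusion of lattice expressions in the `S_{A,M,i}`, which
holds if the collection is distributive. So distributivity implies exactness of all refinement
cochain complexes (`refineExact_of_isDistribSet`). The strand of internal degree `k + 1` of the bar
complex is `R(1, …, 1, 0)` with `k + 1` ones (`BarModel.strand_eq_refine`), whence Koszulness.

*From Koszulness to distributivity.* If all `R(1, …, 1, 0)` are exact, then so are all
`R(a, 1, …, 1, 0)` with `a > 0`, and the maps above are surjective on cycles
(`refineExact_onesZero`). For one, respectively two parts besides the zero this says that the
module is generated by `M_t` with relations generated by those in degree `t + 1`. In general it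
gives, for every `a`, the inclusion `⋂_{p ≥ a} (S + S_{A,M,p}) ⊆ S + ⋂_{p ≥ a} S_{A,M,p}`, where
`S` is the sum of the `S_{A,M,q}` with `q < a`. By the lattice criterion `isDistribSet_of_proper`
these inclusions suffice once all proper subcollections are distributive. Without the `j`-th member
the collection is made of one in `A_1^{⊗ (j + 1)}` and one in `A_1^{⊗ (n - j - 1)} ⊗ M_t`, which
are distributive by induction; then so is their union in the tensor product, as the quotients by
sums of the `S_{A,M,i}` are tensor products of components of `A` and `M` and therefore flat
(`isDistribSet_tensor`, `flatQuot_sup_SMod`, `isDistribSet_SMod_of_bar`).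

*The algebra.* The bar complex of `A` is that of the module `A_+`, of initial degree one, and the
multiplication `T(A_1) ⊗ A_1 → T(A_1)` identifies the collections of `A_+` with those of `A`. Hence
the assertions on `A` are those on the module `A_+`. There is no circularity: the induction for
`A_+` uses the collections of `A` only in degrees which are already settled
(`isKoszul_iff_isDistribSet`).

*Chain complexes.* For distributive collections the tensor products of the components of the duals
are intersections of members of the collection (`coModTerm_eq`), so that the refinement chain
complexes are cube complexes of members of a distributive lattice.

*Right modules.* Reversal of tensors carries the collections of `A` to those of `A^op`, so that the
theorem for left modules applies to `A^op` (`isDistribSet_SAlg_opGrading`).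
-/

namespace KoszulDistributive

set_option linter.unusedSectionVars false

noncomputable section

/-! ### Distributive sets of elements of a modular lattice -/

section Lattice

/-- A set of elements of a lattice is distributive if it is contained in a distributive
sublattice. The sublattice need not contain the bounds of the ambient lattice. -/
def IsDistribSet {L : Type*} [Lattice L] (X : Set L) : Prop :=
  ∃ E : Sublattice L, (∀ x ∈ E, ∀ y ∈ E, ∀ z ∈ E, x ⊓ (y ⊔ z) ≤ x ⊓ y ⊔ x ⊓ z) ∧ X ⊆ E

theorem IsDistribSet.mono {L : Type*} [Lattice L] {X Y : Set L} (h : IsDistribSet Y)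
    (hXY : X ⊆ Y) : IsDistribSet X :=
  let ⟨E, hE, hY⟩ := h
  ⟨E, hE, hXY.trans hY⟩

theorem IsDistribSet.empty {L : Type*} [Lattice L] : IsDistribSet (∅ : Set L) :=
  ⟨⊥, by simp, by simp⟩

variable {L : Type*} [Lattice L]

/-- The other distributive law follows from the first one inside a sublattice. -/
theorem sup_inf_le_of_distrib {E : Sublattice L}
    (hE : ∀ x ∈ E, ∀ y ∈ E, ∀ z ∈ E, x ⊓ (y ⊔ z) ≤ x ⊓ y ⊔ x ⊓ z) {x y z : L}
    (hx : x ∈ E) (hy : y ∈ E) (hz : z ∈ E) : (x ⊔ y) ⊓ (x ⊔ z) ≤ x ⊔ y ⊓ z := by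
  refine (hE _ (E.sup_mem hx hy) _ hx _ hz).trans (sup_le (inf_le_right.trans le_sup_left) ?_)
  rw [inf_comm]
  refine (hE _ hz _ hx _ hy).trans (sup_le (inf_le_right.trans le_sup_left) ?_)
  rw [inf_comm]
  exact le_sup_right

theorem IsDistribSet.toDual {X : Set L} (h : IsDistribSet X) :
    IsDistribSet (OrderDual.ofDual ⁻¹' X : Set Lᵒᵈ) := by
  obtain ⟨E, hE, hX⟩ := h
  exact ⟨⟨OrderDual.ofDual ⁻¹' E, fun a ha b hb => E.inf_mem ha hb,
    fun a ha b hb => E.sup_mem ha hb⟩,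
    fun x hx y hy z hz => sup_inf_le_of_distrib hE hx hy hz, fun x hx => hX hx⟩

theorem IsDistribSet.ofDual {X : Set L}
    (h : IsDistribSet (OrderDual.ofDual ⁻¹' X : Set Lᵒᵈ)) : IsDistribSet X := h.toDual

/-- The preimage of a distributive set under an injective lattice homomorphism is distributive. -/
theorem IsDistribSet.of_image {L' : Type*} [Lattice L'] (f : LatticeHom L L')
    (hf : Function.Injective f) {X : Set L} (h : IsDistribSet (f '' X)) : IsDistribSet X := by
  obtain ⟨E, hE, hX⟩ := h
  refine ⟨E.comap f, fun x hx y hy z hz => ?_, fun x hx => hX ⟨x, hx, rfl⟩⟩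
  have h := hE _ hx _ hy _ hz
  rw [← map_sup, ← map_inf, ← map_inf, ← map_inf, ← map_sup, ← inf_eq_left, ← map_inf] at h
  exact inf_eq_left.1 (hf h)

theorem IsDistribSet.image {L' : Type*} [Lattice L'] (f : LatticeHom L L')
    {X : Set L} (h : IsDistribSet X) : IsDistribSet (f '' X) := by
  obtain ⟨E, hE, hX⟩ := h
  refine ⟨E.map f, ?_, ?_⟩
  · rintro _ ⟨x, hx, rfl⟩ _ ⟨y, hy, rfl⟩ _ ⟨z, hz, rfl⟩
    have h := OrderHomClass.mono f (hE _ hx _ hy _ hz)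
    simpa only [map_sup, map_inf] using h
  · rintro _ ⟨x, hx, rfl⟩
    exact ⟨x, hX hx, rfl⟩

/-- Adjoining a lower bound preserves distributivity. -/
theorem IsDistribSet.insert_of_le {X : Set L} (h : IsDistribSet X) {c : L}
    (hc : ∀ x ∈ X, c ≤ x) : IsDistribSet (insert c X) := by
  obtain ⟨E, hE, hX⟩ := h
  refine ⟨⟨insert c (E ∩ Set.Ici c), ?_, ?_⟩, ?_, ?_⟩
  · rintro a (rfl | ⟨ha, ha'⟩) b (rfl | ⟨hb, hb'⟩)
    · simp
    · rw [sup_eq_right.2 hb']; exact Or.inr ⟨hb, hb'⟩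
    · rw [sup_eq_left.2 ha']; exact Or.inr ⟨ha, ha'⟩
    · exact Or.inr ⟨E.sup_mem ha hb, le_sup_of_le_left ha'⟩
  · rintro a (rfl | ⟨ha, ha'⟩) b (rfl | ⟨hb, hb'⟩)
    · simp
    · rw [inf_eq_left.2 hb']; exact Or.inl rfl
    · rw [inf_eq_right.2 ha']; exact Or.inl rfl
    · exact Or.inr ⟨E.inf_mem ha hb, le_inf ha' hb'⟩
  · rintro x (rfl | ⟨hx, hx'⟩) y (rfl | ⟨hy, hy'⟩) z (rfl | ⟨hz, hz'⟩)
    · simp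
    · exact le_sup_of_le_left (by simp)
    · exact le_sup_of_le_right (by simp)
    · refine le_sup_of_le_left (inf_le_left.trans (le_inf le_rfl hy'))
    · simp
    · rw [sup_eq_right.2 hz']; exact le_sup_right
    · rw [sup_eq_left.2 hy']; exact le_sup_left
    · exact hE _ hx _ hy _ hz
  · rintro x (rfl | hx)
    · exact Or.inl rfl
    · exact Or.inr ⟨hX hx, hc x hx⟩

theorem IsDistribSet.insert_of_ge {X : Set L} (h : IsDistribSet X) {c : L}
    (hc : ∀ x ∈ X, x ≤ c) : IsDistribSet (insert c X) :=
  (h.toDual.insert_of_le (c := OrderDual.toDual c) fun _ hx => hc _ hx).ofDual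

/-- The sublattice in the definition may be taken bounded. -/
theorem IsDistribSet.exists_bounded [BoundedOrder L] {X : Set L} (h : IsDistribSet X) :
    ∃ E : Sublattice L, (∀ x ∈ E, ∀ y ∈ E, ∀ z ∈ E, x ⊓ (y ⊔ z) ≤ x ⊓ y ⊔ x ⊓ z) ∧ X ⊆ E ∧
      ⊥ ∈ E ∧ ⊤ ∈ E := by
  obtain ⟨E, hE, hX⟩ := (h.insert_of_le (c := ⊥) (by simp)).insert_of_ge (c := ⊤) (by simp)
  exact ⟨E, hE, fun x hx => hX (by simp [hx]), hX (by simp), hX (by simp)⟩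

theorem Sublattice.finset_sup_mem {ι : Type*} [OrderBot L] {E : Sublattice L} (h : ⊥ ∈ E)
    {f : ι → L} (s : Finset ι) (hf : ∀ i ∈ s, f i ∈ E) : s.sup f ∈ E :=
  Finset.sup_induction h (fun _ ha _ hb => E.sup_mem ha hb) hf

theorem Sublattice.finset_inf_mem {ι : Type*} [OrderTop L] {E : Sublattice L} (h : ⊤ ∈ E)
    {f : ι → L} (s : Finset ι) (hf : ∀ i ∈ s, f i ∈ E) : s.inf f ∈ E :=
  Finset.inf_induction h (fun _ ha _ hb => E.inf_mem ha hb) hf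

theorem inf_finset_sup_le {ι : Type*} [BoundedOrder L] {E : Sublattice L}
    (hE : ∀ x ∈ E, ∀ y ∈ E, ∀ z ∈ E, x ⊓ (y ⊔ z) ≤ x ⊓ y ⊔ x ⊓ z) (hb : ⊥ ∈ E)
    {f : ι → L} (s : Finset ι) (hf : ∀ i ∈ s, f i ∈ E) {x : L} (hx : x ∈ E) :
    x ⊓ s.sup f ≤ s.sup fun i => x ⊓ f i := by
  classical
  induction s using Finset.induction_on with
  | empty => simp
  | insert a s ha ih =>
    rw [Finset.sup_insert, Finset.sup_insert]
    have h := fun i hi => hf i (Finset.mem_insert_of_mem hi)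
    exact (hE _ hx _ (hf a (Finset.mem_insert_self _ _)) _
      (Sublattice.finset_sup_mem hb s h)).trans (sup_le_sup le_rfl (ih h))

theorem finset_inf_sup_le {ι : Type*} [BoundedOrder L] {E : Sublattice L}
    (hE : ∀ x ∈ E, ∀ y ∈ E, ∀ z ∈ E, x ⊓ (y ⊔ z) ≤ x ⊓ y ⊔ x ⊓ z) (ht : ⊤ ∈ E)
    {f : ι → L} (s : Finset ι) (hf : ∀ i ∈ s, f i ∈ E) {x : L} (hx : x ∈ E) :
    (s.inf fun i => x ⊔ f i) ≤ x ⊔ s.inf f := by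
  classical
  induction s using Finset.induction_on with
  | empty => simp
  | insert a s ha ih =>
    rw [Finset.inf_insert, Finset.inf_insert]
    have h := fun i hi => hf i (Finset.mem_insert_of_mem hi)
    exact (inf_le_inf le_rfl (ih h)).trans (sup_inf_le_of_distrib hE hx
      (hf a (Finset.mem_insert_self _ _)) (Sublattice.finset_inf_mem ht s h))

/-- If `E` is a bounded distributive sublattice of a modular lattice and `x ↦ x ⊔ N` preserves
meets of elements of `E`, then `N` can be adjoined to `E`: the elements `p ⊔ q ⊓ N` with `p ≤ q`
in `E` form a distributive sublattice. -/
theorem isDistribSet_insert_sublattice [IsModularLattice L] [BoundedOrder L] {E : Sublattice L}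
    (hE : ∀ x ∈ E, ∀ y ∈ E, ∀ z ∈ E, x ⊓ (y ⊔ z) ≤ x ⊓ y ⊔ x ⊓ z) (hb : ⊥ ∈ E) (ht : ⊤ ∈ E)
    {N : L} (hN : ∀ p ∈ E, ∀ q ∈ E, (p ⊔ N) ⊓ (q ⊔ N) ≤ p ⊓ q ⊔ N) :
    IsDistribSet (insert N (E : Set L)) := by
  have hmod : ∀ p q : L, p ≤ q → p ⊔ q ⊓ N = q ⊓ (p ⊔ N) := fun p q hpq => by
    rw [inf_comm q (p ⊔ N), sup_inf_assoc_of_le _ hpq, inf_comm N]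
  have hN' : ∀ p ∈ E, ∀ q ∈ E, (p ⊔ q) ⊓ N ≤ p ⊓ N ⊔ q ⊓ N := by
    intro p hp q hq
    -- distributivity of a triple in a modular lattice does not depend on the order
    have h1 : (p ⊔ q) ⊓ N ≤ (p ⊔ q ⊓ (p ⊔ N)) := by
      rw [← sup_inf_assoc_of_le _ le_sup_left]
      exact inf_le_inf le_rfl le_sup_right
    have h2 : (p ⊔ q) ⊓ N ≤ (p ⊓ N) ⊔ q ⊓ (p ⊔ N) := by
      have h3 : (p ⊔ q) ⊓ N ≤ (p ⊔ q ⊓ (p ⊔ N)) ⊓ N := le_inf h1 inf_le_right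
      have h4 : q ⊓ (p ⊔ N) ≤ p ⊓ q ⊔ N :=
        le_trans (le_inf inf_le_right (inf_le_left.trans le_sup_left)) (hN p hp q hq)
      have h5 : q ⊓ (p ⊔ N) = p ⊓ q ⊔ q ⊓ N := by
        apply le_antisymm
        · rw [hmod _ _ inf_le_right]
          exact le_inf inf_le_left h4
        · exact sup_le (le_inf inf_le_right (inf_le_left.trans le_sup_left))
            (le_inf inf_le_left (inf_le_right.trans le_sup_right))
      rw [h5, ← sup_assoc, sup_eq_left.2 (inf_le_left : p ⊓ q ≤ p)] at h3
      have h6 : (p ⊔ q ⊓ N) ⊓ N = p ⊓ N ⊔ q ⊓ N := by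
        rw [inf_comm, sup_comm, inf_comm N, sup_inf_assoc_of_le _ inf_le_right, sup_comm]
      rw [h6] at h3
      exact h3.trans (sup_le_sup le_rfl (le_inf inf_le_left (inf_le_right.trans le_sup_right)))
    have h7 : (p ⊔ q) ⊓ N ≤ (p ⊓ N ⊔ q ⊓ (p ⊔ N)) ⊓ N := le_inf h2 inf_le_right
    rw [sup_inf_assoc_of_le _ inf_le_right] at h7
    refine h7.trans (sup_le_sup le_rfl (le_inf (inf_le_left.trans inf_le_left) inf_le_right))
  have hsup : ∀ p ∈ E, ∀ q ∈ E, ∀ p' ∈ E, ∀ q' ∈ E,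
      (p ⊔ q ⊓ N) ⊔ (p' ⊔ q' ⊓ N) = (p ⊔ p') ⊔ (q ⊔ q') ⊓ N := by
    intro p hp q hq p' hp' q' hq'
    rw [sup_sup_sup_comm]
    refine le_antisymm (sup_le_sup le_rfl (sup_le (inf_le_inf le_sup_left le_rfl)
      (inf_le_inf le_sup_right le_rfl))) (sup_le_sup le_rfl (hN' q hq q' hq'))
  have hinf : ∀ p ∈ E, ∀ q ∈ E, ∀ p' ∈ E, ∀ q' ∈ E, p ≤ q → p' ≤ q' →
      (p ⊔ q ⊓ N) ⊓ (p' ⊔ q' ⊓ N) = (p ⊓ p') ⊔ (q ⊓ q') ⊓ N := by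
    intro p hp q hq p' hp' q' hq' h h'
    rw [hmod _ _ h, hmod _ _ h', hmod _ _ (inf_le_inf h h'), inf_inf_inf_comm]
    exact le_antisymm (inf_le_inf le_rfl (hN p hp p' hp'))
      (inf_le_inf le_rfl (le_inf (sup_le_sup inf_le_left le_rfl) (sup_le_sup inf_le_right le_rfl)))
  refine ⟨⟨{x | ∃ p ∈ E, ∃ q ∈ E, p ≤ q ∧ x = p ⊔ q ⊓ N}, ?_, ?_⟩, ?_, ?_⟩
  · rintro _ ⟨p, hp, q, hq, h, rfl⟩ _ ⟨p', hp', q', hq', h', rfl⟩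
    exact ⟨_, E.sup_mem hp hp', _, E.sup_mem hq hq', sup_le_sup h h', hsup p hp q hq p' hp' q' hq'⟩
  · rintro _ ⟨p, hp, q, hq, h, rfl⟩ _ ⟨p', hp', q', hq', h', rfl⟩
    exact ⟨_, E.inf_mem hp hp', _, E.inf_mem hq hq', inf_le_inf h h',
      hinf p hp q hq p' hp' q' hq' h h'⟩
  · rintro _ ⟨p, hp, q, hq, h, rfl⟩ _ ⟨p', hp', q', hq', h', rfl⟩ _ ⟨r, hr, s, hs, h'', rfl⟩
    rw [hsup p' hp' q' hq' r hr s hs, hinf p hp q hq _ (E.sup_mem hp' hr) _ (E.sup_mem hq' hs) h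
      (sup_le_sup h' h''), hinf p hp q hq p' hp' q' hq' h h', hinf p hp q hq r hr s hs h h'',
      hsup _ (E.inf_mem hp hp') _ (E.inf_mem hq hq') _ (E.inf_mem hp hr) _ (E.inf_mem hq hs)]
    exact sup_le_sup (hE p hp p' hp' r hr) (inf_le_inf (hE q hq q' hq' s hs) le_rfl)
  · rintro x (rfl | hx)
    · exact ⟨⊥, hb, ⊤, ht, bot_le, by simp⟩
    · exact ⟨x, hx, x, hx, le_rfl, by simp⟩

/-- Adjoining one element `N` to a distributive family `X`: it suffices that the family
`X i ⊔ N` is distributive and that `· ⊔ N` preserves finite meets of members of the family. -/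
theorem isDistribSet_insert [IsModularLattice L] [BoundedOrder L] {ι : Type*} [DecidableEq ι]
    {s : Finset ι} {X : ι → L} {N : L} (h : IsDistribSet (X '' s))
    (hN : IsDistribSet ((fun i => X i ⊔ N) '' s))
    (hinf : ∀ F ⊆ s, (F.inf fun i => X i ⊔ N) ≤ F.inf X ⊔ N) :
    IsDistribSet (insert N (X '' s)) := by
  obtain ⟨E, hE, hX, hb, ht⟩ := h.exists_bounded
  obtain ⟨E', hE', hX'⟩ := (hN.insert_of_ge (c := ⊤) (by simp)).insert_of_le (c := N) (by
    rintro _ (rfl | ⟨i, _, rfl⟩) <;> simp)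
  have ht' : ⊤ ∈ E' := hX' (by simp)
  have hX'' : ∀ i ∈ s, X i ⊔ N ∈ E' := fun i hi => hX' (Or.inr (Or.inr ⟨i, hi, rfl⟩))
  -- finite joins of finite meets of members of the family
  let D : Set L := insert ⊥ {x | ∃ F ⊆ s, x = F.inf X}
  have hDE : D ⊆ E := by
    rintro x (rfl | ⟨F, hF, rfl⟩)
    · exact hb
    · exact Sublattice.finset_inf_mem ht F fun i hi => hX ⟨i, hF hi, rfl⟩
  have hDinf : ∀ x ∈ D, ∀ y ∈ D, x ⊓ y ∈ D := by
    rintro x (rfl | ⟨F, hF, rfl⟩) y (rfl | ⟨G, hG, rfl⟩)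
    · exact Or.inl (by simp)
    · exact Or.inl (by simp)
    · exact Or.inl (by simp)
    · exact Or.inr ⟨F ∪ G, Finset.union_subset hF hG, Finset.inf_union.symm⟩
  -- joining with `N` preserves meets of elements of `D` by assumption, and then meets of finite
  -- joins of such elements by distributivity in `E` and in `E'`
  have hDN : ∀ x ∈ D, x ⊔ N ∈ E' ∧ ∀ y ∈ D, (x ⊔ N) ⊓ (y ⊔ N) ≤ x ⊓ y ⊔ N := by
    have hmono : ∀ F : Finset ι, F.inf X ⊔ N ≤ F.inf fun i => X i ⊔ N := fun F =>
      Finset.le_inf fun i hi => sup_le_sup (Finset.inf_le hi) le_rfl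
    rintro x (rfl | ⟨F, hF, rfl⟩)
    · refine ⟨hX' (by rw [bot_sup_eq]; exact Or.inl rfl), fun y _ => by simp⟩
    · refine ⟨?_, ?_⟩
      · rw [le_antisymm (hmono F) (hinf F hF)]
        exact Sublattice.finset_inf_mem ht' F fun i hi => hX'' i (hF hi)
      · rintro y (rfl | ⟨G, hG, rfl⟩)
        · simp
        · rw [← Finset.inf_union]
          refine le_trans ?_ (hinf _ (Finset.union_subset hF hG))
          rw [Finset.inf_union]
          exact inf_le_inf (hmono F) (hmono G)
  have hKE : supClosure D ⊆ E := supClosure_min hDE fun a ha b hb => E.sup_mem ha hb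
  -- the finite joins of elements of `D` form a sublattice
  have hK1 : ∀ x ∈ D, ∀ y ∈ supClosure D, x ⊓ y ∈ supClosure D := by
    intro x hx
    suffices supClosure D ⊆ {y | y ∈ E ∧ x ⊓ y ∈ supClosure D} from fun y hy => (this hy).2
    refine supClosure_min (fun y hy => ⟨hDE hy, subset_supClosure (hDinf x hx y hy)⟩) ?_
    rintro a ⟨ha, ha'⟩ b ⟨hb, hb'⟩
    refine ⟨E.sup_mem ha hb, ?_⟩
    rw [le_antisymm (hE _ (hDE hx) _ ha _ hb) le_inf_sup]
    exact supClosed_supClosure ha' hb'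
  have hK2 : ∀ y ∈ supClosure D, ∀ x ∈ supClosure D, x ⊓ y ∈ supClosure D := by
    intro y hy
    suffices supClosure D ⊆ {x | x ∈ E ∧ x ⊓ y ∈ supClosure D} from fun x hx => (this hx).2
    refine supClosure_min (fun x hx => ⟨hDE hx, hK1 x hx y hy⟩) ?_
    rintro a ⟨ha, ha'⟩ b ⟨hb, hb'⟩
    refine ⟨E.sup_mem ha hb, ?_⟩
    rw [inf_comm, le_antisymm (hE _ (hKE hy) _ ha _ hb) le_inf_sup, inf_comm y, inf_comm y]
    exact supClosed_supClosure ha' hb'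
  have hKN : supClosure D ⊆ {x | x ⊔ N ∈ E'} := by
    refine supClosure_min (fun x hx => (hDN x hx).1) fun a ha b hb => ?_
    change a ⊔ b ⊔ N ∈ E'
    rw [sup_sup_distrib_right]
    exact E'.sup_mem ha hb
  have hN1 : ∀ x ∈ D, ∀ y ∈ supClosure D, (x ⊔ N) ⊓ (y ⊔ N) ≤ x ⊓ y ⊔ N := by
    intro x hx
    suffices supClosure D ⊆ {y | y ⊔ N ∈ E' ∧ (x ⊔ N) ⊓ (y ⊔ N) ≤ x ⊓ y ⊔ N} from
      fun y hy => (this hy).2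
    refine supClosure_min (fun y hy => ⟨(hDN y hy).1, (hDN x hx).2 y hy⟩) ?_
    rintro a ⟨ha, ha'⟩ b ⟨hb, hb'⟩
    have hab : a ⊔ b ⊔ N = (a ⊔ N) ⊔ (b ⊔ N) := sup_sup_distrib_right _ _ _
    refine ⟨show a ⊔ b ⊔ N ∈ E' from hab ▸ E'.sup_mem ha hb, ?_⟩
    rw [hab]
    exact (hE' _ (hDN x hx).1 _ ha _ hb).trans (sup_le
      (ha'.trans (sup_le_sup (inf_le_inf le_rfl le_sup_left) le_rfl))
      (hb'.trans (sup_le_sup (inf_le_inf le_rfl le_sup_right) le_rfl)))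
  have hN2 : ∀ y ∈ supClosure D, ∀ x ∈ supClosure D, (x ⊔ N) ⊓ (y ⊔ N) ≤ x ⊓ y ⊔ N := by
    intro y hy
    suffices supClosure D ⊆ {x | x ⊔ N ∈ E' ∧ (x ⊔ N) ⊓ (y ⊔ N) ≤ x ⊓ y ⊔ N} from
      fun x hx => (this hx).2
    refine supClosure_min (fun x hx => ⟨(hDN x hx).1, hN1 x hx y hy⟩) ?_
    rintro a ⟨ha, ha'⟩ b ⟨hb, hb'⟩
    have hab : a ⊔ b ⊔ N = (a ⊔ N) ⊔ (b ⊔ N) := sup_sup_distrib_right _ _ _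
    refine ⟨show a ⊔ b ⊔ N ∈ E' from hab ▸ E'.sup_mem ha hb, ?_⟩
    rw [hab, inf_comm]
    refine (hE' _ (hKN hy) _ ha _ hb).trans (sup_le ?_ ?_)
    · rw [inf_comm]
      exact ha'.trans (sup_le_sup (inf_le_inf le_sup_left le_rfl) le_rfl)
    · rw [inf_comm]
      exact hb'.trans (sup_le_sup (inf_le_inf le_sup_right le_rfl) le_rfl)
  let K : Sublattice L := ⟨supClosure D, supClosed_supClosure, fun a ha b hb => hK2 b hb a ha⟩
  have hXD : ∀ i ∈ s, X i ∈ D := fun i hi => Or.inr ⟨{i}, by simpa using hi, by simp⟩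
  refine (isDistribSet_insert_sublattice (E := K)
    (fun x hx y hy z hz => hE x (hKE hx) y (hKE hy) z (hKE hz))
    (subset_supClosure (Or.inl rfl)) (subset_supClosure (Or.inr ⟨∅, by simp, by simp⟩))
    fun p hp q hq => hN2 q hq p hp).mono (Set.insert_subset_insert ?_)
  rintro _ ⟨i, hi, rfl⟩
  exact subset_supClosure (hXD i hi)

/-- The order dual of `isDistribSet_insert`. -/
theorem isDistribSet_insert_dual [IsModularLattice L] [BoundedOrder L] {ι : Type*} [DecidableEq ι]
    {s : Finset ι} {X : ι → L} {N : L} (h : IsDistribSet (X '' s))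
    (hN : IsDistribSet ((fun i => X i ⊓ N) '' s))
    (hsup : ∀ F ⊆ s, F.sup X ⊓ N ≤ F.sup fun i => X i ⊓ N) :
    IsDistribSet (insert N (X '' s)) := by
  have := isDistribSet_insert (L := Lᵒᵈ) (s := s) (X := fun i => OrderDual.toDual (X i))
    (N := OrderDual.toDual N) h.toDual hN.toDual (fun F hF => hsup F hF)
  exact IsDistribSet.ofDual (X := insert N (X '' s)) this

/-- The criterion that drives the induction: a family all of whose proper subfamilies are
distributive is itself distributive as soon as, for every `a`, joining with `⨆ q < a, N q` preserves
the meet of the `N p` with `p ≥ a`. -/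
theorem isDistribSet_of_proper [IsModularLattice L] [BoundedOrder L] {n : ℕ} {N : ℕ → L}
    (hprop : ∀ j < n, IsDistribSet (N '' ((Finset.range n).erase j)))
    (htriple : ∀ a, 1 ≤ a → a < n →
      ((Finset.Ico a n).inf fun p => (Finset.range a).sup N ⊔ N p) ≤
        (Finset.range a).sup N ⊔ (Finset.Ico a n).inf N) :
    IsDistribSet (N '' (Finset.range n)) := by
  -- descending induction on `j`, adding `S = ⨆ q < j, N q` to the members from the `j`-th on: by
  -- `isDistribSet_insert` the family for `j` is distributive if its members after the `j`-th are,
  -- and if so is the family for `j + 1`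
  suffices h : ∀ k j, j + k = n →
      IsDistribSet ((fun i => (Finset.range j).sup N ⊔ N i) '' (Finset.Ico j n)) by
    have h0 := h n 0 (by simp)
    simpa using h0
  intro k
  induction k with
  | zero => rintro j rfl; simpa using IsDistribSet.empty
  | succ k ih =>
    intro j hj
    have hjn : j < n := by omega
    set S := (Finset.range j).sup N with hS
    have hS' : (Finset.range (j + 1)).sup N = S ⊔ N j := by
      rw [Finset.range_add_one, Finset.sup_insert, sup_comm]
    obtain ⟨E, hE, hX, hb, ht⟩ := (hprop j hjn).exists_bounded
    have hSE : S ∈ E := Sublattice.finset_sup_mem hb _ fun i hi => hX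
      ⟨i, by simp at hi ⊢; omega, rfl⟩
    have hE1 : ∀ i ∈ Finset.Ico (j + 1) n, S ⊔ N i ∈ E := fun i hi =>
      E.sup_mem hSE (hX ⟨i, by simp at hi ⊢; omega, rfl⟩)
    have key := isDistribSet_insert (s := Finset.Ico (j + 1) n) (X := fun i => S ⊔ N i)
      (N := S ⊔ N j) ⟨E, hE, by rintro _ ⟨i, hi, rfl⟩; exact hE1 i hi⟩ ?_ ?_
    · refine key.mono ?_
      rintro _ ⟨i, hi, rfl⟩
      rcases eq_or_ne i j with rfl | hne
      · exact Or.inl rfl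
      · exact Or.inr ⟨i, by simp at hi ⊢; omega, rfl⟩
    · have := ih (j + 1) (by omega)
      rw [hS'] at this
      have e : (fun i => S ⊔ N i ⊔ (S ⊔ N j)) = fun i => S ⊔ N j ⊔ N i := by
        funext i
        rw [← sup_sup_distrib_left, sup_comm (N i), sup_assoc]
      rwa [e]
    · intro F hF
      -- if `F` omits a member, the identity holds in a proper subfamily
      rcases eq_or_ne F (Finset.Ico (j + 1) n) with rfl | hne
      · rcases Nat.lt_or_ge (j + 1) n with hlt | hge
        · have := htriple (j + 1) (by omega) hlt
          rw [hS'] at this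
          refine le_trans (Finset.inf_mono_fun ?_) (this.trans ?_)
          · intro i _
            exact sup_le (sup_le (le_sup_left.trans le_sup_left) le_sup_right) le_sup_left
          · exact sup_le le_sup_right (le_sup_of_le_left (Finset.inf_mono_fun fun i _ =>
              le_sup_right))
        · rw [Finset.Ico_eq_empty (by omega)]; simp
      · obtain ⟨i₀, hi₀, hi₀F⟩ := Finset.exists_of_ssubset (hF.ssubset_of_ne hne)
        have hi₀' := Finset.mem_Ico.1 hi₀
        obtain ⟨E', hE', hX', hb', ht'⟩ := (hprop i₀ hi₀'.2).exists_bounded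
        have hm : ∀ i < n, i ≠ i₀ → N i ∈ E' := fun i hi hne => hX'
          ⟨i, by simp [hi, hne], rfl⟩
        have hSE' : S ∈ E' := Sublattice.finset_sup_mem hb' _ fun i hi =>
          hm i (by simp at hi; omega) (by simp at hi; omega)
        have := finset_inf_sup_le hE' ht' F (f := fun i => S ⊔ N i) (x := S ⊔ N j)
          (fun i hi => E'.sup_mem hSE' (hm i (by have := hF hi; simp at this; omega)
            (by rintro rfl; exact hi₀F hi)))
          (E'.sup_mem hSE' (hm j hjn (by omega)))
        simpa only [sup_comm (S ⊔ N j)] using this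

end Lattice

/-! ### Cube complexes as iterated mapping cones -/

section Signs

/-- The properties of the signs `sgn` that make the cube complexes iterated mapping cones. -/
structure IsConeSign {ι : Type*} [LinearOrder ι] (s : ι → Finset ι → ℤ) (G : Finset ι) :
    Prop where
  mul_self : ∀ j J, s j J * s j J = 1
  insert_of_lt : ∀ a ∈ G, ∀ j ∈ G, a < j → ∀ J, s j (insert a J) = s j J
  of_forall_lt : ∀ a ∈ G, ∀ J ⊆ G, (∀ x ∈ J, a < x) → s a J = s a ∅ * (-1) ^ J.card

theorem IsConeSign.mono {ι : Type*} [LinearOrder ι] {s : ι → Finset ι → ℤ} {G G' : Finset ι}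
    (h : IsConeSign s G) (hG : G' ⊆ G) : IsConeSign s G' :=
  ⟨h.1, fun a ha j hj => h.2 a (hG ha) j (hG hj), fun a ha J hJ => h.3 a (hG ha) J (hJ.trans hG)⟩

theorem sgn_mul_self {m : ℕ} (j : Fin m) (J : Finset (Fin m)) : sgn j J * sgn j J = 1 := by
  unfold sgn; rw [← pow_add, ← two_mul, pow_mul]; simp

theorem sgn_insert_of_lt {m : ℕ} {a j : Fin m} (h : a < j) (J : Finset (Fin m)) :
    sgn j (insert a J) = sgn j J := by
  unfold sgn; rw [Finset.filter_insert, if_neg (not_lt.2 h.le)]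

theorem sgn_insert_of_gt {m : ℕ} {a j : Fin m} (h : j < a) {J : Finset (Fin m)} (ha : a ∉ J) :
    sgn j (insert a J) = - sgn j J := by
  unfold sgn
  rw [Finset.filter_insert, if_pos h, Finset.card_insert_of_notMem (by simp [ha]), pow_succ]
  ring

/-- Relative to a fixed `I`, the signs of the cube complexes are compatible with removing the
least element outside `I`. -/
theorem isConeSign_sgn {m : ℕ} (I : Finset (Fin m)) :
    IsConeSign (fun j J => sgn j (I ∪ J)) Iᶜ where
  mul_self j J := sgn_mul_self _ _
  insert_of_lt a _ j _ h J := by rw [Finset.union_insert, sgn_insert_of_lt h]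
  of_forall_lt a _ J hJ h := by
    unfold sgn
    rw [Finset.union_empty, ← pow_add, Finset.filter_union, Finset.card_union_of_disjoint,
      Finset.filter_true_of_mem h]
    exact Finset.disjoint_filter_filter
      (Finset.disjoint_left.2 fun x hx hx' => (Finset.mem_compl.1 (hJ hx')) hx)

end Signs

section Cubes

variable {R : Type u} [CommRing R] {W : Type v} [AddCommGroup W] [Module R W]

/-- Exactness in positive degrees of the chain complex with terms `⨁_{J ⊆ G, |J| = k} X J`. -/
def CubeChEx {ι : Type*} [DecidableEq ι] (s : ι → Finset ι → ℤ) (G : Finset ι)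
    (X : Finset ι → Submodule R W) : Prop :=
  ∀ (k : ℕ) (c : Finset ι → W), (∀ J ∈ G.powersetCard (k + 1), c J ∈ X J) →
    (∀ J ∈ G.powersetCard k, ∑ j ∈ G \ J, s j J • c (insert j J) = 0) →
    ∃ b : Finset ι → W, (∀ J ∈ G.powersetCard (k + 2), b J ∈ X J) ∧
      ∀ J ∈ G.powersetCard (k + 1), ∑ j ∈ G \ J, s j J • b (insert j J) = c J

/-- Exactness in positive degrees of the cochain complex with terms
`⨁_{J ⊆ G, |J| = k} W / X J`, expressed by representatives in `W`. -/
def CubeCoEx {ι : Type*} [DecidableEq ι] (s : ι → Finset ι → ℤ) (G : Finset ι)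
    (X : Finset ι → Submodule R W) : Prop :=
  ∀ (k : ℕ) (c : Finset ι → W),
    (∀ K ∈ G.powersetCard (k + 2), ∑ j ∈ K, s j (K.erase j) • c (K.erase j) ∈ X K) →
    ∃ b : Finset ι → W, ∀ J ∈ G.powersetCard (k + 1),
      c J - ∑ j ∈ J, s j (J.erase j) • b (J.erase j) ∈ X J

variable {ι : Type*} [LinearOrder ι] {s : ι → Finset ι → ℤ} {G : Finset ι} {a : ι}
  {X : Finset ι → Submodule R W}

theorem powersetCard_insert_cases {k : ℕ} (ha : a ∉ G) {J : Finset ι}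
    (hJ : J ∈ (insert a G).powersetCard k) :
    J ∈ G.powersetCard k ∨ ∃ k' K, k = k' + 1 ∧ K ∈ G.powersetCard k' ∧ J = insert a K := by
  cases k with
  | zero => left; simp at hJ ⊢; exact hJ
  | succ k =>
    rw [Finset.powersetCard_succ_insert ha, Finset.mem_union, Finset.mem_image] at hJ
    rcases hJ with h | ⟨K, hK, rfl⟩
    · exact Or.inl h
    · exact Or.inr ⟨k, K, rfl, hK, rfl⟩

theorem notMem_of_mem_powersetCard {ι : Type*} {G : Finset ι} {a : ι} {k : ℕ} (ha : a ∉ G)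
    {J : Finset ι} (hJ : J ∈ G.powersetCard k) : a ∉ J := fun h =>
  ha ((Finset.mem_powersetCard.1 hJ).1 h)

theorem insert_mem_powersetCard {k : ℕ} (ha : a ∉ G) {J : Finset ι}
    (hJ : J ∈ G.powersetCard k) : insert a J ∈ (insert a G).powersetCard (k + 1) := by
  rw [Finset.powersetCard_succ_insert ha]
  exact Finset.mem_union_right _ (Finset.mem_image_of_mem _ hJ)

theorem mem_powersetCard_insert {k : ℕ} {J : Finset ι}
    (hJ : J ∈ G.powersetCard k) : J ∈ (insert a G).powersetCard k :=
  Finset.powersetCard_mono (Finset.subset_insert _ _) hJ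

theorem sum_insert_sdiff_insert (f : ι → W) (ha : a ∉ G) (J : Finset ι) :
    ∑ j ∈ insert a G \ insert a J, f j = ∑ j ∈ G \ J, f j := by
  congr 1
  ext x
  simp only [Finset.mem_sdiff, Finset.mem_insert]
  constructor
  · rintro ⟨rfl | h, h'⟩
    · simp at h'
    · exact ⟨h, fun hx => h' (Or.inr hx)⟩
  · rintro ⟨h, h'⟩
    exact ⟨Or.inr h, by rintro (rfl | h''); exacts [ha h, h' h'']⟩

theorem sum_insert_sdiff (f : ι → W) (ha : a ∉ G) {J : Finset ι} (hJ : a ∉ J) :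
    ∑ j ∈ insert a G \ J, f j = f a + ∑ j ∈ G \ J, f j := by
  rw [Finset.insert_sdiff_of_notMem _ hJ, Finset.sum_insert (by simp [ha])]

/-- If `a < min G`, the complex over `insert a G` is the mapping cone of the inclusion of the
complex with terms `X (insert a J)` into the one with terms `X J`, for `J ⊆ G`. By the long exact
sequence it is exact in positive degrees if both are and the map on homology in degree zero is
injective, which is `h0`. -/
theorem cubeChEx_insert (hs : IsConeSign s (insert a G)) (hlt : ∀ x ∈ G, a < x)
    (hX : Antitone X) (h1 : CubeChEx s G X) (h2 : CubeChEx s G fun J => X (insert a J))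
    (h0 : X {a} ⊓ G.sup (fun j => X {j}) ≤ G.sup fun j => X {a, j}) :
    CubeChEx s (insert a G) X := by
  classical
  intro k c hc hcyc
  have ha : a ∉ G := fun h => lt_irrefl _ (hlt a h)
  have haG := Finset.mem_insert_self a G
  have hmem : ∀ {j}, j ∈ G → j ∈ insert a G := fun h => Finset.mem_insert_of_mem h
  have hsub : ∀ {l} {J : Finset ι}, J ∈ G.powersetCard l → J ⊆ G := fun h =>
    (Finset.mem_powersetCard.1 h).1
  have hε : ∀ {l} {J : Finset ι}, J ∈ G.powersetCard l → s a J = s a ∅ * (-1) ^ l := by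
    intro l J hJ
    rw [hs.of_forall_lt a haG J ((hsub hJ).trans (Finset.subset_insert _ _))
      fun x hx => hlt x (hsub hJ hx), (Finset.mem_powersetCard.1 hJ).2]
  have hd : ∀ (f : Finset ι → W) (J : Finset ι),
      ∑ j ∈ insert a G \ insert a J, s j (insert a J) • f (insert j (insert a J)) =
        ∑ j ∈ G \ J, s j J • f (insert a (insert j J)) := by
    intro f J
    rw [sum_insert_sdiff_insert _ ha]
    refine Finset.sum_congr rfl fun j hj => ?_
    have hj := (Finset.mem_sdiff.1 hj).1
    rw [hs.insert_of_lt a haG j (hmem hj) (hlt j hj), Finset.insert_comm]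
  -- the component of the cycle at the subsets containing `a` is a boundary
  have key : ∃ e : Finset ι → W, (∀ J ∈ G.powersetCard (k + 1), e J ∈ X (insert a J)) ∧
      ∀ J ∈ G.powersetCard k, ∑ j ∈ G \ J, s j J • e (insert j J) = c (insert a J) := by
    cases k with
    | succ k =>
      refine h2 k (fun J => c (insert a J)) (fun J hJ => hc _ (insert_mem_powersetCard ha hJ)) ?_
      intro J hJ
      rw [← hd]
      exact hcyc _ (insert_mem_powersetCard ha hJ)
    | zero =>
      have hw : c {a} ∈ X {a} := hc _ (by simp)
      have h3 := hcyc ∅ (by simp)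
      rw [sum_insert_sdiff _ ha (by simp)] at h3
      have h4 : c {a} ∈ G.sup fun j => X {j} := by
        have h5 : c {a} = - s a ∅ • ∑ j ∈ G \ ∅, s j ∅ • c (insert j ∅) := by
          rw [neg_smul, eq_neg_iff_add_eq_zero]
          have := congrArg (s a ∅ • ·) h3
          simp only [smul_add, smul_zero, smul_smul, hs.mul_self, one_smul] at this
          exact this
        rw [h5]
        refine zsmul_mem (sum_mem fun j hj => zsmul_mem ?_ _) _
        exact (Finset.le_sup (f := fun j => X {j}) (by simpa using hj))
          (hc {j} (by simpa using Or.inr hj))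
      obtain ⟨u, hu⟩ := (Submodule.mem_iSup_finset_iff_exists_sum (fun j => X {a, j}) _).1
        (by simpa only [Finset.sup_eq_iSup] using h0 ⟨hw, h4⟩)
      refine ⟨fun J => ∑ j ∈ J, s j ∅ • (u j : W), ?_, ?_⟩
      · intro J hJ
        obtain ⟨j, rfl⟩ := Finset.card_eq_one.1 (Finset.mem_powersetCard.1 hJ).2
        simpa using zsmul_mem (u j).2 _
      · intro J hJ
        obtain rfl := Finset.card_eq_zero.1 (Finset.mem_powersetCard.1 hJ).2
        simp only [Finset.sdiff_empty, insert_empty_eq, Finset.sum_singleton, smul_smul,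
          hs.mul_self, one_smul]
        exact hu
  obtain ⟨e, he, hde⟩ := key
  obtain ⟨b, hb, hdb⟩ := h1 k (fun J => c J - (s a ∅ * (-1) ^ (k + 1)) • e J) (by
      intro J hJ
      exact sub_mem (hc J (mem_powersetCard_insert hJ))
        (zsmul_mem (hX (Finset.subset_insert _ _) (he J hJ)) _)) (by
      intro J hJ
      have h3 := hcyc J (mem_powersetCard_insert hJ)
      rw [sum_insert_sdiff _ ha (notMem_of_mem_powersetCard ha hJ), hε hJ] at h3
      simp only [smul_sub, Finset.sum_sub_distrib]
      have h4 : ∑ x ∈ G \ J, s x J • (s a ∅ * (-1) ^ (k + 1)) • e (insert x J) =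
          (s a ∅ * (-1) ^ (k + 1)) • c (insert a J) := by
        rw [← hde J hJ, Finset.smul_sum]
        exact Finset.sum_congr rfl fun x _ => smul_comm _ _ _
      rw [h4, ← h3, pow_succ, mul_neg_one, mul_neg, neg_smul]
      abel)
  obtain ⟨B, hB⟩ : ∃ B : Finset ι → W, ∀ J, B J = if a ∈ J then e (J.erase a) else b J :=
    ⟨_, fun _ => rfl⟩
  have hBb : ∀ J, a ∉ J → B J = b J := fun J h => by rw [hB, if_neg h]
  have hBe : ∀ J, a ∉ J → B (insert a J) = e J := fun J h => by
    rw [hB, if_pos (Finset.mem_insert_self _ _), Finset.erase_insert h]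
  have hnot : ∀ {J : Finset ι} {x}, a ∉ J → x ∈ G \ J → a ∉ insert x J := by
    intro J x hJ hx
    rw [Finset.mem_insert]
    rintro (rfl | h)
    · exact ha (Finset.mem_sdiff.1 hx).1
    · exact hJ h
  refine ⟨B, ?_, ?_⟩
  · intro J hJ
    rcases powersetCard_insert_cases ha hJ with hJ | ⟨k', K, hk, hK, rfl⟩
    · rw [hBb _ (notMem_of_mem_powersetCard ha hJ)]
      exact hb J hJ
    · obtain rfl : k' = k + 1 := by omega
      rw [hBe _ (notMem_of_mem_powersetCard ha hK)]
      exact he K hK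
  · intro J hJ
    rcases powersetCard_insert_cases ha hJ with hJ | ⟨k', K, hk, hK, rfl⟩
    · have haJ := notMem_of_mem_powersetCard ha hJ
      rw [sum_insert_sdiff _ ha haJ, hε hJ]
      have h4 : ∑ x ∈ G \ J, s x J • B (insert x J) = ∑ x ∈ G \ J, s x J • b (insert x J) :=
        Finset.sum_congr rfl fun x hx => by rw [hBb _ (hnot haJ hx)]
      rw [h4, hdb J hJ, hBe _ haJ]
      abel
    · obtain rfl : k' = k := by omega
      rw [hd, ← hde K hK]
      exact Finset.sum_congr rfl fun x hx => by
        rw [hBe _ (hnot (notMem_of_mem_powersetCard ha hK) hx)]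

theorem sum_insert_erase (f : ι → Finset ι → W) {J : Finset ι} (hJ : a ∉ J) :
    ∑ j ∈ insert a J, f j ((insert a J).erase j) =
      f a J + ∑ j ∈ J, f j (insert a (J.erase j)) := by
  rw [Finset.sum_insert hJ, Finset.erase_insert hJ]
  congr 1
  refine Finset.sum_congr rfl fun j hj => ?_
  rw [Finset.erase_insert_of_ne (by rintro rfl; exact hJ hj)]

/-- The cochain version of `cubeChEx_insert`. Here the map on cohomology in degree zero has to be
surjective, which is `h0`. -/
theorem cubeCoEx_insert (hs : IsConeSign s (insert a G)) (hlt : ∀ x ∈ G, a < x)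
    (hX : Monotone X) (h1 : CubeCoEx s G X) (h2 : CubeCoEx s G fun J => X (insert a J))
    (h0 : (G.inf fun j => X {a, j}) ≤ G.inf (fun j => X {j}) ⊔ X {a}) :
    CubeCoEx s (insert a G) X := by
  classical
  intro k c hcyc
  have ha : a ∉ G := fun h => lt_irrefl _ (hlt a h)
  have haG := Finset.mem_insert_self a G
  have hmem : ∀ {j}, j ∈ G → j ∈ insert a G := fun h => Finset.mem_insert_of_mem h
  have hsub : ∀ {l} {J : Finset ι}, J ∈ G.powersetCard l → J ⊆ G := fun h =>
    (Finset.mem_powersetCard.1 h).1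
  have hε : ∀ {l} {J : Finset ι}, J ∈ G.powersetCard l → s a J = s a ∅ * (-1) ^ l := by
    intro l J hJ
    rw [hs.of_forall_lt a haG J ((hsub hJ).trans (Finset.subset_insert _ _))
      fun x hx => hlt x (hsub hJ hx), (Finset.mem_powersetCard.1 hJ).2]
  have hd : ∀ (f : Finset ι → W) (J : Finset ι), J ⊆ G →
      ∑ j ∈ insert a J, s j ((insert a J).erase j) • f ((insert a J).erase j) =
        s a J • f J + ∑ j ∈ J, s j (J.erase j) • f (insert a (J.erase j)) := by
    intro f J hJ
    rw [sum_insert_erase (fun j K => s j K • f K) fun h => ha (hJ h)]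
    congr 1
    refine Finset.sum_congr rfl fun j hj => ?_
    rw [hs.insert_of_lt a haG j (hmem (hJ hj)) (hlt j (hJ hj))]
  obtain ⟨b, hb⟩ := h1 k c fun K hK => hcyc K (mem_powersetCard_insert hK)
  -- the component at the subsets containing `a` becomes a cocycle after correction by `b`
  set ε : ℤ := s a ∅ * (-1) ^ k with hεdef
  have hcyc' : ∀ K ∈ G.powersetCard (k + 1),
      ∑ j ∈ K, s j (K.erase j) • (c (insert a (K.erase j)) - ε • b (K.erase j)) ∈
        X (insert a K) := by
    intro K hK
    have h3 := hcyc _ (insert_mem_powersetCard ha hK)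
    rw [hd c K (hsub hK), hε hK] at h3
    have h4 := (X (insert a K)).smul_of_tower_mem ε (hX (Finset.subset_insert a K) (hb K hK))
    simp only [smul_sub, Finset.sum_sub_distrib]
    have h5 : ∑ x ∈ K, s x (K.erase x) • ε • b (K.erase x) =
        ε • ∑ x ∈ K, s x (K.erase x) • b (K.erase x) := by
      rw [Finset.smul_sum]
      exact Finset.sum_congr rfl fun x _ => smul_comm _ _ _
    rw [h5]
    convert! add_mem h3 h4 using 1
    rw [pow_succ, mul_neg_one, mul_neg, ← hεdef, neg_smul, smul_sub]
    abel
  have key : ∃ (b' : Finset ι → W) (e : Finset ι → W), (∀ J ∈ G.powersetCard (k + 1),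
      c J - ∑ j ∈ J, s j (J.erase j) • b' (J.erase j) ∈ X J) ∧
      ∀ J ∈ G.powersetCard k, c (insert a J) - ε • b' J -
        ∑ j ∈ J, s j (J.erase j) • e (J.erase j) ∈ X (insert a J) := by
    cases k with
    | succ k =>
      obtain ⟨e, he⟩ := h2 k (fun J => c (insert a J) - ε • b J) hcyc'
      exact ⟨b, e, hb, he⟩
    | zero =>
      have hε2 : ε * ε = 1 := by rw [hεdef, pow_zero, mul_one]; exact hs.mul_self _ _
      have h3 : c {a} - ε • b ∅ ∈ G.inf fun j => X {a, j} := by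
        rw [Submodule.mem_finsetInf]
        intro j hj
        have h4 := hcyc' {j} (by simpa using hj)
        simp only [Finset.sum_singleton, Finset.erase_singleton, insert_empty_eq] at h4
        have h5 := (X {a, j}).smul_of_tower_mem (s j ∅) h4
        rwa [smul_smul, hs.mul_self, one_smul] at h5
      obtain ⟨u, hu, v, hv, huv⟩ := Submodule.mem_sup.1 (h0 h3)
      refine ⟨fun J => b J + ε • u, 0, ?_, ?_⟩
      · intro J hJ
        obtain ⟨j, rfl⟩ := Finset.card_eq_one.1 (Finset.mem_powersetCard.1 hJ).2
        have h4 := hb _ hJ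
        simp only [Finset.sum_singleton, Finset.erase_singleton] at h4 ⊢
        rw [smul_add, ← sub_sub]
        refine sub_mem h4 (zsmul_mem (zsmul_mem ?_ _) _)
        exact (Submodule.mem_finsetInf.1 hu) j (by simpa using hJ)
      · intro J hJ
        obtain rfl := Finset.card_eq_zero.1 (Finset.mem_powersetCard.1 hJ).2
        simp only [insert_empty_eq, smul_add, smul_smul, hε2, one_smul, Finset.sum_empty, sub_zero]
        rw [← sub_sub, ← huv, add_sub_cancel_left]
        exact hv
  obtain ⟨b', e, hb', he⟩ := key
  obtain ⟨B, hB⟩ : ∃ B : Finset ι → W, ∀ J, B J = if a ∈ J then e (J.erase a) else b' J :=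
    ⟨_, fun _ => rfl⟩
  have hBb : ∀ J, a ∉ J → B J = b' J := fun J h => by rw [hB, if_neg h]
  have hBe : ∀ J, a ∉ J → B (insert a J) = e J := fun J h => by
    rw [hB, if_pos (Finset.mem_insert_self _ _), Finset.erase_insert h]
  refine ⟨B, ?_⟩
  intro J hJ
  rcases powersetCard_insert_cases ha hJ with hJ | ⟨k', K, hk, hK, rfl⟩
  · have haJ := notMem_of_mem_powersetCard ha hJ
    have h4 : ∑ x ∈ J, s x (J.erase x) • B (J.erase x) =
        ∑ x ∈ J, s x (J.erase x) • b' (J.erase x) :=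
      Finset.sum_congr rfl fun x hx => by
        rw [hBb _ fun h => haJ (Finset.mem_of_mem_erase h)]
    rw [h4]
    exact hb' J hJ
  · obtain rfl : k' = k := by omega
    have haK := notMem_of_mem_powersetCard ha hK
    rw [hd _ K (hsub hK), hBb _ haK, hε hK]
    have h4 : ∑ x ∈ K, s x (K.erase x) • B (insert a (K.erase x)) =
        ∑ x ∈ K, s x (K.erase x) • e (K.erase x) :=
      Finset.sum_congr rfl fun x hx => by
        rw [hBe _ fun h => haK (Finset.mem_of_mem_erase h)]
    rw [h4, ← sub_sub]
    exact he K hK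

/-- Members of a distributive sublattice yield exact chain complexes. The fixed member `Y` makes
the induction possible: for the subsets containing the least element `a` it becomes `Y ⊓ N a`. -/
theorem cubeChEx_of_isDistribSet {N : ι → Submodule R W} {E : Sublattice (Submodule R W)}
    (hE : ∀ x ∈ E, ∀ y ∈ E, ∀ z ∈ E, x ⊓ (y ⊔ z) ≤ x ⊓ y ⊔ x ⊓ z) (hb : ⊥ ∈ E)
    (hs : IsConeSign s G) (hN : ∀ j ∈ G, N j ∈ E) {Y : Submodule R W} (hY : Y ∈ E) :
    CubeChEx s G fun J => Y ⊓ J.inf N := by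
  induction G using Finset.induction_on_min generalizing Y with
  | empty =>
    intro k c _ _
    refine ⟨0, by simp, fun J hJ => ?_⟩
    rw [Finset.powersetCard_eq_empty.2 (by simp)] at hJ
    simp at hJ
  | insert a G hlt ih =>
    have haG := Finset.mem_insert_self a G
    have hN' : ∀ j ∈ G, N j ∈ E := fun j hj => hN j (Finset.mem_insert_of_mem hj)
    have hs' := hs.mono (Finset.subset_insert a G)
    refine cubeChEx_insert hs hlt (fun J K h => inf_le_inf le_rfl (Finset.inf_mono h))
      (ih hs' hN' hY) ?_ ?_
    · convert! ih hs' hN' (E.inf_mem hY (hN a haG)) using 2 with J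
      rw [Finset.inf_insert, inf_assoc]
    · simp only [Finset.inf_insert, Finset.inf_singleton]
      refine (inf_finset_sup_le hE hb G (fun j hj => E.inf_mem hY (hN' j hj))
        (E.inf_mem hY (hN a haG))).trans (Finset.sup_mono_fun fun j _ => ?_)
      rw [inf_inf_inf_comm, inf_idem]

/-- Members of a distributive sublattice yield exact cochain complexes. -/
theorem cubeCoEx_of_isDistribSet {N : ι → Submodule R W} {E : Sublattice (Submodule R W)}
    (hE : ∀ x ∈ E, ∀ y ∈ E, ∀ z ∈ E, x ⊓ (y ⊔ z) ≤ x ⊓ y ⊔ x ⊓ z) (ht : ⊤ ∈ E)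
    (hs : IsConeSign s G) (hN : ∀ j ∈ G, N j ∈ E) {Y : Submodule R W} (hY : Y ∈ E) :
    CubeCoEx s G fun J => Y ⊔ J.sup N := by
  induction G using Finset.induction_on_min generalizing Y with
  | empty =>
    intro k c _
    refine ⟨0, fun J hJ => ?_⟩
    rw [Finset.powersetCard_eq_empty.2 (by simp)] at hJ
    simp at hJ
  | insert a G hlt ih =>
    have haG := Finset.mem_insert_self a G
    have hN' : ∀ j ∈ G, N j ∈ E := fun j hj => hN j (Finset.mem_insert_of_mem hj)
    have hs' := hs.mono (Finset.subset_insert a G)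
    refine cubeCoEx_insert hs hlt (fun J K h => sup_le_sup le_rfl (Finset.sup_mono h))
      (ih hs' hN' hY) ?_ ?_
    · convert! ih hs' hN' (E.sup_mem hY (hN a haG)) using 2 with J
      rw [Finset.sup_insert, sup_assoc]
    · simp only [Finset.sup_insert, Finset.sup_singleton]
      rw [sup_comm]
      refine le_trans (Finset.inf_mono_fun fun j _ => ?_) (finset_inf_sup_le hE ht G
        (f := fun j => Y ⊔ N j) (fun j hj => E.sup_mem hY (hN' j hj)) (E.sup_mem hY (hN a haG)))
      rw [sup_sup_sup_comm, sup_idem]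

end Cubes

/-! ### Distributivity of a collection of submodules is a lattice property -/

section Transfer

variable {R : Type u} [CommRing R] {W : Type v} [AddCommGroup W] [Module R W] {m : ℕ}

theorem Face.card_sdiff {I : Finset (Fin m)} {k : ℕ} (J : Face I k) :
    J.1 \ I ∈ Iᶜ.powersetCard k := by
  rw [Finset.mem_powersetCard, Finset.card_sdiff_of_subset J.2.1, J.2.2]
  exact ⟨fun x hx => Finset.mem_compl.2 (Finset.mem_sdiff.1 hx).2, by omega⟩

theorem face_of_mem_powersetCard {I : Finset (Fin m)} {k : ℕ} {J : Finset (Fin m)}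
    (hJ : J ∈ Iᶜ.powersetCard k) : I ⊆ I ∪ J ∧ (I ∪ J).card = I.card + k := by
  obtain ⟨h, rfl⟩ := Finset.mem_powersetCard.1 hJ
  refine ⟨Finset.subset_union_left, Finset.card_union_of_disjoint ?_⟩
  exact Finset.disjoint_left.2 fun x hx hx' => Finset.mem_compl.1 (h hx') hx

theorem disjoint_of_mem_powersetCard {I : Finset (Fin m)} {k : ℕ} {J : Finset (Fin m)}
    (hJ : J ∈ Iᶜ.powersetCard k) : Disjoint I J :=
  Finset.disjoint_left.2 fun _ hx hx' =>
    Finset.mem_compl.1 ((Finset.mem_powersetCard.1 hJ).1 hx') hx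

theorem union_sdiff_face {I : Finset (Fin m)} {k : ℕ} (J : Face I k) : I ∪ (J.1 \ I) = J.1 :=
  Finset.union_sdiff_of_subset J.2.1

/-- Indexing the terms of the chain complex by `J \ I` instead of `J`. -/
theorem cubeChainExact_of_cubeChEx {I : Finset (Fin m)} {X : Finset (Fin m) → Submodule R W}
    (h : CubeChEx (fun j J => sgn j (I ∪ J)) Iᶜ fun J => X (I ∪ J)) : CubeChainExact X I := by
  classical
  intro k c hc hcyc
  let c' : Finset (Fin m) → W := fun J =>
    if h : I ⊆ I ∪ J ∧ (I ∪ J).card = I.card + (k + 1) then c ⟨I ∪ J, h⟩ else 0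
  have hd : ∀ (l : ℕ) (f : Face I (l + 1) → W) (f' : Finset (Fin m) → W)
      (_ : ∀ J (h : J ∈ Iᶜ.powersetCard (l + 1)), f' J = f ⟨I ∪ J, face_of_mem_powersetCard h⟩)
      (J : Face I l), ∑ j ∈ Iᶜ \ (J.1 \ I), sgn j (I ∪ (J.1 \ I)) • f' (insert j (J.1 \ I)) =
        cubeD R W I l f J := by
    intro l f f' hf J
    simp only [cubeD, LinearMap.pi_apply, LinearMap.sum_apply, LinearMap.smul_apply,
      LinearMap.proj_apply, union_sdiff_face]
    have hset : Iᶜ \ (J.1 \ I) = Finset.univ.filter fun j => j ∉ J.1 := by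
      ext x
      have := @J.2.1 x
      simp only [Finset.mem_sdiff, Finset.mem_compl, Finset.mem_filter, Finset.mem_univ, true_and]
      tauto
    rw [hset, ← Finset.sum_subtype_of_mem (p := fun j => j ∉ J.1)
      (fun j => sgn j J.1 • f' (insert j (J.1 \ I))) (by simp)]
    have hu : (Finset.univ.filter fun j => j ∉ J.1).subtype (fun j => j ∉ J.1) =
        Finset.univ := by
      ext x; simpa using x.2
    rw [hu]
    refine Finset.sum_congr rfl fun j _ => ?_
    have hjI : (j : Fin m) ∉ I := fun h => j.2 (J.2.1 h)
    have hmem : insert (j : Fin m) (J.1 \ I) ∈ Iᶜ.powersetCard (l + 1) := by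
      have := (J.insert j).card_sdiff
      rwa [show (J.insert j).1 = insert j.1 J.1 from rfl,
        Finset.insert_sdiff_of_notMem _ hjI] at this
    rw [hf _ hmem]
    congr 2
    apply Subtype.ext
    change I ∪ insert (j : Fin m) (J.1 \ I) = insert j.1 J.1
    rw [Finset.union_insert, union_sdiff_face]
  have hc' : ∀ J (h : J ∈ Iᶜ.powersetCard (k + 1)),
      c' J = c ⟨I ∪ J, face_of_mem_powersetCard h⟩ := fun J h =>
    dif_pos (face_of_mem_powersetCard h)
  have hsd : ∀ {l} {J : Finset (Fin m)}, J ∈ Iᶜ.powersetCard l → (I ∪ J) \ I = J := fun h =>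
    Finset.union_sdiff_cancel_left (disjoint_of_mem_powersetCard h)
  obtain ⟨b, hb, hdb⟩ := h k c' (fun J hJ => by rw [hc' J hJ]; exact hc ⟨I ∪ J, _⟩) (fun J hJ => by
    have := hd k c c' hc' ⟨I ∪ J, face_of_mem_powersetCard hJ⟩
    simp only [hsd hJ] at this
    rw [this, hcyc]; rfl)
  refine ⟨fun J => b (J.1 \ I), fun J => ?_, ?_⟩
  · have := hb _ J.card_sdiff
    simpa only [union_sdiff_face] using this
  · funext J
    rw [← hd (k + 1) _ b (fun K hK => by simp only [hsd hK]) J, hdb _ J.card_sdiff,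
      hc' _ J.card_sdiff]
    congr 1
    exact Subtype.ext (union_sdiff_face J)

/-- The differential of `C^•_I` on representatives. -/
theorem quotD_mkQ {I : Finset (Fin m)} (N : Fin m → Submodule R W) (l : ℕ) (f : Face I l → W)
    (f' : Finset (Fin m) → W)
    (hf : ∀ J (h : J ∈ Iᶜ.powersetCard l), f' J = f ⟨I ∪ J, face_of_mem_powersetCard h⟩)
    (K : Face I (l + 1)) : quotD N I l (fun J => Submodule.mkQ _ (f J)) K =
      Submodule.mkQ _ (∑ j ∈ K.1 \ I, sgn j (I ∪ (K.1 \ I).erase j) • f' ((K.1 \ I).erase j)) := by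
  simp only [quotD, LinearMap.pi_apply, LinearMap.sum_apply, LinearMap.smul_apply,
    map_sum, map_zsmul]
  have hset : K.1 \ I = Finset.univ.filter fun j => j ∈ K.1 ∧ j ∉ I := by
    ext x; simp
  rw [Finset.sum_congr hset (g := fun j => sgn j (I ∪ (K.1 \ I).erase j) •
    Submodule.mkQ _ (f' ((K.1 \ I).erase j))) (fun _ _ => rfl),
    ← Finset.sum_subtype_of_mem (p := fun j => j ∈ K.1 ∧ j ∉ I) _ (by simp)]
  have hu : (Finset.univ.filter fun j => j ∈ K.1 ∧ j ∉ I).subtype (fun j => j ∈ K.1 ∧ j ∉ I) =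
      Finset.univ := by
    ext x; simpa using x.2
  rw [hu]
  refine Finset.sum_congr rfl fun j _ => ?_
  have he : (K.1 \ I).erase (j : Fin m) = (K.erase j).1 \ I := by
    ext x
    simp only [Face.erase, Finset.mem_erase, Finset.mem_sdiff]
    tauto
  have hmem : (K.1 \ I).erase (j : Fin m) ∈ Iᶜ.powersetCard l := by
    rw [he]; exact (K.erase j).card_sdiff
  have hU : I ∪ (K.1 \ I).erase (j : Fin m) = K.1.erase j := by
    rw [he, union_sdiff_face]; rfl
  have hface : (⟨I ∪ (K.1 \ I).erase (j : Fin m), face_of_mem_powersetCard hmem⟩ : Face I l) =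
      K.erase j := Subtype.ext hU
  have hsgn : sgn (j : Fin m) (K.1.erase j) =
      sgn (j : Fin m) (I ∪ (K.1 \ I).erase (j : Fin m)) := by
    rw [hU]
  rw [hf _ hmem, ← hsgn]
  rw [hface]
  rfl

/-- Indexing the terms of the cochain complex by `J \ I` instead of `J`, and passing to
representatives in `W`. -/
theorem quotD_exact_of_cubeCoEx {I : Finset (Fin m)} {N : Fin m → Submodule R W}
    (h : CubeCoEx (fun j J => sgn j (I ∪ J)) Iᶜ fun J => ⨆ j ∈ I ∪ J, N j) (k : ℕ)
    (x : QuotCochain N I (k + 1)) (hx : quotD N I (k + 1) x = 0) :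
    ∃ y, quotD N I k y = x := by
  classical
  choose c hc using fun J : Face I (k + 1) => Submodule.mkQ_surjective _ (x J)
  let c' : Finset (Fin m) → W := fun J =>
    if h : I ⊆ I ∪ J ∧ (I ∪ J).card = I.card + (k + 1) then c ⟨I ∪ J, h⟩ else 0
  have hc' : ∀ J (h : J ∈ Iᶜ.powersetCard (k + 1)),
      c' J = c ⟨I ∪ J, face_of_mem_powersetCard h⟩ := fun J h =>
    dif_pos (face_of_mem_powersetCard h)
  have hx' : x = fun J => Submodule.mkQ _ (c J) := funext fun J => (hc J).symm
  have hsd : ∀ {l} {J : Finset (Fin m)}, J ∈ Iᶜ.powersetCard l → (I ∪ J) \ I = J := fun h =>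
    Finset.union_sdiff_cancel_left (disjoint_of_mem_powersetCard h)
  obtain ⟨b, hb⟩ := h k c' (fun K hK => by
    have h1 := quotD_mkQ N (k + 1) c c' hc' ⟨I ∪ K, face_of_mem_powersetCard hK⟩
    rw [← hx', hx] at h1
    simp only [hsd hK] at h1
    exact (Submodule.Quotient.mk_eq_zero _).1 h1.symm)
  refine ⟨fun J => Submodule.mkQ _ (b (J.1 \ I)), ?_⟩
  funext J
  rw [quotD_mkQ N k (fun J => b (J.1 \ I)) b (fun K hK => by simp only [hsd hK]) J, ← hc J]
  refine ((Submodule.Quotient.eq _).2 ?_).symm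
  have h1 := hb _ J.card_sdiff
  have hface : (⟨I ∪ (J.1 \ I), face_of_mem_powersetCard J.card_sdiff⟩ : Face I (k + 1)) = J :=
    Subtype.ext (union_sdiff_face J)
  rw [hc' _ J.card_sdiff, hface] at h1
  simpa only [union_sdiff_face] using h1

/-- The square of the cochain differential vanishes on representatives. -/
theorem cubeCo_comp_self {ι : Type*} [LinearOrder ι] {s : ι → Finset ι → ℤ} {G : Finset ι}
    (hs : IsConeSign s G) (K : Finset ι) (hK : K ⊆ G) (f : Finset ι → W) :
    ∑ j ∈ K, s j (K.erase j) • ∑ i ∈ K.erase j, s i ((K.erase j).erase i) •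
      f ((K.erase j).erase i) = 0 := by
  classical
  induction K using Finset.induction_on_min generalizing f with
  | empty => simp
  | insert a K hlt ih =>
    have ha : a ∉ K := fun h => lt_irrefl _ (hlt a h)
    have haG : a ∈ G := hK (Finset.mem_insert_self _ _)
    have hKG : K ⊆ G := (Finset.subset_insert a K).trans hK
    have hd : ∀ (g : Finset ι → W) (J : Finset ι), J ⊆ K →
        ∑ j ∈ insert a J, s j ((insert a J).erase j) • g ((insert a J).erase j) =
          s a J • g J + ∑ j ∈ J, s j (J.erase j) • g (insert a (J.erase j)) := by
      intro g J hJ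
      rw [sum_insert_erase (fun j K => s j K • g K) fun h => ha (hJ h)]
      congr 1
      refine Finset.sum_congr rfl fun j hj => ?_
      rw [hs.insert_of_lt a haG j (hKG (hJ hj)) (hlt j (hJ hj))]
    have h1 := hd (fun J => ∑ i ∈ J, s i (J.erase i) • f (J.erase i)) K subset_rfl
    rw [h1]
    have h2 : ∀ j ∈ K, s j (K.erase j) • ∑ i ∈ insert a (K.erase j),
        s i ((insert a (K.erase j)).erase i) • f ((insert a (K.erase j)).erase i) =
        - s a K • s j (K.erase j) • f (K.erase j) + s j (K.erase j) • ∑ i ∈ K.erase j,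
          s i ((K.erase j).erase i) • f (insert a ((K.erase j).erase i)) := by
      intro j hj
      rw [hd f _ (Finset.erase_subset _ _), smul_add, smul_comm (s j _) (s a _)]
      congr 2
      rw [hs.of_forall_lt a haG K hKG hlt, hs.of_forall_lt a haG _
        ((Finset.erase_subset _ _).trans hKG) fun x hx => hlt x (Finset.mem_of_mem_erase hx),
        ← Finset.card_erase_add_one hj, pow_succ]
      ring
    rw [Finset.sum_congr rfl h2, Finset.sum_add_distrib,
      ih hKG fun J => f (insert a J), ← Finset.smul_sum, neg_smul]
    simp

theorem quotD_comp_quotD (N : Fin m → Submodule R W) (I : Finset (Fin m)) (k : ℕ)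
    (x : QuotCochain N I k) : quotD N I (k + 1) (quotD N I k x) = 0 := by
  classical
  choose c hc using fun J : Face I k => Submodule.mkQ_surjective _ (x J)
  let c' : Finset (Fin m) → W := fun J =>
    if h : I ⊆ I ∪ J ∧ (I ∪ J).card = I.card + k then c ⟨I ∪ J, h⟩ else 0
  have hc' : ∀ J (h : J ∈ Iᶜ.powersetCard k),
      c' J = c ⟨I ∪ J, face_of_mem_powersetCard h⟩ := fun J h =>
    dif_pos (face_of_mem_powersetCard h)
  have hx' : x = fun J => Submodule.mkQ _ (c J) := funext fun J => (hc J).symm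
  have h1 := funext (quotD_mkQ N k c c' hc')
  funext K
  rw [hx', h1, quotD_mkQ N (k + 1) _ (fun J => ∑ j ∈ J, sgn j (I ∪ J.erase j) • c' (J.erase j))
    fun J hJ => by
      simp only [Finset.union_sdiff_cancel_left (disjoint_of_mem_powersetCard hJ)]]
  rw [cubeCo_comp_self (isConeSign_sgn I) _ fun x hx => Finset.mem_compl.2
    (Finset.mem_sdiff.1 hx).2]
  simp

theorem biInf_union_eq (N : Fin m → Submodule R W) (I J : Finset (Fin m)) :
    (⨅ j ∈ I ∪ J, N j) = I.inf N ⊓ J.inf N := by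
  rw [← Finset.inf_union, Finset.inf_eq_iInf]

theorem biSup_union_eq (N : Fin m → Submodule R W) (I J : Finset (Fin m)) :
    (⨆ j ∈ I ∪ J, N j) = I.sup N ⊔ J.sup N := by
  rw [← Finset.sup_union, Finset.sup_eq_iSup]

/-- In degree one, exactness of the chain complexes `C_•^I` says that a relation
`∑ c j = 0` with `c j ∈ N j ∩ ⋂_{i ∈ I} N i` comes from an alternating matrix. Here the sum may
run over any `G` disjoint from `I`. -/
theorem IsDistributive.exists_alternating {N : Fin m → Submodule R W} (h : IsDistributive N)
    (G I : Finset (Fin m)) (hGI : Disjoint I G) (c : Fin m → W)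
    (hc : ∀ j ∈ G, c j ∈ I.inf N ⊓ N j) (hsum : ∑ j ∈ G, c j = 0) :
    ∃ b : Fin m → Fin m → W, (∀ j k, b j k = - b k j) ∧ (∀ j, b j j = 0) ∧
      (∀ j ∈ G, ∀ k ∈ G, b j k ∈ I.inf N ⊓ N j ⊓ N k) ∧ ∀ j ∈ G, c j = ∑ k ∈ G, b j k := by
  classical
  obtain ⟨n, hn⟩ : ∃ n, (I ∪ G)ᶜ.card = n := ⟨_, rfl⟩
  -- induction on the number of elements outside `I ∪ G`
  induction n generalizing G I c with
  | succ n ih =>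
    -- the row at a new element `i` of a matrix for `insert i G` is a relation inside `N i`, and the
    -- matrix of this relation corrects the first one
    obtain ⟨i, hi⟩ := Finset.card_pos.1 (by omega : 0 < (I ∪ G)ᶜ.card)
    have hi' : i ∉ I ∧ i ∉ G := by simpa using hi
    have hcard : ((I ∪ G)ᶜ.erase i).card = n := by rw [Finset.card_erase_of_mem hi]; omega
    obtain ⟨b, hb1, hb2, hb3, hb4⟩ := ih (insert i G) I (by simp [hi'.1, hGI])
      (fun j => if j = i then 0 else c j) (by
        intro j hj
        split_ifs with hji
        · exact zero_mem _
        · exact hc j ((Finset.mem_insert.1 hj).resolve_left hji)) (by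
        rw [Finset.sum_insert hi'.2, if_pos rfl, zero_add, ← hsum]
        exact Finset.sum_congr rfl fun j hj => if_neg (by rintro rfl; exact hi'.2 hj))
      (by rw [← hcard]; congr 1; ext x; simp)
    have hiG := Finset.mem_insert_self i G
    have hG : ∀ {j}, j ∈ G → j ∈ insert i G := fun h => Finset.mem_insert_of_mem h
    have hbi : ∑ k ∈ G, b i k = 0 := by
      have := hb4 i hiG
      rwa [if_pos rfl, Finset.sum_insert hi'.2, hb2, zero_add, eq_comm] at this
    have hins : (insert i I).inf N = I.inf N ⊓ N i := by rw [Finset.inf_insert, inf_comm]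
    obtain ⟨e, he1, he2, he3, he4⟩ := ih G (insert i I) (by simp [hi'.2, hGI]) (b i) (by
      intro j hj
      rw [hins]
      exact hb3 i hiG j (hG hj)) hbi (by rw [← hcard]; congr 1; ext x; simp)
    refine ⟨fun j k => b j k - e j k, fun j k => ?_, fun j => ?_, fun j hj k hk => ?_,
      fun j hj => ?_⟩
    · beta_reduce; rw [hb1 j k, he1 j k]; abel
    · beta_reduce; rw [hb2, he2, sub_zero]
    · refine sub_mem (hb3 j (hG hj) k (hG hk)) ?_
      have := he3 j hj k hk
      rw [hins] at this
      exact ⟨⟨this.1.1.1, this.1.2⟩, this.2⟩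
    · have h1 := hb4 j (hG hj)
      rw [if_neg (by rintro rfl; exact hi'.2 hj), Finset.sum_insert hi'.2, hb1 j i,
        he4 j hj] at h1
      rw [Finset.sum_sub_distrib, h1]
      abel
  | zero =>
    -- `G` is the complement of `I`, and the claim is exactness of `C_•^I` in degree one
    have hG : ∀ j, j ∈ G ↔ j ∉ I := by
      intro j
      have h1 := Finset.card_eq_zero.1 hn
      have h2 : j ∉ (I ∪ G)ᶜ := by rw [h1]; simp
      constructor
      · exact fun hj hj' => Finset.disjoint_left.1 hGI hj' hj
      · intro hj; simpa [hj] using h2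
    let F : (j : Fin m) → j ∉ I → Face I 1 := fun j hj =>
      ⟨insert j I, Finset.subset_insert _ _, Finset.card_insert_of_notMem hj⟩
    let c' : Face I 1 → W := fun J => ∑ j ∈ J.1 \ I, sgn j I • c j
    have hc' : ∀ j hj, c' (F j hj) = sgn j I • c j := by
      intro j hj
      have : insert j I \ I = {j} := by
        ext x; simp only [Finset.mem_sdiff, Finset.mem_insert, Finset.mem_singleton]
        constructor
        · tauto
        · rintro rfl; exact ⟨Or.inl rfl, hj⟩
      simp only [c', F, this, Finset.sum_singleton]
    have hF : ∀ J : Face I 1, ∃ j hj, J = F j hj := by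
      intro J
      have h1 : (J.1 \ I).card = 1 := (Finset.mem_powersetCard.1 J.card_sdiff).2
      obtain ⟨j, hj⟩ := Finset.card_eq_one.1 h1
      have hj' : j ∈ J.1 \ I := by rw [hj]; simp
      refine ⟨j, (Finset.mem_sdiff.1 hj').2, Subtype.ext ?_⟩
      change J.1 = insert j I
      rw [← Finset.union_sdiff_of_subset J.2.1, hj, Finset.union_comm]; rfl
    have hinf : ∀ j, (⨅ l ∈ insert j I, N l) = I.inf N ⊓ N j := by
      intro j
      rw [← Finset.inf_eq_iInf, Finset.inf_insert, inf_comm]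
    obtain ⟨b, hb, hdb⟩ := (h I).2 0 c' (by
      intro J
      obtain ⟨j, hj, rfl⟩ := hF J
      rw [hc' j hj]
      change _ ∈ ⨅ l ∈ insert j I, N l
      rw [hinf]
      exact zsmul_mem (hc j ((hG j).2 hj)) _) (by
      funext J
      have hJ : J.1 = I := (Finset.eq_of_subset_of_card_le J.2.1 (by rw [J.2.2]; rfl)).symm
      obtain ⟨J, hJ'⟩ := J
      obtain rfl : J = I := hJ
      simp only [cubeD, LinearMap.pi_apply, LinearMap.sum_apply, LinearMap.smul_apply,
        LinearMap.proj_apply, Pi.zero_apply]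
      rw [← hsum, ← Finset.sum_subtype_of_mem (p := fun j => j ∉ J) (s := G) c
        fun j hj => (hG j).1 hj]
      refine Finset.sum_congr ?_ fun j _ => ?_
      · ext x; simpa [hG] using x.2
      · have := hc' j.1 j.2
        refine (congrArg _ this).trans ?_
        rw [smul_smul, sgn_mul_self, one_smul])
    let F2 : (j k : Fin m) → j ∉ I ∧ k ∉ I ∧ j ≠ k → Face I 2 := fun j k hjk =>
      ⟨insert k (insert j I), (Finset.subset_insert _ _).trans (Finset.subset_insert _ _), by
        rw [Finset.card_insert_of_notMem, Finset.card_insert_of_notMem hjk.1]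
        simp only [Finset.mem_insert, not_or]
        exact ⟨fun h => hjk.2.2 h.symm, hjk.2.1⟩⟩
    have hswap : ∀ j k, j ∉ I → k ∉ I → j < k →
        sgn j I * sgn k (insert j I) = - (sgn k I * sgn j (insert k I)) := by
      intro j k hj hk hjk
      rw [sgn_insert_of_lt hjk, sgn_insert_of_gt hjk hk]
      ring
    obtain ⟨B, hB, hB0⟩ : ∃ B : Fin m → Fin m → W,
        (∀ j k (h : j ∉ I ∧ k ∉ I ∧ j ≠ k),
          B j k = (sgn j I * sgn k (insert j I)) • b (F2 j k h)) ∧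
        ∀ j k, ¬ (j ∉ I ∧ k ∉ I ∧ j ≠ k) → B j k = 0 :=
      ⟨fun j k => if h : j ∉ I ∧ k ∉ I ∧ j ≠ k then
        (sgn j I * sgn k (insert j I)) • b (F2 j k h) else 0,
        fun j k h => dif_pos h, fun j k h => dif_neg h⟩
    refine ⟨B, ?_, ?_, ?_, ?_⟩
    · intro j k
      by_cases hjk : j ∉ I ∧ k ∉ I ∧ j ≠ k
      · have hkj : k ∉ I ∧ j ∉ I ∧ k ≠ j := ⟨hjk.2.1, hjk.1, hjk.2.2.symm⟩
        rw [hB j k hjk, hB k j hkj]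
        have : F2 j k hjk = F2 k j hkj := Subtype.ext (Finset.insert_comm _ _ _)
        rw [this, ← neg_smul]
        congr 1
        rcases lt_or_gt_of_ne hjk.2.2 with hlt | hlt
        · exact hswap j k hjk.1 hjk.2.1 hlt
        · rw [hswap k j hjk.2.1 hjk.1 hlt, neg_neg]
      · rw [hB0 j k hjk, hB0 k j fun h => hjk ⟨h.2.1, h.1, h.2.2.symm⟩, neg_zero]
    · intro j
      exact hB0 j j (by simp)
    · intro j hj k hk
      by_cases hjk : j ∉ I ∧ k ∉ I ∧ j ≠ k
      · rw [hB j k hjk]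
        refine zsmul_mem ?_ _
        have h1 := hb (F2 j k hjk)
        have h2 : (⨅ l ∈ (F2 j k hjk).1, N l) = I.inf N ⊓ N j ⊓ N k := by
          change (⨅ l ∈ insert k (insert j I), N l) = _
          rw [← Finset.inf_eq_iInf, Finset.inf_insert, Finset.inf_insert, inf_comm, inf_comm (N j)]
        rwa [← h2]
      · rw [hB0 j k hjk]
        exact zero_mem _
    · intro j hj
      have hjI := (hG j).1 hj
      have h1 := congrFun hdb (F j hjI)
      rw [hc' j hjI] at h1
      have h2 := congrArg (sgn j I • ·) h1
      simp only [smul_smul, sgn_mul_self, one_smul] at h2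
      rw [← h2]
      simp only [cubeD, LinearMap.pi_apply, LinearMap.sum_apply, LinearMap.smul_apply,
        LinearMap.proj_apply, Finset.smul_sum, smul_smul]
      have hset : ∑ k ∈ G, B j k = ∑ k ∈ G.erase j, B j k := by
        rw [← Finset.add_sum_erase G _ hj, hB0 j j (by simp), zero_add]
      have hmem : ∀ k, k ∉ (F j hjI).1 ↔ k ∈ G.erase j := by
        intro k
        change k ∉ insert j I ↔ _
        rw [Finset.mem_erase, hG, Finset.mem_insert, not_or]
      rw [hset, ← Finset.sum_subtype_of_mem (p := fun k => k ∉ (F j hjI).1) (s := G.erase j) _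
        fun k hk => (hmem k).2 hk]
      refine Finset.sum_congr ?_ fun k _ => ?_
      · ext x; simpa [← hmem] using x.2
      · have hk := k.2
        have hk' : k.1 ≠ j ∧ k.1 ∉ I := by
          rw [hmem, Finset.mem_erase, hG] at hk; exact hk
        rw [hB j k ⟨hjI, hk'.2, hk'.1.symm⟩]
        rfl

/-- Members are adjoined one at a time. The condition `F.sup X ⊓ N a ≤ F.sup (X ⊓ N a)` this needs
is a statement about a relation between elements of the `N j`, and the alternating matrix of the
relation provides the decomposition. -/
theorem IsDistributive.isDistribSet {N : Fin m → Submodule R W} (h : IsDistributive N) :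
    IsDistribSet (Set.range N) := by
  classical
  -- adjoining `N a` requires the statement for the intersections with `N a`, hence the `I`
  suffices H : ∀ (s I : Finset (Fin m)), Disjoint I s →
      IsDistribSet ((fun j => I.inf N ⊓ N j) '' s) by
    have := H Finset.univ ∅ (by simp)
    simpa using this
  intro s
  induction s using Finset.induction_on with
  | empty => intro I _; simpa using IsDistribSet.empty
  | insert a s ha ih =>
    intro I hI
    rw [Finset.disjoint_insert_right] at hI
    rw [Finset.coe_insert, Set.image_insert_eq]
    refine isDistribSet_insert_dual (ih I hI.2) ?_ ?_
    · convert! ih (insert a I) (by simp [ha, hI.2]) using 2 with j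
      rw [Finset.inf_insert, inf_inf_inf_comm, inf_idem, inf_comm (N j), ← inf_assoc,
        inf_comm (I.inf N)]
    · intro F hF x hx
      obtain ⟨hx1, hx2⟩ := hx
      obtain ⟨u, hu⟩ := (Submodule.mem_iSup_finset_iff_exists_sum (fun j => I.inf N ⊓ N j) _).1
        (by rw [← Finset.sup_eq_iSup]; exact hx1)
      have haF : a ∉ F := fun h => ha (hF h)
      obtain ⟨b, hb1, hb2, hb3, hb4⟩ := h.exists_alternating (insert a F) I
        (Finset.disjoint_insert_right.2 ⟨hI.1, Finset.disjoint_of_subset_right hF hI.2⟩)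
        (fun j => if j = a then x else - (u j : W)) (by
          intro j hj
          split_ifs with hja
          · exact hja ▸ hx2
          · exact neg_mem (u j).2) (by
          rw [Finset.sum_insert haF, if_pos rfl, ← hu, ← Finset.sum_add_distrib.symm.trans
            (Finset.sum_eq_zero fun j hj => ?_)]
          rw [if_neg (by rintro rfl; exact haF hj)]
          abel)
      have h1 := hb4 a (Finset.mem_insert_self _ _)
      rw [if_pos rfl, Finset.sum_insert haF, hb2, zero_add] at h1
      rw [h1]
      refine sum_mem fun k hk => ?_
      refine (Finset.le_sup (f := fun i => I.inf N ⊓ N i ⊓ (I.inf N ⊓ N a)) hk) ?_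
      have h2 := hb3 a (Finset.mem_insert_self _ _) k (Finset.mem_insert_of_mem hk)
      exact ⟨⟨h2.1.1, h2.2⟩, h2.1⟩

theorem IsDistribSet.isDistributive {N : Fin m → Submodule R W}
    (h : IsDistribSet (Set.range N)) : IsDistributive N := by
  obtain ⟨E, hE, hN, hb, ht⟩ := h.exists_bounded
  have hN' : ∀ j, N j ∈ E := fun j => hN ⟨j, rfl⟩
  intro I
  refine ⟨fun k => ?_, ?_⟩
  · intro x
    refine ⟨fun hx => quotD_exact_of_cubeCoEx ?_ k x hx, ?_⟩
    · simp only [biSup_union_eq]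
      exact cubeCoEx_of_isDistribSet hE ht (isConeSign_sgn I) (fun j _ => hN' j)
        (Sublattice.finset_sup_mem hb _ fun j _ => hN' j)
    · rintro ⟨y, rfl⟩
      exact quotD_comp_quotD N I k y
  · refine cubeChainExact_of_cubeChEx ?_
    simp only [biInf_union_eq]
    exact cubeChEx_of_isDistribSet hE hb (isConeSign_sgn I) (fun j _ => hN' j)
      (Sublattice.finset_inf_mem ht _ fun j _ => hN' j)

theorem isDistributive_iff_isDistribSet {N : Fin m → Submodule R W} :
    IsDistributive N ↔ IsDistribSet (Set.range N) :=
  ⟨IsDistributive.isDistribSet, IsDistribSet.isDistributive⟩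

end Transfer

/-! ### Flatness and tensor products of submodules -/

section Flat

variable {R : Type*} [CommRing R]

/-- The kernel of a surjection between flat modules is flat. -/
theorem flat_of_exact {X Y Z : Type*} [AddCommGroup X] [Module R X] [AddCommGroup Y] [Module R Y]
    [AddCommGroup Z] [Module R Z] [Module.Flat R Y] [Module.Flat R Z] (g : X →ₗ[R] Y)
    (f : Y →ₗ[R] Z) (hg : Function.Injective g) (hf : Function.Surjective f)
    (h : Function.Exact g f) : Module.Flat R X := by
  rw [Module.Flat.iff_rTensor_preserves_injective_linearMap]
  intro N N' _ _ _ _ i hi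
  have h1 := LinearMap.lTensor_injective_of_exact_of_flat f hf g hg h N
  have h2 := Module.Flat.rTensor_preserves_injective_linearMap (M := Y) i hi
  have h3 : (i.rTensor Y) ∘ₗ (g.lTensor N) = (g.lTensor N') ∘ₗ (i.rTensor X) := by
    rw [LinearMap.rTensor_comp_lTensor, LinearMap.lTensor_comp_rTensor]
  have h4 : Function.Injective ((g.lTensor N') ∘ₗ (i.rTensor X)) := by
    rw [← h3]; exact h2.comp h1
  exact Function.Injective.of_comp (f := g.lTensor N') h4

theorem flat_of_flat_quotient {W : Type*} [AddCommGroup W] [Module R W] [Module.Flat R W]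
    (Y : Submodule R W) [Module.Flat R (W ⧸ Y)] : Module.Flat R Y :=
  flat_of_exact Y.subtype Y.mkQ Y.subtype_injective Y.mkQ_surjective
    (LinearMap.exact_subtype_mkQ Y)

theorem flat_prod {X Y : Type*} [AddCommGroup X] [Module R X] [AddCommGroup Y] [Module R Y]
    [Module.Flat R X] [Module.Flat R Y] : Module.Flat R (X × Y) := by
  rw [Module.Flat.iff_rTensor_preserves_injective_linearMap]
  intro N N' _ _ _ _ i hi
  have h1 := Module.Flat.rTensor_preserves_injective_linearMap (M := X) i hi
  have h2 := Module.Flat.rTensor_preserves_injective_linearMap (M := Y) i hi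
  have h3 : (TensorProduct.prodRight R R N' X Y).toLinearMap ∘ₗ i.rTensor (X × Y) =
      (i.rTensor X).prodMap (i.rTensor Y) ∘ₗ (TensorProduct.prodRight R R N X Y).toLinearMap := by
    ext <;> simp
  have h4 : Function.Injective
      ((TensorProduct.prodRight R R N' X Y).toLinearMap ∘ₗ i.rTensor (X × Y)) := by
    rw [h3]
    exact (h1.prodMap h2).comp (TensorProduct.prodRight R R N X Y).injective
  exact Function.Injective.of_comp (f := TensorProduct.prodRight R R N' X Y) h4

/-- The sequence `0 → W/(Y ∩ Y') → W/Y × W/Y' → W/(Y + Y') → 0` is exact. -/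
theorem flat_quotient_inf {W : Type*} [AddCommGroup W] [Module R W] (Y Y' : Submodule R W)
    [Module.Flat R (W ⧸ Y)] [Module.Flat R (W ⧸ Y')] [Module.Flat R (W ⧸ (Y ⊔ Y'))] :
    Module.Flat R (W ⧸ (Y ⊓ Y')) := by
  have := flat_prod (R := R) (X := W ⧸ Y) (Y := W ⧸ Y')
  let g : (W ⧸ (Y ⊓ Y')) →ₗ[R] (W ⧸ Y) × (W ⧸ Y') :=
    (Submodule.factor inf_le_left).prod (Submodule.factor inf_le_right)
  let f : (W ⧸ Y) × (W ⧸ Y') →ₗ[R] W ⧸ (Y ⊔ Y') :=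
    (Submodule.factor le_sup_left).coprod (-(Submodule.factor le_sup_right))
  refine flat_of_exact g f ?_ ?_ ?_
  · rw [← LinearMap.ker_eq_bot, eq_bot_iff]
    intro x hx
    obtain ⟨x, rfl⟩ := Submodule.mkQ_surjective _ x
    have h1 : Submodule.mkQ Y x = 0 := congrArg Prod.fst hx
    have h2 : Submodule.mkQ Y' x = 0 := congrArg Prod.snd hx
    exact (Submodule.Quotient.mk_eq_zero _).2 ⟨(Submodule.Quotient.mk_eq_zero _).1 h1,
      (Submodule.Quotient.mk_eq_zero _).1 h2⟩
  · intro x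
    obtain ⟨x, rfl⟩ := Submodule.mkQ_surjective _ x
    exact ⟨(Submodule.mkQ Y x, 0), by simp [f]⟩
  · rintro ⟨x, y⟩
    obtain ⟨x, rfl⟩ := Submodule.mkQ_surjective _ x
    obtain ⟨y, rfl⟩ := Submodule.mkQ_surjective _ y
    constructor
    · intro h
      have h1 : Submodule.mkQ (Y ⊔ Y') (x - y) = 0 := by
        rw [map_sub, sub_eq_add_neg]; exact h
      obtain ⟨u, hu, v, hv, huv⟩ := Submodule.mem_sup.1 ((Submodule.Quotient.mk_eq_zero _).1 h1)
      refine ⟨Submodule.mkQ _ (x - u), Prod.ext ?_ ?_⟩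
      · exact (Submodule.Quotient.eq _).2 (by simpa using hu)
      · refine (Submodule.Quotient.eq _).2 ?_
        have : x - u - y = v := by rw [sub_right_comm, ← huv]; abel
        change x - u - y ∈ Y'
        rwa [this]
    · rintro ⟨z, hz⟩
      obtain ⟨z, rfl⟩ := Submodule.mkQ_surjective _ z
      rw [← hz]
      change Submodule.mkQ (Y ⊔ Y') z + - Submodule.mkQ (Y ⊔ Y') z = 0
      simp

variable {W₁ W₂ : Type*} [AddCommGroup W₁] [Module R W₁] [AddCommGroup W₂] [Module R W₂]

open TensorProduct in
/-- The image of `P ⊗ Q` in `W₁ ⊗ W₂`. -/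
abbrev box (P : Submodule R W₁) (Q : Submodule R W₂) : Submodule R (W₁ ⊗[R] W₂) :=
  LinearMap.range (mapIncl P Q)

theorem box_top (P : Submodule R W₁) :
    box P (⊤ : Submodule R W₂) = LinearMap.range (P.subtype.rTensor W₂) := by
  have : TensorProduct.mapIncl P (⊤ : Submodule R W₂) =
      P.subtype.rTensor W₂ ∘ₗ (⊤ : Submodule R W₂).subtype.lTensor P := by
    rw [LinearMap.rTensor_comp_lTensor]
  unfold box
  rw [this, LinearMap.range_comp, LinearMap.range_eq_top.2 (LinearMap.lTensor_surjective _ ?_),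
    Submodule.map_top]
  intro x; exact ⟨⟨x, trivial⟩, rfl⟩

theorem top_box (Q : Submodule R W₂) :
    box (⊤ : Submodule R W₁) Q = LinearMap.range (Q.subtype.lTensor W₁) := by
  have : TensorProduct.mapIncl (⊤ : Submodule R W₁) Q =
      Q.subtype.lTensor W₁ ∘ₗ (⊤ : Submodule R W₁).subtype.rTensor Q := by
    rw [LinearMap.lTensor_comp_rTensor]
  unfold box
  rw [this, LinearMap.range_comp, LinearMap.range_eq_top.2 (LinearMap.rTensor_surjective _ ?_),
    Submodule.map_top]
  intro x; exact ⟨⟨x, trivial⟩, rfl⟩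

theorem ker_map_of_surjective {Z₁ Z₂ : Type*} [AddCommGroup Z₁] [Module R Z₁] [AddCommGroup Z₂]
    [Module R Z₂] (f : W₁ →ₗ[R] Z₁) (g : W₂ →ₗ[R] Z₂) (hf : Function.Surjective f)
    (hg : Function.Surjective g) :
    LinearMap.ker (TensorProduct.map f g) = box (LinearMap.ker f) ⊤ ⊔ box ⊤ (LinearMap.ker g) := by
  have hef : Function.Exact (LinearMap.ker f).subtype f := LinearMap.exact_subtype_ker_map f
  have heg : Function.Exact (LinearMap.ker g).subtype g := LinearMap.exact_subtype_ker_map g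
  rw [TensorProduct.map_ker hef hf heg hg, sup_comm, box_top, top_box]

theorem ker_map_mkQ (P : Submodule R W₁) (Q : Submodule R W₂) :
    LinearMap.ker (TensorProduct.map P.mkQ Q.mkQ) = box P ⊤ ⊔ box ⊤ Q := by
  rw [ker_map_of_surjective _ _ P.mkQ_surjective Q.mkQ_surjective, P.ker_mkQ, Q.ker_mkQ]

/-- Tensoring with the flat module `W₂ / Y` preserves the intersection of submodules of `W₁`. -/
theorem box_sup_inf_le (P P' : Submodule R W₁) (Y : Submodule R W₂) [Module.Flat R (W₂ ⧸ Y)] :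
    (box P ⊤ ⊔ box ⊤ Y) ⊓ (box P' ⊤ ⊔ box ⊤ Y) ≤ box (P ⊓ P') ⊤ ⊔ box ⊤ Y := by
  rw [← ker_map_mkQ, ← ker_map_mkQ, ← ker_map_mkQ]
  rintro x ⟨h1, h2⟩
  let g : (W₁ ⧸ (P ⊓ P')) →ₗ[R] (W₁ ⧸ P) × (W₁ ⧸ P') :=
    (Submodule.factor inf_le_left).prod (Submodule.factor inf_le_right)
  have hg : Function.Injective g := by
    rw [← LinearMap.ker_eq_bot, eq_bot_iff]
    intro x hx
    obtain ⟨x, rfl⟩ := Submodule.mkQ_surjective _ x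
    have h1 : Submodule.mkQ P x = 0 := congrArg Prod.fst hx
    have h2 : Submodule.mkQ P' x = 0 := congrArg Prod.snd hx
    exact (Submodule.Quotient.mk_eq_zero _).2 ⟨(Submodule.Quotient.mk_eq_zero _).1 h1,
      (Submodule.Quotient.mk_eq_zero _).1 h2⟩
  have hinj := Module.Flat.rTensor_preserves_injective_linearMap (M := W₂ ⧸ Y) g hg
  have hinj' := (TensorProduct.prodLeft R R (W₁ ⧸ P) (W₁ ⧸ P') (W₂ ⧸ Y)).injective.comp hinj
  refine hinj' ?_
  have h3 : (TensorProduct.prodLeft R R (W₁ ⧸ P) (W₁ ⧸ P') (W₂ ⧸ Y)).toLinearMap ∘ₗ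
      g.rTensor (W₂ ⧸ Y) ∘ₗ TensorProduct.map (P ⊓ P').mkQ Y.mkQ =
      (TensorProduct.map P.mkQ Y.mkQ).prod (TensorProduct.map P'.mkQ Y.mkQ) := by
    ext <;> simp [g]
  have h4 := LinearMap.congr_fun h3 x
  refine h4.trans ?_
  rw [Function.comp_apply, map_zero, map_zero]
  exact Prod.ext h1 h2

theorem map_comm_box (P : Submodule R W₁) (Q : Submodule R W₂) :
    (box P Q).map (TensorProduct.comm R W₁ W₂).toLinearMap = box Q P := by
  have h : (TensorProduct.comm R W₁ W₂).toLinearMap ∘ₗ TensorProduct.mapIncl P Q =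
      TensorProduct.mapIncl Q P ∘ₗ (TensorProduct.comm R P Q).toLinearMap := by
    ext; simp [TensorProduct.mapIncl]
  rw [← LinearMap.range_comp, h, LinearMap.range_comp, LinearEquiv.range, Submodule.map_top]

theorem box_sup_inf_le' (P : Submodule R W₁) (Y Y' : Submodule R W₂) [Module.Flat R (W₁ ⧸ P)] :
    (box P ⊤ ⊔ box ⊤ Y) ⊓ (box P ⊤ ⊔ box ⊤ Y') ≤ box P ⊤ ⊔ box ⊤ (Y ⊓ Y') := by
  have h := box_sup_inf_le Y Y' P
  have h' := Submodule.map_mono (f := (TensorProduct.comm R W₂ W₁).toLinearMap) h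
  rw [Submodule.map_inf _ (TensorProduct.comm R W₂ W₁).injective] at h'
  simpa only [Submodule.map_sup, map_comm_box, sup_comm] using h'

theorem box_inf_le (P : Submodule R W₁) (Q : Submodule R W₂) [Module.Flat R (W₂ ⧸ Q)] :
    box P ⊤ ⊓ box ⊤ Q ≤ box P Q := by
  rw [box_top, top_box]
  rintro _ ⟨⟨y, rfl⟩, ⟨z, hz⟩⟩
  have h1 : Q.mkQ.lTensor W₁ (P.subtype.rTensor W₂ y) = 0 := by
    rw [← hz]
    exact (lTensor_exact W₁ (LinearMap.exact_subtype_mkQ Q) Q.mkQ_surjective _).2 ⟨z, rfl⟩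
  rw [← LinearMap.comp_apply, LinearMap.lTensor_comp_rTensor, ← LinearMap.rTensor_comp_lTensor,
    LinearMap.comp_apply] at h1
  have h2 := Module.Flat.rTensor_preserves_injective_linearMap (M := W₂ ⧸ Q) P.subtype
    P.subtype_injective (h1.trans (map_zero _).symm)
  obtain ⟨w, rfl⟩ := (lTensor_exact P (LinearMap.exact_subtype_mkQ Q) Q.mkQ_surjective _).1 h2
  refine ⟨w, ?_⟩
  rw [← LinearMap.comp_apply, LinearMap.rTensor_comp_lTensor]

end Flat

section Act

variable {R : Type*} [CommRing R] {T : Type*} [Ring T] [Algebra R T] {U : Type*} [AddCommGroup U]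
  [Module R U] [Module T U] [IsScalarTower R T U]

/-- The canonical map `P ⊗ Q → U` for submodules `P` of an algebra and `Q` of a module `U`. -/
def actMap (P : Submodule R T) (Q : Submodule R U) : P ⊗[R] Q →ₗ[R] U :=
  TensorProduct.lift (((Algebra.lsmul R R U).toLinearMap ∘ₗ P.subtype).compl₂ Q.subtype)

@[simp]
theorem actMap_tmul (P : Submodule R T) (Q : Submodule R U) (x : P) (y : Q) :
    actMap P Q (x ⊗ₜ y) = (x : T) • (y : U) := rfl

/-- `Q₀ / Y` is flat. -/
abbrev FlatQuot {W : Type*} [AddCommGroup W] [Module R W] (Y Q₀ : Submodule R W) : Prop :=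
  Module.Flat R (Q₀ ⧸ Y.submoduleOf Q₀)

theorem map_actMap_box {P P₀ : Submodule R T} {Q Q₀ : Submodule R U} (hP : P ≤ P₀) (hQ : Q ≤ Q₀) :
    (box (P.submoduleOf P₀) (Q.submoduleOf Q₀)).map (actMap P₀ Q₀) = P • Q := by
  apply le_antisymm
  · rintro _ ⟨_, ⟨ξ, rfl⟩, rfl⟩
    induction ξ with
    | zero => simp
    | add x y hx hy => rw [map_add, map_add]; exact add_mem hx hy
    | tmul x y => exact Submodule.smul_mem_smul x.2 y.2
  · rw [Submodule.smul_le]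
    intro x hx y hy
    exact ⟨_, ⟨(⟨⟨x, hP hx⟩, hx⟩ : P.submoduleOf P₀) ⊗ₜ
      (⟨⟨y, hQ hy⟩, hy⟩ : Q.submoduleOf Q₀), rfl⟩, rfl⟩

theorem range_actMap (P : Submodule R T) (Q : Submodule R U) :
    LinearMap.range (actMap P Q) = P • Q := by
  apply le_antisymm
  · rintro _ ⟨ξ, rfl⟩
    induction ξ with
    | zero => simp
    | add x y hx hy => rw [map_add]; exact add_mem hx hy
    | tmul x y => exact Submodule.smul_mem_smul x.2 y.2
  · rw [Submodule.smul_le]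
    intro x hx y hy
    exact ⟨⟨x, hx⟩ ⊗ₜ ⟨y, hy⟩, rfl⟩

theorem map_actMap_box_top {P P₀ : Submodule R T} {Q₀ : Submodule R U} (hP : P ≤ P₀) :
    (box (P.submoduleOf P₀) ⊤).map (actMap P₀ Q₀) = P • Q₀ := by
  rw [← map_actMap_box hP le_rfl, Submodule.submoduleOf_self]

theorem map_actMap_top_box {P₀ : Submodule R T} {Q Q₀ : Submodule R U} (hQ : Q ≤ Q₀) :
    (box ⊤ (Q.submoduleOf Q₀)).map (actMap P₀ Q₀) = P₀ • Q := by
  rw [← map_actMap_box le_rfl hQ, Submodule.submoduleOf_self]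

variable {P₀ : Submodule R T} {Q₀ : Submodule R U} (hinj : Function.Injective (actMap P₀ Q₀))
include hinj

/-- The lemma `box_sup_inf_le` inside a module in which `P₀ ⊗ Q₀` embeds. -/
theorem smul_sup_inf_le {P P' : Submodule R T} {Y : Submodule R U} (hP : P ≤ P₀) (hP' : P' ≤ P₀)
    (hY : Y ≤ Q₀) [FlatQuot Y Q₀] :
    (P • Q₀ ⊔ P₀ • Y) ⊓ (P' • Q₀ ⊔ P₀ • Y) ≤ (P ⊓ P') • Q₀ ⊔ P₀ • Y := by
  have h := Submodule.map_mono (f := actMap P₀ Q₀)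
    (box_sup_inf_le (P.submoduleOf P₀) (P'.submoduleOf P₀) (Y.submoduleOf Q₀))
  rw [Submodule.map_inf _ hinj] at h
  have e : P.submoduleOf P₀ ⊓ P'.submoduleOf P₀ = (P ⊓ P').submoduleOf P₀ := rfl
  rw [e] at h
  simpa only [Submodule.map_sup, map_actMap_box_top hP, map_actMap_box_top hP',
    map_actMap_box_top (inf_le_left.trans hP : P ⊓ P' ≤ P₀), map_actMap_top_box hY] using h

theorem smul_sup_inf_le' {P : Submodule R T} {Y Y' : Submodule R U} (hP : P ≤ P₀)
    (hY : Y ≤ Q₀) (hY' : Y' ≤ Q₀) [FlatQuot P P₀] :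
    (P • Q₀ ⊔ P₀ • Y) ⊓ (P • Q₀ ⊔ P₀ • Y') ≤ P • Q₀ ⊔ P₀ • (Y ⊓ Y') := by
  have h := Submodule.map_mono (f := actMap P₀ Q₀)
    (box_sup_inf_le' (P.submoduleOf P₀) (Y.submoduleOf Q₀) (Y'.submoduleOf Q₀))
  rw [Submodule.map_inf _ hinj] at h
  have e : Y.submoduleOf Q₀ ⊓ Y'.submoduleOf Q₀ = (Y ⊓ Y').submoduleOf Q₀ := rfl
  rw [e] at h
  simpa only [Submodule.map_sup, map_actMap_box_top hP,
    map_actMap_top_box (inf_le_left.trans hY : Y ⊓ Y' ≤ Q₀),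
    map_actMap_top_box hY, map_actMap_top_box hY'] using h

/-- The lemma `box_inf_le` inside a module in which `P₀ ⊗ Q₀` embeds. -/
theorem smul_inf_smul_le {P : Submodule R T} {Q : Submodule R U} (hP : P ≤ P₀)
    (hQ : Q ≤ Q₀) [FlatQuot Q Q₀] : P • Q₀ ⊓ P₀ • Q ≤ P • Q := by
  have h := Submodule.map_mono (f := actMap P₀ Q₀)
    (box_inf_le (P.submoduleOf P₀) (Q.submoduleOf Q₀))
  rw [Submodule.map_inf _ hinj] at h
  simpa only [map_actMap_box hP hQ, map_actMap_box_top hP, map_actMap_top_box hQ] using h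

omit hinj in
theorem flatQuot_map_ker {X Z : Type*} [AddCommGroup X] [Module R X] [AddCommGroup Z] [Module R Z]
    [Module.Flat R Z] (f : X →ₗ[R] Z) (hf : Function.Surjective f) (j : X →ₗ[R] U)
    (hj : Function.Injective j) :
    FlatQuot ((LinearMap.ker f).map j) (LinearMap.range j) := by
  let e : X ≃ₗ[R] LinearMap.range j := LinearEquiv.ofInjective j hj
  have he : (LinearMap.ker f).map e.toLinearMap =
      ((LinearMap.ker f).map j).submoduleOf (LinearMap.range j) := by
    apply Submodule.map_injective_of_injective (LinearMap.range j).subtype_injective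
    rw [← Submodule.map_comp]
    have h1 : (LinearMap.range j).subtype ∘ₗ e.toLinearMap = j := rfl
    rw [h1, Submodule.submoduleOf, Submodule.map_comap_eq, Submodule.range_subtype]
    exact (inf_eq_right.2 (LinearMap.map_le_range)).symm
  exact Module.Flat.of_linearEquiv (M := Z)
    ((Submodule.Quotient.equiv _ _ e he).symm.trans (f.quotKerEquivOfSurjective hf))

/-- The quotient of `P₀ ⊗ Q₀` by `P ⊗ Q₀ + P₀ ⊗ Q` is `P₀ / P ⊗ Q₀ / Q`. -/
theorem flatQuot_smul {P : Submodule R T} {Q : Submodule R U} (hP : P ≤ P₀)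
    (hQ : Q ≤ Q₀) [FlatQuot P P₀] [FlatQuot Q Q₀] :
    FlatQuot (P • Q₀ ⊔ P₀ • Q) (P₀ • Q₀) := by
  have hs : Function.Surjective
      (TensorProduct.map (P.submoduleOf P₀).mkQ (Q.submoduleOf Q₀).mkQ) :=
    TensorProduct.map_surjective (Submodule.mkQ_surjective _) (Submodule.mkQ_surjective _)
  have h := flatQuot_map_ker (X := P₀ ⊗[R] Q₀) _ hs (actMap P₀ Q₀) hinj
  rwa [ker_map_mkQ, Submodule.map_sup, map_actMap_box_top hP, map_actMap_top_box hQ,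
    range_actMap] at h

omit hinj in
/-- The kernel of a tensor product `f ⊗ g` on `P₀ ⊗ Q₀`, when the tensor product of the images
embeds. -/
theorem actMap_mem_of_map_eq_zero {A' B' : Type*} [AddCommGroup A'] [Module R A'] [AddCommGroup B']
    [Module R B'] (f : T →ₗ[R] A') (g : U →ₗ[R] B')
    (hfg : Function.Injective (TensorProduct.mapIncl (P₀.map f) (Q₀.map g))) (ξ : P₀ ⊗[R] Q₀)
    (h : TensorProduct.map (f ∘ₗ P₀.subtype) (g ∘ₗ Q₀.subtype) ξ = 0) :
    actMap P₀ Q₀ ξ ∈ (P₀ ⊓ LinearMap.ker f) • Q₀ ⊔ P₀ • (Q₀ ⊓ LinearMap.ker g) := by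
  let f' : P₀ →ₗ[R] P₀.map f := f.restrict fun x hx => Submodule.mem_map_of_mem hx
  let g' : Q₀ →ₗ[R] Q₀.map g := g.restrict fun x hx => Submodule.mem_map_of_mem hx
  have hf' : Function.Surjective f' := by rintro ⟨_, x, hx, rfl⟩; exact ⟨⟨x, hx⟩, rfl⟩
  have hg' : Function.Surjective g' := by rintro ⟨_, x, hx, rfl⟩; exact ⟨⟨x, hx⟩, rfl⟩
  have h1 : TensorProduct.map f' g' ξ = 0 := by
    apply hfg
    rw [map_zero, ← h, TensorProduct.mapIncl, ← LinearMap.comp_apply, ← TensorProduct.map_comp]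
    rfl
  have h2 : ξ ∈ LinearMap.ker (TensorProduct.map f' g') := h1
  rw [ker_map_of_surjective f' g' hf' hg'] at h2
  have h3 := Submodule.mem_map_of_mem (f := actMap P₀ Q₀) h2
  have ef : LinearMap.ker f' = (P₀ ⊓ LinearMap.ker f).submoduleOf P₀ := by
    ext x; simp [f', Submodule.submoduleOf, Subtype.ext_iff]
  have eg : LinearMap.ker g' = (Q₀ ⊓ LinearMap.ker g).submoduleOf Q₀ := by
    ext x; simp [g', Submodule.submoduleOf, Subtype.ext_iff]
  rw [ef, eg, Submodule.map_sup, map_actMap_box_top inf_le_left,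
    map_actMap_top_box inf_le_left] at h3
  exact h3

end Act

/-! ### Distributivity of a tensor product of collections -/

section TensorDistrib

variable {R : Type*} [CommRing R]

/-- The direct image under an injective linear map, as a lattice homomorphism. -/
def mapLatticeHom {W W' : Type*} [AddCommGroup W] [Module R W] [AddCommGroup W'] [Module R W']
    (f : W →ₗ[R] W') (hf : Function.Injective f) :
    LatticeHom (Submodule R W) (Submodule R W') where
  toFun := Submodule.map f
  map_sup' _ _ := Submodule.map_sup _ _ _
  map_inf' _ _ := Submodule.map_inf _ hf

theorem isDistribSet_map {W W' : Type*} [AddCommGroup W] [Module R W] [AddCommGroup W']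
    [Module R W'] {f : W →ₗ[R] W'} (hf : Function.Injective f) {X : Set (Submodule R W)} :
    IsDistribSet (Submodule.map f '' X) ↔ IsDistribSet X :=
  ⟨IsDistribSet.of_image (mapLatticeHom f hf) (Submodule.map_injective_of_injective hf),
    IsDistribSet.image (mapLatticeHom f hf)⟩

section FlatQuot

variable {W : Type*} [AddCommGroup W] [Module R W]

theorem submoduleOf_sup_of_le {Y Y' Q₀ : Submodule R W} (hY : Y ≤ Q₀) (hY' : Y' ≤ Q₀) :
    Y.submoduleOf Q₀ ⊔ Y'.submoduleOf Q₀ = (Y ⊔ Y').submoduleOf Q₀ := by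
  apply Submodule.map_injective_of_injective Q₀.subtype_injective
  rw [Submodule.map_sup]
  simp only [Submodule.submoduleOf, Submodule.map_comap_subtype]
  rw [inf_eq_right.2 hY, inf_eq_right.2 hY', inf_eq_right.2 (sup_le hY hY')]

theorem FlatQuot.inf {Y Y' Q₀ : Submodule R W} (h : FlatQuot Y Q₀) (h' : FlatQuot Y' Q₀)
    (hs : FlatQuot (Y ⊔ Y') Q₀) (hY : Y ≤ Q₀) (hY' : Y' ≤ Q₀) : FlatQuot (Y ⊓ Y') Q₀ := by
  have h2 : Module.Flat R (Q₀ ⧸ (Y.submoduleOf Q₀ ⊔ Y'.submoduleOf Q₀)) := by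
    rw [submoduleOf_sup_of_le hY hY']; exact hs
  exact flat_quotient_inf (Y.submoduleOf Q₀) (Y'.submoduleOf Q₀)

theorem FlatQuot.self (Q₀ : Submodule R W) : FlatQuot Q₀ Q₀ := by
  have : Subsingleton (Q₀ ⧸ Q₀.submoduleOf Q₀) := by
    rw [Submodule.submoduleOf_self]; exact Submodule.Quotient.subsingleton_iff.2 rfl
  show Module.Flat R _
  infer_instance

theorem FlatQuot.bot (Q₀ : Submodule R W) [Module.Flat R Q₀] : FlatQuot ⊥ Q₀ := by
  have : (⊥ : Submodule R W).submoduleOf Q₀ = ⊥ := by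
    rw [Submodule.submoduleOf, Submodule.comap_bot, Submodule.ker_subtype]
  show Module.Flat R _
  rw [this]
  exact Module.Flat.of_linearEquiv (Submodule.quotEquivOfEqBot _ rfl)

theorem FlatQuot.flat {Y Q₀ : Submodule R W} [Module.Flat R Q₀] (h : FlatQuot Y Q₀)
    (hY : Y ≤ Q₀) : Module.Flat R Y := by
  have := flat_of_flat_quotient (Y.submoduleOf Q₀)
  exact Module.Flat.of_linearEquiv (Submodule.submoduleOfEquivOfLe hY).symm

theorem flatQuot_congr {Y Y' Q₀ : Submodule R W} (h : Y.submoduleOf Q₀ = Y'.submoduleOf Q₀)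
    (hY : FlatQuot Y Q₀) : FlatQuot Y' Q₀ := by
  show Module.Flat R _
  rw [← h]; exact hY

/-- Flatness of the quotients by all sums of members of a distributive collection implies
flatness of the quotients by intersections of sums. -/
theorem flatQuot_finset_inf {κ : Type*} [DecidableEq κ] {N : κ → Submodule R W} {s : Finset κ}
    {Q₀ : Submodule R W} (hN : IsDistribSet (N '' s)) (hle : ∀ q ∈ s, N q ≤ Q₀)
    (hflat : ∀ Z ⊆ s, FlatQuot (Z.sup N) Q₀) {F : Finset κ} (hF : F ⊆ s) :
    ∀ Z ⊆ s, FlatQuot (Q₀ ⊓ F.inf fun q => Z.sup N ⊔ N q) Q₀ := by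
  obtain ⟨E, hE, hX, hb, ht⟩ := hN.exists_bounded
  have hmem : ∀ Z ⊆ s, Z.sup N ∈ E := fun Z hZ =>
    Sublattice.finset_sup_mem hb _ fun i hi => hX ⟨i, hZ hi, rfl⟩
  have hsle : ∀ Z ⊆ s, Z.sup N ≤ Q₀ := fun Z hZ => Finset.sup_le fun i hi => hle i (hZ hi)
  induction F using Finset.induction_on with
  | empty =>
    intro Z hZ
    rw [Finset.inf_empty, inf_top_eq]
    exact FlatQuot.self Q₀
  | insert a F ha ih =>
    intro Z hZ
    have hF' := (Finset.subset_insert _ _).trans hF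
    have haZ : insert a Z ⊆ s := Finset.insert_subset (hF (Finset.mem_insert_self _ _)) hZ
    have e : (insert a Z).sup N = Z.sup N ⊔ N a := by rw [Finset.sup_insert, sup_comm]
    have h1 := ih hF' Z hZ
    have h2 := hflat _ haZ
    have h3 := ih hF' _ haZ
    have hle' := hsle _ haZ
    rw [e] at h2 h3 hle'
    rw [Finset.inf_insert, inf_left_comm]
    refine h2.inf h1 (flatQuot_congr ?_ h3) hle' inf_le_left
    congr 1
    have haE : Z.sup N ⊔ N a ∈ E := e ▸ hmem _ haZ
    apply le_antisymm
    · -- the distributive law inside the sublattice generated by the collection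
      refine le_trans (b := Q₀ ⊓ F.inf fun q => Z.sup N ⊔ N a ⊔ (Z.sup N ⊔ N q))
        (inf_le_inf_left _ ?_) ?_
      · exact Finset.le_inf fun q hq => (Finset.inf_le hq).trans
          (sup_le (le_sup_left) (le_sup_right.trans le_sup_right))
      · refine (inf_le_inf_left _ (finset_inf_sup_le hE ht F
          (f := fun q => Z.sup N ⊔ N q) (fun q hq => ?_) haE)).trans ?_
        · exact E.sup_mem (hmem Z hZ) (hX ⟨q, hF' hq, rfl⟩)
        · rw [inf_comm, sup_inf_assoc_of_le _ hle', inf_comm]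
    · refine sup_le (le_inf hle' (Finset.le_inf fun q _ => le_sup_left)) ?_
      exact inf_le_inf_left _ (Finset.inf_mono_fun fun q _ =>
        sup_le (le_sup_left.trans le_sup_left) le_sup_right)

end FlatQuot

variable {T : Type*} [Ring T] [Algebra R T] {U : Type*} [AddCommGroup U]
  [Module R U] [Module T U] [IsScalarTower R T U]
  {P₀ : Submodule R T} {Q₀ : Submodule R U} (hinj : Function.Injective (actMap P₀ Q₀))
include hinj

theorem finset_inf_smul_sup_le {ι : Type*} {P : ι → Submodule R T} (F : Finset ι)
    (hP : ∀ i ∈ F, P i ≤ P₀) {Y : Submodule R U} (hY : Y ≤ Q₀) [FlatQuot Y Q₀] :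
    P₀ • Q₀ ⊓ (F.inf fun i => P i • Q₀ ⊔ P₀ • Y) ≤ (P₀ ⊓ F.inf P) • Q₀ ⊔ P₀ • Y := by
  classical
  induction F using Finset.induction_on with
  | empty => simp
  | insert a F ha ih =>
    rw [Finset.inf_insert, Finset.inf_insert, inf_left_comm]
    refine (inf_le_inf_left _ (ih fun i hi => hP i (Finset.mem_insert_of_mem hi))).trans ?_
    refine (smul_sup_inf_le hinj (hP a (Finset.mem_insert_self _ _)) inf_le_left hY).trans ?_
    rw [inf_left_comm]

theorem finset_inf_smul_sup_le' {κ : Type*} {P : Submodule R T} {N : κ → Submodule R U}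
    (F : Finset κ) (hP : P ≤ P₀) (hN : ∀ i ∈ F, N i ≤ Q₀) [FlatQuot P P₀] :
    P₀ • Q₀ ⊓ (F.inf fun i => P • Q₀ ⊔ P₀ • N i) ≤ P • Q₀ ⊔ P₀ • (Q₀ ⊓ F.inf N) := by
  classical
  induction F using Finset.induction_on with
  | empty => simp
  | insert a F ha ih =>
    rw [Finset.inf_insert, Finset.inf_insert, inf_left_comm]
    refine (inf_le_inf_left _ (ih fun i hi => hN i (Finset.mem_insert_of_mem hi))).trans ?_
    refine (smul_sup_inf_le' hinj hP (hN a (Finset.mem_insert_self _ _)) inf_le_left).trans ?_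
    rw [inf_left_comm]

theorem finset_inf_smul_le {κ : Type*} {N : κ → Submodule R U} [Module.Flat R P₀]
    (F : Finset κ) (hN : ∀ i ∈ F, N i ≤ Q₀) :
    P₀ • Q₀ ⊓ (F.inf fun i => P₀ • N i) ≤ P₀ • (Q₀ ⊓ F.inf N) := by
  have := FlatQuot.bot P₀
  simpa using finset_inf_smul_sup_le' hinj F bot_le hN

/-- Distributive collections in `P₀` and in `Q₀` together form a distributive collection in
`P₀ ⊗ Q₀`, provided that all quotients of `Q₀` by sums of members are flat. -/
theorem isDistribSet_tensor {ι κ : Type*} [DecidableEq ι] [DecidableEq κ] [Module.Flat R P₀]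
    {P : ι → Submodule R T} {s : Finset ι} {N : κ → Submodule R U} {g : Finset κ}
    (hP : IsDistribSet (P '' s)) (hN : IsDistribSet (N '' g)) (hPle : ∀ i ∈ s, P i ≤ P₀)
    (hNle : ∀ q ∈ g, N q ≤ Q₀) (hflat : ∀ Z ⊆ g, FlatQuot (Z.sup N) Q₀) :
    IsDistribSet ((fun i => P i • Q₀) '' s ∪ (fun q => P₀ • N q) '' g) := by
  obtain ⟨E, hE, hX, hb, ht⟩ := hN.exists_bounded
  have hmem : ∀ Z ⊆ g, Z.sup N ∈ E := fun Z hZ =>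
    Sublattice.finset_sup_mem hb _ fun i hi => hX ⟨i, hZ hi, rfl⟩
  have hsle : ∀ Z ⊆ g, Z.sup N ≤ Q₀ := fun Z hZ => Finset.sup_le fun i hi => hNle i (hZ hi)
  -- the statement is proved for all collections obtained by adding a fixed sum of the `N q`
  suffices h : ∀ G ⊆ g, ∀ Z ⊆ g, IsDistribSet
      ((Sum.elim (fun i => P i • Q₀ ⊔ P₀ • Z.sup N) fun q => P₀ • (N q ⊔ Z.sup N)) ''
        (s.disjSum G : Finset (ι ⊕ κ))) by
    refine (h g subset_rfl ∅ (Finset.empty_subset _)).mono ?_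
    rintro _ (⟨i, hi, rfl⟩ | ⟨q, hq, rfl⟩)
    · exact ⟨Sum.inl i, by simpa using hi, by simp⟩
    · exact ⟨Sum.inr q, by simpa using hq, by simp⟩
  intro G
  induction G using Finset.induction_on with
  | empty =>
    intro _ Z hZ
    have := hflat Z hZ
    have hZ' := hsle Z hZ
    -- `X ↦ X ⊗ Q₀ + P₀ ⊗ Z` preserves meets, since the quotient of `Q₀` by the sum over `Z` is flat
    let f : LatticeHom (Submodule R P₀) (Submodule R U) :=
      { toFun := fun X => X.map P₀.subtype • Q₀ ⊔ P₀ • Z.sup N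
        map_sup' := fun X Y => by
          rw [Submodule.map_sup, Submodule.sup_smul, sup_sup_distrib_right]
        map_inf' := fun X Y => by
          rw [Submodule.map_inf _ P₀.subtype_injective]
          apply le_antisymm
          · exact le_inf (sup_le_sup_right (Submodule.smul_mono inf_le_left le_rfl) _)
              (sup_le_sup_right (Submodule.smul_mono inf_le_right le_rfl) _)
          · exact smul_sup_inf_le hinj (Submodule.map_subtype_le _ _)
              (Submodule.map_subtype_le _ _) hZ' }
    have hP' : IsDistribSet ((fun i => (P i).submoduleOf P₀) '' s) := by
      rw [← isDistribSet_map P₀.subtype_injective, Set.image_image]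
      refine hP.mono ?_
      rintro _ ⟨i, hi, rfl⟩
      refine ⟨i, hi, ?_⟩
      simp only [Submodule.submoduleOf, Submodule.map_comap_subtype]
      exact (inf_eq_right.2 (hPle i hi)).symm
    refine (hP'.image f).mono ?_
    rintro _ ⟨x, hx, rfl⟩
    obtain ⟨i, hi, rfl⟩ : ∃ i ∈ s, Sum.inl i = x := by simpa using hx
    refine ⟨_, ⟨i, hi, rfl⟩, ?_⟩
    show Submodule.map P₀.subtype ((P i).submoduleOf P₀) • Q₀ ⊔ _ = _
    simp only [Submodule.submoduleOf, Submodule.map_comap_subtype, Sum.elim_inl]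
    rw [inf_eq_right.2 (hPle i hi)]
  | insert q G hq ih =>
    intro hG Z hZ
    have hG' := (Finset.subset_insert _ _).trans hG
    have hqg := hG (Finset.mem_insert_self _ _)
    have hqZ : insert q Z ⊆ g := Finset.insert_subset hqg hZ
    have e : (insert q Z).sup N = N q ⊔ Z.sup N := Finset.sup_insert
    obtain ⟨X, hXdef⟩ : ∃ X : ι ⊕ κ → Submodule R U, X = Sum.elim
      (fun i => P i • Q₀ ⊔ P₀ • Z.sup N) fun q => P₀ • (N q ⊔ Z.sup N) := ⟨_, rfl⟩
    have hXN : ∀ x, X x ⊔ P₀ • (N q ⊔ Z.sup N) = (Sum.elim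
        (fun i => P i • Q₀ ⊔ P₀ • (insert q Z).sup N)
          fun q' => P₀ • (N q' ⊔ (insert q Z).sup N)) x := by
      rintro (i | q') <;> rw [hXdef, e] <;>
        simp only [Sum.elim_inl, Sum.elim_inr, Submodule.smul_sup]
      all_goals rw [sup_assoc,
        sup_eq_right.2 (le_sup_right : P₀ • Z.sup N ≤ P₀ • N q ⊔ P₀ • Z.sup N)]
    have key := isDistribSet_insert (s := s.disjSum G) (X := X) (N := P₀ • (N q ⊔ Z.sup N))
      (hXdef ▸ ih hG' Z hZ) (by simp only [hXN]; exact ih hG' _ hqZ) ?_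
    · refine key.mono ?_
      rintro _ ⟨i | q', hx, rfl⟩
      · exact Or.inr ⟨Sum.inl i, by simpa using hx, by rw [hXdef]⟩
      · obtain rfl | hx : q' = q ∨ q' ∈ G := by simpa using hx
        · exact Or.inl rfl
        · exact Or.inr ⟨Sum.inr q', by simpa using hx, by rw [hXdef]⟩
    · intro F hF
      rcases F.eq_empty_or_nonempty with rfl | ⟨x₀, hx₀⟩
      · simp
      simp only [hXN]
      have hS := hsle _ hqZ
      have := hflat _ hqZ
      have hFl : ∀ i ∈ F.toLeft, P i ≤ P₀ := fun i hi => hPle i (by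
        simpa using hF (Finset.mem_toLeft.1 hi))
      have hFr : F.toRight ⊆ g := fun i hi => hG' (by simpa using hF (Finset.mem_toRight.1 hi))
      -- the meet over `F` lies in `(P' ⊗ Q₀ + P₀ ⊗ S') ∩ (P₀ ⊗ Y)`, where `P'` is the meet of the
      -- `P i` in `F` and `Y` that of the `S' + N q'`
      obtain ⟨S', hS'⟩ : ∃ S', S' = (insert q Z).sup N := ⟨_, rfl⟩
      obtain ⟨Y, hY⟩ : ∃ Y, Y = Q₀ ⊓ F.toRight.inf fun q' => S' ⊔ N q' := ⟨_, rfl⟩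
      have hYf : FlatQuot Y Q₀ := by
        rw [hY, hS']; exact flatQuot_finset_inf hN hNle hflat hFr _ hqZ
      have hYQ : Y ≤ Q₀ := hY ▸ inf_le_left
      obtain ⟨P', hP'⟩ : ∃ P', P' = P₀ ⊓ F.toLeft.inf P := ⟨_, rfl⟩
      have hP'P : P' ≤ P₀ := hP' ▸ inf_le_left
      rw [← hS'] at hS this ⊢
      have hSY : S' ≤ Y := hY ▸ le_inf hS (Finset.le_inf fun _ _ => le_sup_left)
      have hle : (F.inf (Sum.elim (fun i => P i • Q₀ ⊔ P₀ • S') fun q' => P₀ • (N q' ⊔ S'))) ≤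
          (P' • Q₀ ⊔ P₀ • S') ⊓ P₀ • Y := by
        have h0 : (F.inf (Sum.elim (fun i => P i • Q₀ ⊔ P₀ • S') fun q' => P₀ • (N q' ⊔ S'))) ≤
            P₀ • Q₀ := by
          refine (Finset.inf_le hx₀).trans ?_
          rcases x₀ with i | q'
          · exact sup_le (Submodule.smul_mono (hFl i (by simpa using hx₀)) le_rfl)
              (Submodule.smul_mono le_rfl hS)
          · exact Submodule.smul_mono le_rfl (sup_le (hNle _ (hFr (by simpa using hx₀))) hS)
        refine le_inf ?_ ?_
        · rw [hP']
          refine le_trans (le_inf h0 (Finset.le_inf fun i hi => ?_))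
            (finset_inf_smul_sup_le hinj F.toLeft hFl hS)
          exact Finset.inf_le (f := Sum.elim (fun i => P i • Q₀ ⊔ P₀ • S') fun q' =>
            P₀ • (N q' ⊔ S')) (Finset.mem_toLeft.1 hi)
        · rw [hY]
          refine le_trans (le_inf h0 (Finset.le_inf fun i hi => ?_))
            (finset_inf_smul_le hinj F.toRight fun i hi => sup_le hS (hNle i (hFr hi)))
          refine (Finset.inf_le (f := Sum.elim (fun i => P i • Q₀ ⊔ P₀ • S') fun q' =>
            P₀ • (N q' ⊔ S')) (Finset.mem_toRight.1 hi)).trans ?_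
          rw [Sum.elim_inr, sup_comm]
      -- by modularity and flatness of `Q₀ / Y` this is `P₀ ⊗ S' + P' ⊗ Y`
      refine hle.trans ?_
      rw [sup_comm, sup_inf_assoc_of_le _ (Submodule.smul_mono le_rfl hSY)]
      refine sup_le ?_ ((smul_inf_smul_le hinj hP'P hYQ).trans ?_)
      · rw [hS', e]; exact le_sup_right
      -- distributivity of the `N q'` splits off `N q` from `Y`
      have hYle : Y ≤ N q ⊔ (Q₀ ⊓ F.toRight.inf fun q' => Z.sup N ⊔ N q') := by
        rw [hY, inf_comm Q₀, inf_comm Q₀, ← sup_inf_assoc_of_le _ (hNle q hqg)]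
        refine inf_le_inf_right _ (le_trans (Finset.inf_mono_fun fun q' _ => ?_)
          (finset_inf_sup_le hE ht F.toRight (x := N q) (f := fun q' => Z.sup N ⊔ N q')
            (fun q' hq' => E.sup_mem (hmem Z hZ) (hX ⟨q', hFr hq', rfl⟩)) (hX ⟨q, hqg, rfl⟩)))
        rw [hS', e, sup_assoc]
      refine (Submodule.smul_mono le_rfl hYle).trans ?_
      rw [Submodule.smul_sup]
      refine sup_le ?_ (le_trans (Finset.le_inf fun x hx => ?_) le_sup_left)
      · exact (Submodule.smul_mono hP'P le_sup_left).trans le_sup_right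
      · rw [hXdef]
        rcases x with i | q'
        · refine le_trans (Submodule.smul_mono ?_ inf_le_left) le_sup_left
          rw [hP']; exact inf_le_right.trans (Finset.inf_le (Finset.mem_toLeft.2 hx))
        · refine Submodule.smul_mono hP'P (inf_le_right.trans ?_)
          refine (Finset.inf_le (Finset.mem_toRight.2 hx)).trans ?_
          rw [sup_comm]

end TensorDistrib

/-! ### Deconcatenation of tensors -/

section Deconcatenation

variable {R : Type*} [CommRing R]

theorem smul_eq_mul_submodule {T : Type*} [Ring T] [Algebra R T] (P Q : Submodule R T) :
    P • Q = P * Q := rfl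

/-- A homogeneous component of a graded algebra is a direct summand. -/
theorem rTensor_subtype_injective_of_graded {T : Type*} [Ring T] [Algebra R T]
    (𝒜 : ℕ → Submodule R T) [GradedAlgebra 𝒜] (a : ℕ) (X : Type*) [AddCommGroup X] [Module R X] :
    Function.Injective ((𝒜 a).subtype.rTensor X) := by
  let π : T →ₗ[R] 𝒜 a := (GradedAlgebra.proj 𝒜 a).codRestrict (𝒜 a) fun x => by
    rw [GradedAlgebra.proj_apply]; exact SetLike.coe_mem _
  have h : π ∘ₗ (𝒜 a).subtype = LinearMap.id := by
    ext x
    simp [π, GradedAlgebra.proj_apply]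
  have h' : π.rTensor X ∘ₗ (𝒜 a).subtype.rTensor X = LinearMap.id := by
    rw [← LinearMap.rTensor_comp, h, LinearMap.rTensor_id]
  exact Function.LeftInverse.injective fun x => LinearMap.congr_fun h' x

theorem mapIncl_injective_of_graded {T : Type*} [Ring T] [Algebra R T]
    (𝒜 : ℕ → Submodule R T) [GradedAlgebra 𝒜] (a : ℕ) [Module.Flat R (𝒜 a)]
    {U : Type*} [AddCommGroup U] [Module R U] (X : Submodule R U) :
    Function.Injective (TensorProduct.mapIncl (𝒜 a) X) := by
  have h : TensorProduct.mapIncl (𝒜 a) X =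
      (𝒜 a).subtype.rTensor U ∘ₗ X.subtype.lTensor (𝒜 a) := by
    rw [LinearMap.rTensor_comp_lTensor]
  rw [h]
  exact (rTensor_subtype_injective_of_graded 𝒜 a U).comp
    (Module.Flat.lTensor_preserves_injective_linearMap _ X.subtype_injective)

variable {E : Type*} [AddCommGroup E] [Module R E]

local notation "W" => LinearMap.range (TensorAlgebra.ι R : E →ₗ[R] TensorAlgebra R E)

/-- The map splitting off the first tensor factor of a tensor. -/
theorem exists_split_first : ∃ D : TensorAlgebra R E →ₗ[R] TensorAlgebra R E ⊗[R] TensorAlgebra R E,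
    ∀ (v : E) (x : TensorAlgebra R E),
      D (TensorAlgebra.ι R v * x) = TensorAlgebra.ι R v ⊗ₜ x := by
  -- `T(E)` acts on `T(E) × (T(E) ⊗ T(E))` so that `v` maps `(x, z)` to `(v x, v ⊗ x)`
  let f : E →ₗ[R] Module.End R (TensorAlgebra R E × (TensorAlgebra R E ⊗[R] TensorAlgebra R E)) :=
    { toFun := fun v => (LinearMap.mulLeft R (TensorAlgebra.ι R v) ∘ₗ LinearMap.fst R _ _).prod
        (TensorProduct.mk R _ _ (TensorAlgebra.ι R v) ∘ₗ LinearMap.fst R _ _)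
      map_add' := fun v w => by
        refine LinearMap.ext fun x => Prod.ext ?_ ?_
        · simp [add_mul]
        · simp
      map_smul' := fun r v => by
        refine LinearMap.ext fun x => Prod.ext ?_ ?_
        · simp
        · simp [TensorProduct.smul_tmul'] }
  let ρ := TensorAlgebra.lift R f
  have h1 : ∀ x y : TensorAlgebra R E, (ρ x (y, 0)).1 = x * y ∧
      ∀ z, (ρ x (y, z)).1 = (ρ x (y, 0)).1 := by
    intro x
    induction x using TensorAlgebra.induction with
    | algebraMap r =>
      intro y
      simp [ρ, Module.algebraMap_end_apply, Algebra.smul_def]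
    | ι v => intro y; simp [ρ, f]
    | mul a b ha hb =>
      intro y
      rw [map_mul, Module.End.mul_apply, mul_assoc, ← (hb y).1, ← (ha _).1]
      have e : ∀ z, ρ a (ρ b (y, z)) = ρ a ((ρ b (y, z)).1, (ρ b (y, z)).2) := fun z => rfl
      refine ⟨by rw [e, (ha _).2], fun z => ?_⟩
      rw [Module.End.mul_apply, e, (ha _).2, (hb y).2, e 0, (ha _).2 (ρ b (y, 0)).2]
    | add a b ha hb =>
      intro y
      refine ⟨?_, fun z => ?_⟩
      · rw [map_add, LinearMap.add_apply, Prod.fst_add, (ha y).1, (hb y).1, add_mul]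
      · rw [map_add, LinearMap.add_apply, LinearMap.add_apply, Prod.fst_add, Prod.fst_add,
          (ha y).2, (hb y).2]
  refine ⟨LinearMap.snd R _ _ ∘ₗ (LinearMap.applyₗ (1, 0)) ∘ₗ ρ.toLinearMap, fun v x => ?_⟩
  have h2 : ρ (TensorAlgebra.ι R v) = f v := TensorAlgebra.lift_ι_apply _ _
  show (ρ (TensorAlgebra.ι R v * x) (1, 0)).2 = _
  rw [map_mul, Module.End.mul_apply, h2]
  show TensorAlgebra.ι R v ⊗ₜ (ρ x (1, 0)).1 = _
  rw [(h1 x 1).1, mul_one]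

variable {U : Type*} [AddCommGroup U] [Module R U] [Module (TensorAlgebra R E) U]
  [IsScalarTower R (TensorAlgebra R E) U]

/-- If the first tensor factor can be split off in the `T(E)`-module `U`, then so can the first
`a` tensor factors. -/
theorem exists_split (D : U →ₗ[R] TensorAlgebra R E ⊗[R] U)
    (hD : ∀ (v : E) (u : U), D (TensorAlgebra.ι R v • u) = TensorAlgebra.ι R v ⊗ₜ u) (a : ℕ) :
    ∃ Δ : U →ₗ[R] TensorAlgebra R E ⊗[R] U, ∀ x ∈ W ^ a, ∀ u : U, Δ (x • u) = x ⊗ₜ u := by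
  induction a with
  | zero =>
    refine ⟨TensorProduct.mk R _ _ 1, fun x hx u => ?_⟩
    obtain ⟨r, rfl⟩ := Submodule.mem_one.1 (by simpa using hx)
    rw [algebraMap_smul, TensorProduct.mk_apply, TensorProduct.tmul_smul,
      TensorProduct.smul_tmul', Algebra.algebraMap_eq_smul_one]
  | succ a ih =>
    obtain ⟨Δ, hΔ⟩ := ih
    refine ⟨(LinearMap.mul' R (TensorAlgebra R E)).rTensor U ∘ₗ
      (TensorProduct.assoc R _ _ _).symm.toLinearMap ∘ₗ Δ.lTensor (TensorAlgebra R E) ∘ₗ D, ?_⟩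
    intro x hx u
    rw [pow_succ'] at hx
    induction hx using Submodule.mul_induction_on' with
    | add x hx y hy h1 h2 => rw [add_smul, map_add, h1, h2, TensorProduct.add_tmul]
    | mem_mul_mem v hv y hy =>
      obtain ⟨v, rfl⟩ := hv
      rw [mul_smul]
      simp [hD, hΔ y hy]

variable [Module.Flat R E]

/-- By splitting off the first factor, the `(a + 1)`-st tensor power of `E` is the tensor product
of `E` with the `a`-th. -/
theorem flat_pow_ι (a : ℕ) : Module.Flat R ↥(W ^ a) ∧
    Module.Flat R ↥W := by
  have h1 : Module.Flat R ↥W := Module.Flat.of_linearEquiv (M := E)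
    (LinearEquiv.ofInjective _ (TensorAlgebra.ι_leftInverse (R := R) (M := E)).injective).symm
  refine ⟨?_, h1⟩
  induction a with
  | zero =>
    rw [pow_zero, Submodule.one_eq_range]
    exact Module.Flat.of_linearEquiv (M := R) (LinearEquiv.ofInjective _
      (TensorAlgebra.algebraMap_leftInverse (R := R) E).injective).symm
  | succ a ih =>
    have h1' : Module.Flat R ↥(W ^ 1) := by rwa [pow_one]
    obtain ⟨D, hD⟩ := exists_split_first (R := R) (E := E)
    have h2 := mapIncl_injective_of_graded (fun n => W ^ n) 1 (W ^ a)
    have h3 : TensorProduct.mapIncl (W ^ 1) (W ^ a) = D ∘ₗ actMap (W ^ 1) (W ^ a) := by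
      ext ⟨x, hx⟩ ⟨y, hy⟩
      obtain ⟨v, rfl⟩ : x ∈ W := by simpa using hx
      simp [hD, TensorProduct.mapIncl]
    have h4 : Function.Injective (actMap (W ^ 1) (W ^ a)) := by
      rw [h3] at h2
      exact Function.Injective.of_comp h2
    have e := (LinearEquiv.ofInjective _ h4).trans (LinearEquiv.ofEq _ _ (range_actMap _ _))
    have h5 : W ^ 1 • W ^ a = W ^ (a + 1) := by
      rw [smul_eq_mul_submodule, ← pow_add, add_comm]
    rw [h5] at e
    exact Module.Flat.of_linearEquiv e.symm

/-- The map `E^{⊗ a} ⊗ X → U` is injective because splitting off the first `a` factors is a left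
inverse up to the inclusion of `E^{⊗ a} ⊗ X` in `T(E) ⊗ U`. -/
theorem actMap_pow_ι_injective (D : U →ₗ[R] TensorAlgebra R E ⊗[R] U)
    (hD : ∀ (v : E) (u : U), D (TensorAlgebra.ι R v • u) = TensorAlgebra.ι R v ⊗ₜ u) (a : ℕ)
    (X : Submodule R U) : Function.Injective (actMap (W ^ a) X) := by
  obtain ⟨Δ, hΔ⟩ := exists_split D hD a
  have := (flat_pow_ι (R := R) (E := E) a).1
  have h2 := mapIncl_injective_of_graded (fun n => W ^ n) a X
  have h3 : TensorProduct.mapIncl (W ^ a) X = Δ ∘ₗ actMap (W ^ a) X := by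
    ext ⟨x, hx⟩ ⟨y, hy⟩
    simp [hΔ x hx, TensorProduct.mapIncl]
  rw [h3] at h2
  exact Function.Injective.of_comp h2

end Deconcatenation

theorem iSup_fin_eq_sup {L : Type*} [CompleteLattice L] (n : ℕ) (f : ℕ → L) :
    (⨆ i : Fin n, f i) = (Finset.range n).sup f := by
  rw [Finset.sup_eq_iSup]
  apply le_antisymm
  · exact iSup_le fun i => le_iSup₂_of_le (i : ℕ) (Finset.mem_range.2 i.2) le_rfl
  · exact iSup₂_le fun i hi => le_iSup_of_le (⟨i, Finset.mem_range.1 hi⟩ : Fin n) le_rfl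

theorem iInf_fin_eq_inf {L : Type*} [CompleteLattice L] (n : ℕ) (f : ℕ → L) :
    (⨅ i : Fin n, f i) = (Finset.range n).inf f := by
  rw [Finset.inf_eq_iInf]
  apply le_antisymm
  · exact le_iInf₂ fun i hi => iInf_le_of_le (⟨i, Finset.mem_range.1 hi⟩ : Fin n) le_rfl
  · exact le_iInf fun i => iInf₂_le_of_le (i : ℕ) (Finset.mem_range.2 i.2) le_rfl

section FinsetSup

variable {R : Type*} [CommRing R] {T : Type*} [Ring T] [Algebra R T] {U : Type*} [AddCommGroup U]
  [Module R U] [Module T U] [IsScalarTower R T U]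

theorem finset_sup_smul {ι : Type*} (s : Finset ι) (P : ι → Submodule R T) (X : Submodule R U) :
    s.sup P • X = s.sup fun i => P i • X := by
  classical
  induction s using Finset.induction_on with
  | empty => simp
  | insert a s ha ih => rw [Finset.sup_insert, Finset.sup_insert, Submodule.sup_smul, ih]

theorem smul_finset_sup {ι : Type*} (s : Finset ι) (P : Submodule R T) (X : ι → Submodule R U) :
    P • s.sup X = s.sup fun i => P • X i := by
  classical
  induction s using Finset.induction_on with
  | empty => simp
  | insert a s ha ih => rw [Finset.sup_insert, Finset.sup_insert, Submodule.smul_sup, ih]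

end FinsetSup

/-! ### The tensor algebra and the relations of a quadratic algebra -/

section Relations

variable {R : Type*} [CommRing R] {A : Type*} [Ring A] [Algebra R A] (𝒜 : ℕ → Submodule R A)

instance gradedAlgebraV : GradedAlgebra (fun n => V 𝒜 ^ n) :=
  inferInstanceAs (GradedAlgebra fun n => LinearMap.range (TensorAlgebra.ι R : 𝒜 1 →ₗ[R] _) ^ n)

theorem iSup_V_pow : (⨆ n, V 𝒜 ^ n) = ⊤ :=
  (DirectSum.Decomposition.isInternal fun n => V 𝒜 ^ n).submodule_iSup_eq_top

/-- The relations of degree `n`: the kernel of `A_1^{⊗ n} → A_n`. -/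
def relAlg (n : ℕ) : Submodule R (TA 𝒜) := V 𝒜 ^ n ⊓ LinearMap.ker (can 𝒜).toLinearMap

theorem can_ι (x : 𝒜 1) : can 𝒜 (TensorAlgebra.ι R x) = x := TensorAlgebra.lift_ι_apply _ _

theorem SAlg_le (n i : ℕ) (h : i + 2 ≤ n) : SAlg 𝒜 n i ≤ V 𝒜 ^ n := by
  have e : V 𝒜 ^ n = V 𝒜 ^ i * V 𝒜 ^ 2 * V 𝒜 ^ (n - i - 2) := by
    rw [← pow_add, ← pow_add]; congr 1; omega
  rw [e, SAlg]
  exact mul_le_mul' (mul_le_mul' le_rfl inf_le_left) le_rfl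

theorem pow_mul_SAlg (a m i : ℕ) (h : i + 2 ≤ m) :
    V 𝒜 ^ a * SAlg 𝒜 m i = SAlg 𝒜 (a + m) (a + i) := by
  have e : m - i - 2 = a + m - (a + i) - 2 := by omega
  rw [SAlg, SAlg, pow_add, e]
  simp only [mul_assoc]

theorem SAlg_mul_pow (a m i : ℕ) (h : i + 2 ≤ a) :
    SAlg 𝒜 a i * V 𝒜 ^ m = SAlg 𝒜 (a + m) i := by
  rw [SAlg, SAlg, mul_assoc, ← pow_add]
  congr 2; omega

theorem relAlg_le (n : ℕ) : relAlg 𝒜 n ≤ V 𝒜 ^ n := inf_le_left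

variable {𝒜} in
theorem SAlg_le_ker (n i : ℕ) : SAlg 𝒜 n i ≤ LinearMap.ker (can 𝒜).toLinearMap := by
  have h1 : ∀ x ∈ V 𝒜 ^ i * Q2 𝒜, can 𝒜 x = 0 := by
    intro x hx
    induction hx using Submodule.mul_induction_on' with
    | mem_mul_mem x hx y hy =>
      have : can 𝒜 y = 0 := hy.2
      rw [map_mul, this, mul_zero]
    | add x _ y _ hx hy => rw [map_add, hx, hy, add_zero]
  intro x hx
  rw [SAlg] at hx
  show can 𝒜 x = 0
  induction hx using Submodule.mul_induction_on' with
  | mem_mul_mem x hx y hy => rw [map_mul, h1 x hx, zero_mul]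
  | add x _ y _ hx hy => rw [map_add, hx, hy, add_zero]

variable [GradedAlgebra 𝒜]

theorem can_mem {n : ℕ} {x : TA 𝒜} (hx : x ∈ V 𝒜 ^ n) : can 𝒜 x ∈ 𝒜 n := by
  induction n generalizing x with
  | zero =>
    obtain ⟨r, rfl⟩ := Submodule.mem_one.1 (by simpa using hx)
    rw [AlgHom.commutes]
    exact SetLike.algebraMap_mem_graded 𝒜 r
  | succ n ih =>
    rw [pow_succ] at hx
    induction hx using Submodule.mul_induction_on' with
    | mem_mul_mem x hx y hy =>
      obtain ⟨v, rfl⟩ := hy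
      rw [map_mul, can_ι]
      exact SetLike.mul_mem_graded (ih hx) v.2
    | add x _ y _ hx hy => rw [map_add]; exact add_mem hx hy

variable {𝒜} (hquad : IsQuadratic 𝒜)
include hquad

theorem map_can_pow (n : ℕ) : (V 𝒜 ^ n).map (can 𝒜).toLinearMap = 𝒜 n := by
  apply le_antisymm
  · rintro _ ⟨x, hx, rfl⟩
    exact can_mem 𝒜 hx
  · intro a ha
    obtain ⟨x, rfl⟩ := hquad.1 a
    suffices h : ∀ x : TA 𝒜, GradedAlgebra.proj 𝒜 n (can 𝒜 x) ∈
        (V 𝒜 ^ n).map (can 𝒜).toLinearMap by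
      have h1 := h x
      rwa [GradedAlgebra.proj_apply, DirectSum.decompose_of_mem_same 𝒜 ha] at h1
    intro x
    have hx : x ∈ ⨆ n, V 𝒜 ^ n := by rw [iSup_V_pow]; trivial
    induction hx using Submodule.iSup_induction' with
    | mem m x hx =>
      rw [GradedAlgebra.proj_apply]
      rcases eq_or_ne m n with rfl | hmn
      · rw [DirectSum.decompose_of_mem_same 𝒜 (can_mem 𝒜 hx)]
        exact ⟨x, hx, rfl⟩
      · rw [DirectSum.decompose_of_mem_ne 𝒜 (can_mem 𝒜 hx) hmn]
        exact zero_mem _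
    | zero => simp
    | add x y _ _ hx hy => rw [map_add, map_add]; exact add_mem hx hy

/-- In a quadratic algebra the relations are generated by those of degree two. -/
theorem relAlg_eq (n : ℕ) : relAlg 𝒜 n = (Finset.range (n - 1)).sup (SAlg 𝒜 n) := by
  apply le_antisymm
  · have hI : ∀ x : TA 𝒜, can 𝒜 x = 0 → x ∈ (⊤ : Submodule R (TA 𝒜)) * Q2 𝒜 * ⊤ := by
      intro x hx
      -- `T Q₂ T` is a two-sided ideal
      let J : Submodule R (TA 𝒜) := ⊤ * Q2 𝒜 * ⊤
      let I : TwoSidedIdeal (TA 𝒜) := TwoSidedIdeal.mk' (J : Set (TA 𝒜)) J.zero_mem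
        (fun h h' => J.add_mem h h') (fun h => J.neg_mem h)
        (fun {y z} h => by
          have h' : y * z ∈ (⊤ : Submodule R (TA 𝒜)) * J := Submodule.mul_mem_mul trivial h
          have e : (⊤ : Submodule R (TA 𝒜)) * J ≤ J := by
            show ⊤ * (⊤ * Q2 𝒜 * ⊤) ≤ ⊤ * Q2 𝒜 * ⊤
            rw [← mul_assoc, ← mul_assoc]
            exact mul_le_mul' (mul_le_mul' le_top le_rfl) le_rfl
          exact e h')
        (fun {y z} h => by
          have h' : y * z ∈ J * (⊤ : Submodule R (TA 𝒜)) := Submodule.mul_mem_mul h trivial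
          have e : J * (⊤ : Submodule R (TA 𝒜)) ≤ J := by
            show ⊤ * Q2 𝒜 * ⊤ * ⊤ ≤ ⊤ * Q2 𝒜 * ⊤
            rw [mul_assoc]
            exact mul_le_mul' le_rfl le_top
          exact e h')
      have hle : TwoSidedIdeal.span (Q2 𝒜 : Set (TA 𝒜)) ≤ I := by
        rw [TwoSidedIdeal.span_le]
        intro y hy
        show y ∈ I
        rw [TwoSidedIdeal.mem_mk']
        show y ∈ (⊤ : Submodule R (TA 𝒜)) * Q2 𝒜 * ⊤
        have := Submodule.mul_mem_mul (Submodule.mul_mem_mul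
          (Submodule.mem_top : (1 : TA 𝒜) ∈ (⊤ : Submodule R (TA 𝒜))) hy)
          (Submodule.mem_top : (1 : TA 𝒜) ∈ (⊤ : Submodule R (TA 𝒜)))
        simpa using this
      rw [← hquad.2] at hle
      have := hle ((TwoSidedIdeal.mem_ker (can 𝒜)).2 hx)
      rwa [TwoSidedIdeal.mem_mk'] at this
    -- the component of degree `n` of `T Q₂ T`
    suffices h : (⊤ : Submodule R (TA 𝒜)) * Q2 𝒜 * ⊤ ≤
        ((Finset.range (n - 1)).sup (SAlg 𝒜 n)).comap
          (GradedAlgebra.proj (fun n => V 𝒜 ^ n) n) by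
      rintro x ⟨hx, hx0⟩
      have h1 := h (hI x hx0)
      rwa [Submodule.mem_comap, GradedAlgebra.proj_apply,
        DirectSum.decompose_of_mem_same (fun n => V 𝒜 ^ n) hx] at h1
    rw [← iSup_V_pow, Submodule.iSup_mul, Submodule.iSup_mul]
    refine iSup_le fun k => ?_
    rw [Submodule.mul_iSup]
    refine iSup_le fun l => ?_
    have e : V 𝒜 ^ k * Q2 𝒜 * V 𝒜 ^ l = SAlg 𝒜 (k + 2 + l) k := by
      rw [SAlg]; congr 2; omega
    rw [e]
    intro x hx
    rw [Submodule.mem_comap, GradedAlgebra.proj_apply]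
    have hx' := SAlg_le 𝒜 _ _ (by omega) hx
    rcases eq_or_ne (k + 2 + l) n with rfl | hn
    · rw [DirectSum.decompose_of_mem_same (fun n => V 𝒜 ^ n) hx']
      exact Finset.le_sup (f := SAlg 𝒜 (k + 2 + l)) (Finset.mem_range.2 (by omega)) hx
    · rw [DirectSum.decompose_of_mem_ne (fun n => V 𝒜 ^ n) hx' hn]
      exact zero_mem _
  · refine Finset.sup_le fun i hi => le_inf (SAlg_le 𝒜 n i ?_) (SAlg_le_ker n i)
    rw [Finset.mem_range] at hi; omega

omit hquad in
theorem flatQuot_of_map_ker {W W' : Type*} [AddCommGroup W] [Module R W] [AddCommGroup W']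
    [Module R W'] (f : W →ₗ[R] W') (Q₀ : Submodule R W) [Module.Flat R (Q₀.map f)] :
    FlatQuot (Q₀ ⊓ LinearMap.ker f) Q₀ := by
  let g : Q₀ →ₗ[R] Q₀.map f := f.restrict fun x hx => Submodule.mem_map_of_mem hx
  have hg : Function.Surjective g := by rintro ⟨_, x, hx, rfl⟩; exact ⟨⟨x, hx⟩, rfl⟩
  have h : (Q₀ ⊓ LinearMap.ker f).submoduleOf Q₀ = LinearMap.ker g := by
    ext x; simp [g, Submodule.submoduleOf, Subtype.ext_iff]
  show Module.Flat R _
  rw [h]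
  exact Module.Flat.of_linearEquiv (g.quotKerEquivOfSurjective hg)

/-- The quotient is `A_n`. -/
theorem flatQuot_relAlg (hflat : ∀ n, Module.Flat R (𝒜 n)) (n : ℕ) :
    FlatQuot (relAlg 𝒜 n) (V 𝒜 ^ n) := by
  have : Module.Flat R ((V 𝒜 ^ n).map (can 𝒜).toLinearMap) := by
    rw [map_can_pow hquad]; exact hflat n
  exact flatQuot_of_map_ker _ _

end Relations

/-! ### The submodules of `A_1^{⊗ n} ⊗ M_t` -/

section TensorModule

variable {R : Type*} [CommRing R] {A : Type*} [Ring A] [Algebra R A] {𝒜 : ℕ → Submodule R A}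
  {M : Type*} [AddCommGroup M] [Module R M] [Module A M] [IsScalarTower R A M]
  (ℳ : ℤ → Submodule R M) (t : ℤ)

theorem flat_V_pow (hflat : Module.Flat R (𝒜 1)) (n : ℕ) : Module.Flat R ↥(V 𝒜 ^ n) :=
  (flat_pow_ι n).1

theorem exists_split_tm : ∃ D : TM 𝒜 ℳ t →ₗ[R] TA 𝒜 ⊗[R] TM 𝒜 ℳ t,
    ∀ (v : 𝒜 1) (u : TM 𝒜 ℳ t), D (TensorAlgebra.ι R v • u) = TensorAlgebra.ι R v ⊗ₜ u := by
  obtain ⟨D, hD⟩ := exists_split_first (R := R) (E := 𝒜 1)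
  refine ⟨(TensorProduct.assoc R _ _ _).toLinearMap ∘ₗ D.rTensor (ℳ t), fun v u => ?_⟩
  induction u using TensorProduct.induction_on with
  | zero => simp
  | add x y hx hy => rw [smul_add, map_add, hx, hy, TensorProduct.tmul_add]
  | tmul x y =>
    rw [TensorProduct.smul_tmul', smul_eq_mul, LinearMap.comp_apply, LinearMap.rTensor_tmul, hD]
    rfl

theorem exists_split_tm_pow (a : ℕ) : ∃ Δ : TM 𝒜 ℳ t →ₗ[R] TA 𝒜 ⊗[R] TM 𝒜 ℳ t,
    ∀ x ∈ V 𝒜 ^ a, ∀ u : TM 𝒜 ℳ t, Δ (x • u) = x ⊗ₜ u := by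
  obtain ⟨D, hD⟩ := exists_split_tm (𝒜 := 𝒜) ℳ t
  exact exists_split D hD a

/-- `A_1^{⊗ a} ⊗ X` embeds in `T(A_1) ⊗ M_t` for submodules `X` of `T(A_1) ⊗ M_t`. -/
theorem actMap_V_pow_injective (hflat : Module.Flat R (𝒜 1)) (a : ℕ)
    (X : Submodule R (TM 𝒜 ℳ t)) : Function.Injective (actMap (V 𝒜 ^ a) X) := by
  obtain ⟨D, hD⟩ := exists_split_tm (𝒜 := 𝒜) ℳ t
  exact actMap_pow_ι_injective D hD a X

variable {ℳ t}

theorem tens_mono {P Q : Submodule R (TA 𝒜)} (h : P ≤ Q) : tens 𝒜 ℳ t P ≤ tens 𝒜 ℳ t Q := by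
  rintro _ ⟨x, rfl⟩
  refine ⟨(Submodule.inclusion h).rTensor _ x, ?_⟩
  rw [← LinearMap.comp_apply, ← LinearMap.rTensor_comp]
  rfl

theorem tmul_mem_tens {P : Submodule R (TA 𝒜)} {x : TA 𝒜} (hx : x ∈ P) (m : ℳ t) :
    x ⊗ₜ[R] m ∈ tens 𝒜 ℳ t P := ⟨(⟨x, hx⟩ : P) ⊗ₜ m, rfl⟩

theorem tens_induction {P : Submodule R (TA 𝒜)} {p : TM 𝒜 ℳ t → Prop}
    (htmul : ∀ x ∈ P, ∀ m, p (x ⊗ₜ m)) (h0 : p 0) (hadd : ∀ x y, p x → p y → p (x + y))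
    {x : TM 𝒜 ℳ t} (hx : x ∈ tens 𝒜 ℳ t P) : p x := by
  obtain ⟨x, rfl⟩ := hx
  induction x with
  | zero => simpa
  | add x y hx hy => rw [map_add]; exact hadd _ _ hx hy
  | tmul x m => exact htmul _ x.2 m

theorem tens_le {P : Submodule R (TA 𝒜)} {X : Submodule R (TM 𝒜 ℳ t)} :
    tens 𝒜 ℳ t P ≤ X ↔ ∀ x ∈ P, ∀ m, x ⊗ₜ m ∈ X :=
  ⟨fun h _ hx m => h (tmul_mem_tens hx m), fun h _ hx =>
    tens_induction h X.zero_mem (fun _ _ => X.add_mem) hx⟩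

theorem smul_tens (P Q : Submodule R (TA 𝒜)) : P • tens 𝒜 ℳ t Q = tens 𝒜 ℳ t (P * Q) := by
  apply le_antisymm
  · rw [Submodule.smul_le]
    intro x hx y hy
    refine tens_induction (p := fun y => x • y ∈ _) (fun y hy m => ?_) (by simp)
      (fun a b ha hb => ?_) hy
    · rw [TensorProduct.smul_tmul', smul_eq_mul]
      exact tmul_mem_tens (Submodule.mul_mem_mul hx hy) m
    · rw [smul_add]; exact add_mem ha hb
  · rw [tens_le]
    intro x hx m
    induction hx using Submodule.mul_induction_on' with
    | mem_mul_mem x hx y hy =>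
      rw [← smul_eq_mul, ← TensorProduct.smul_tmul']
      exact Submodule.smul_mem_smul hx (tmul_mem_tens hy m)
    | add x _ y _ hx hy => rw [TensorProduct.add_tmul]; exact add_mem hx hy

variable (ℳ t) in
/-- `A_1^{⊗ n} ⊗ M_t`. -/
abbrev tmPow (n : ℕ) : Submodule R (TM 𝒜 ℳ t) := tens 𝒜 ℳ t (V 𝒜 ^ n)

theorem pow_smul_tmPow (a m : ℕ) : V 𝒜 ^ a • tmPow ℳ t m = tmPow (𝒜 := 𝒜) ℳ t (a + m) := by
  rw [smul_tens, ← pow_add]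

theorem SMod_le (n i : ℕ) (h : i < n) : SMod 𝒜 ℳ t n i ≤ tmPow ℳ t n := by
  rw [SMod]
  split_ifs with hi
  · exact tens_mono (SAlg_le 𝒜 n i (by omega))
  · obtain rfl : n = i + 1 := by omega
    rw [← pow_smul_tmPow i 1]
    exact Submodule.smul_mono le_rfl inf_le_left

theorem pow_smul_SMod (a m i : ℕ) (h : i < m) :
    V 𝒜 ^ a • SMod 𝒜 ℳ t m i = SMod 𝒜 ℳ t (a + m) (a + i) := by
  rw [SMod, SMod]
  by_cases hi : i + 1 < m
  · rw [if_pos hi, if_pos (by omega), smul_tens, pow_mul_SAlg _ _ _ _ (by omega)]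
  · rw [if_neg hi, if_neg (by omega), ← Submodule.smul_assoc, smul_eq_mul_submodule, ← pow_add]

theorem SAlg_smul_tmPow (a m i : ℕ) (h : i + 1 < a) :
    SAlg 𝒜 a i • tmPow ℳ t m = SMod 𝒜 ℳ t (a + m) i := by
  rw [SMod, if_pos (by omega), smul_tens, SAlg_mul_pow _ _ _ _ (by omega)]

theorem canMod_smul (x : TA 𝒜) (u : TM 𝒜 ℳ t) :
    canMod 𝒜 ℳ t (x • u) = can 𝒜 x • canMod 𝒜 ℳ t u := by
  induction u using TensorProduct.induction_on with
  | zero => simp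
  | add x y hx hy => rw [smul_add, map_add, hx, hy, map_add, smul_add]
  | tmul y m =>
    rw [TensorProduct.smul_tmul', smul_eq_mul]
    simp [canMod]

theorem relAlg_smul_tmPow [GradedAlgebra 𝒜] (hquad : IsQuadratic 𝒜) (a m : ℕ) :
    relAlg 𝒜 a • tmPow ℳ t m = (Finset.range (a - 1)).sup (SMod 𝒜 ℳ t (a + m)) := by
  rw [relAlg_eq hquad, finset_sup_smul]
  refine Finset.sup_congr rfl fun i hi => SAlg_smul_tmPow a m i ?_
  rw [Finset.mem_range] at hi; omega

end TensorModule

/-! ### Bar complexes and their refinement subcomplexes -/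

section BoxLemmas

variable {R : Type*} [CommRing R] {W₁ W₂ : Type*} [AddCommGroup W₁] [Module R W₁]
  [AddCommGroup W₂] [Module R W₂]

theorem tmul_mem_box {P : Submodule R W₁} {Q : Submodule R W₂} {x : W₁} {y : W₂} (hx : x ∈ P)
    (hy : y ∈ Q) : x ⊗ₜ y ∈ box P Q := ⟨(⟨x, hx⟩ : P) ⊗ₜ (⟨y, hy⟩ : Q), rfl⟩

theorem box_le {P : Submodule R W₁} {Q : Submodule R W₂} {X : Submodule R (W₁ ⊗[R] W₂)} :
    box P Q ≤ X ↔ ∀ x ∈ P, ∀ y ∈ Q, x ⊗ₜ y ∈ X := by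
  refine ⟨fun h x hx y hy => h (tmul_mem_box hx hy), fun h => ?_⟩
  rintro _ ⟨ξ, rfl⟩
  induction ξ with
  | zero => simp
  | add x y hx hy => rw [map_add]; exact add_mem hx hy
  | tmul x y => exact h _ x.2 _ y.2

theorem box_mono {P P' : Submodule R W₁} {Q Q' : Submodule R W₂} (h : P ≤ P') (h' : Q ≤ Q') :
    box P Q ≤ box P' Q' := box_le.2 fun _ hx _ hy => tmul_mem_box (h hx) (h' hy)

theorem box_map_le {W₃ : Type*} [AddCommGroup W₃] [Module R W₃] (P : Submodule R W₁)
    (Q : Submodule R W₂) (f : W₂ →ₗ[R] W₃) : box P (Q.map f) ≤ (box P Q).map (f.lTensor W₁) := by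
  rw [box_le]
  rintro x hx _ ⟨y, hy, rfl⟩
  exact ⟨_, tmul_mem_box hx hy, rfl⟩

end BoxLemmas

/-- Tensoring with the flat direct summand `A_a` of `A` commutes with kernels. -/
theorem box_inf_ker_le {R : Type*} [CommRing R] {A : Type*} [Ring A] [Algebra R A]
    (𝒜 : ℕ → Submodule R A) [GradedAlgebra 𝒜] (a : ℕ) [Module.Flat R (𝒜 a)]
    {W₂ W₃ : Type*} [AddCommGroup W₂] [Module R W₂] [AddCommGroup W₃] [Module R W₃]
    (X : Submodule R W₂) (f : W₂ →ₗ[R] W₃) {c : A ⊗[R] W₂} (hc : c ∈ box (𝒜 a) X)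
    (hf : f.lTensor A c = 0) : c ∈ box (𝒜 a) (X ⊓ LinearMap.ker f) := by
  obtain ⟨ξ, rfl⟩ := hc
  have h1 : (f ∘ₗ X.subtype).lTensor (𝒜 a) ξ = 0 := by
    apply rTensor_subtype_injective_of_graded 𝒜 a W₃
    rw [map_zero, ← hf, ← LinearMap.comp_apply, ← LinearMap.comp_apply,
      LinearMap.rTensor_comp_lTensor, TensorProduct.mapIncl, LinearMap.lTensor,
      ← TensorProduct.map_comp, LinearMap.id_comp]
  have hex : Function.Exact (LinearMap.ker (f ∘ₗ X.subtype)).subtype (f ∘ₗ X.subtype) :=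
    LinearMap.exact_subtype_ker_map _
  obtain ⟨ζ, rfl⟩ := (Module.Flat.lTensor_exact (𝒜 a) hex ξ).1 h1
  clear h1 hf
  induction ζ with
  | zero => simp
  | add x y hx hy => rw [map_add, map_add]; exact add_mem hx hy
  | tmul x y => exact tmul_mem_box x.2 ⟨y.1.2, y.2⟩

/-- The reduced bar complex of an `A`-module `M`, described by the isomorphisms splitting off the
first tensor factor. -/
structure BarModel (R : Type*) [CommRing R] (A : Type*) [Ring A] [Algebra R A] (M : Type*)
    [AddCommGroup M] [Module R M] [Module A M] [IsScalarTower R A M] (B : ℕ → Type*)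
    [∀ n, AddCommGroup (B n)] [∀ n, Module R (B n)] where
  /-- The isomorphism of `M` with the term in degree zero. -/
  base : M ≃ₗ[R] B 0
  /-- Splitting off the first tensor factor. -/
  cons : ∀ n, A ⊗[R] B n ≃ₗ[R] B (n + 1)
  /-- The differential. -/
  d : ∀ n, B (n + 1) →ₗ[R] B n
  d_base : ∀ a m, d 0 (cons 0 (a ⊗ₜ base m)) = base (a • m)
  d_cons : ∀ n a b x, d (n + 1) (cons (n + 1) (a ⊗ₜ cons n (b ⊗ₜ x))) =
    cons n ((a * b) ⊗ₜ x) - cons n (a ⊗ₜ d n (cons n (b ⊗ₜ x)))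

namespace BarModel

variable {R : Type*} [CommRing R] {A : Type*} [Ring A] [Algebra R A] {M : Type*}
  [AddCommGroup M] [Module R M] [Module A M] [IsScalarTower R A M] {B : ℕ → Type*}
  [∀ n, AddCommGroup (B n)] [∀ n, Module R (B n)] (S : BarModel R A M B)

/-- Multiplication into the first tensor factor. -/
def lmul : ∀ n, A ⊗[R] B n →ₗ[R] B n
  | 0 => S.base.toLinearMap ∘ₗ TensorProduct.lift (Algebra.lsmul R R M).toLinearMap ∘ₗ
      S.base.symm.toLinearMap.lTensor A
  | n + 1 => (S.cons n).toLinearMap ∘ₗ (LinearMap.mul' R A).rTensor (B n) ∘ₗ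
      (TensorProduct.assoc R A A (B n)).symm.toLinearMap ∘ₗ
        (S.cons n).symm.toLinearMap.lTensor A

@[simp]
theorem lmul_base (a : A) (m : M) : S.lmul 0 (a ⊗ₜ S.base m) = S.base (a • m) := by simp [lmul]

@[simp]
theorem lmul_cons (n : ℕ) (a b : A) (x : B n) :
    S.lmul (n + 1) (a ⊗ₜ S.cons n (b ⊗ₜ x)) = S.cons n ((a * b) ⊗ₜ x) := by simp [lmul]

theorem induction_cons {n : ℕ} {p : B (n + 1) → Prop} (tmul : ∀ a x, p (S.cons n (a ⊗ₜ x)))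
    (zero : p 0) (add : ∀ x y, p x → p y → p (x + y)) (x : B (n + 1)) : p x := by
  obtain ⟨ξ, rfl⟩ := (S.cons n).surjective x
  induction ξ with
  | zero => rwa [map_zero]
  | add x y hx hy => rw [map_add]; exact add _ _ hx hy
  | tmul a x => exact tmul a x

theorem lmul_lmul (n : ℕ) (a b : A) (x : B n) :
    S.lmul n (a ⊗ₜ S.lmul n (b ⊗ₜ x)) = S.lmul n ((a * b) ⊗ₜ x) := by
  cases n with
  | zero =>
    obtain ⟨m, rfl⟩ := S.base.surjective x
    simp [mul_smul]
  | succ n =>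
    induction x using S.induction_cons with
    | tmul c x => simp [mul_assoc]
    | zero => simp
    | add x y hx hy => simp only [TensorProduct.tmul_add, map_add, hx, hy]

theorem d_cons_zero (ξ : A ⊗[R] B 0) : S.d 0 (S.cons 0 ξ) = S.lmul 0 ξ := by
  induction ξ with
  | zero => simp
  | add x y hx hy => simp only [map_add, hx, hy]
  | tmul a x =>
    obtain ⟨m, rfl⟩ := S.base.surjective x
    rw [d_base, lmul_base]

theorem d_cons_succ (n : ℕ) (ξ : A ⊗[R] B (n + 1)) : S.d (n + 1) (S.cons (n + 1) ξ) =
    S.lmul (n + 1) ξ - S.cons n ((S.d n).lTensor A ξ) := by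
  induction ξ with
  | zero => simp
  | add x y hx hy => simp only [map_add, hx, hy]; abel
  | tmul a x =>
    induction x using S.induction_cons with
    | tmul c x => rw [d_cons, lmul_cons, LinearMap.lTensor_tmul]
    | zero => simp
    | add x y hx hy => simp only [TensorProduct.tmul_add, map_add, hx, hy]; abel

theorem d_d (n : ℕ) (x : B (n + 2)) : S.d n (S.d (n + 1) x) = 0 := by
  induction n with
  | zero =>
    induction x using S.induction_cons with
    | tmul a x =>
      induction x using S.induction_cons with
      | tmul b x => rw [d_cons, map_sub, d_cons_zero, d_cons_zero, d_cons_zero, lmul_lmul, sub_self]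
      | zero => simp
      | add x y hx hy => rw [TensorProduct.tmul_add, map_add, map_add, map_add, hx, hy, add_zero]
    | zero => simp
    | add x y hx hy => rw [map_add, map_add, hx, hy, add_zero]
  | succ n ih =>
    induction x using S.induction_cons with
    | tmul a x =>
      induction x using S.induction_cons with
      | tmul b x =>
        have h := ih (S.cons (n + 1) (b ⊗ₜ x))
        rw [d_cons, map_sub, d_cons_succ, d_cons_succ, LinearMap.lTensor_tmul,
          LinearMap.lTensor_tmul, h, TensorProduct.tmul_zero, map_zero, sub_zero, d_cons_succ,
          LinearMap.lTensor_tmul, TensorProduct.tmul_sub, map_sub, lmul_lmul, lmul_cons, sub_self]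
      | zero => simp
      | add x y hx hy => rw [TensorProduct.tmul_add, map_add, map_add, map_add, hx, hy, add_zero]
    | zero => simp
    | add x y hx hy => rw [map_add, map_add, hx, hy, add_zero]

variable (𝒜 : ℕ → Submodule R A) (L : ℕ → Submodule R M)

/-- The subcomplex of the bar complex which is the refinement complex of the composition `(a, l)`;
the last part of the composition stands for the factor in `M`, graded by `L`. It is the mapping
cone of a multiplication map `A_a ⊗ R(b, l) → R(a + b, l)`, which is how it is defined here. -/
def refine : List ℕ → ℕ → ∀ n, Submodule R (B n)
  | [], a, 0 => (L a).map S.base.toLinearMap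
  | [], _, _ + 1 => ⊥
  | b :: l, a, 0 => refine l (a + b) 0
  | b :: l, a, n + 1 => (box (𝒜 a) (refine l b n)).map (S.cons n).toLinearMap ⊔
      refine l (a + b) (n + 1)

/-- Exactness of the refinement complex of `(a, l)` in positive cohomological degrees. -/
def RefineExact (l : List ℕ) (a : ℕ) : Prop :=
  ∀ n < l.length, cycles S.d (S.refine 𝒜 L l a) n ≤ (S.refine 𝒜 L l a (n + 1)).map (S.d n)

variable {𝒜 L}

theorem refine_eq_bot (l : List ℕ) (a n : ℕ) (h : l.length < n) : S.refine 𝒜 L l a n = ⊥ := by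
  induction l generalizing a n with
  | nil => cases n with
    | zero => simp at h
    | succ n => rfl
  | cons b l ih => cases n with
    | zero => simp at h
    | succ n =>
      rw [List.length_cons] at h
      rw [refine, ih _ _ (by omega), ih _ _ (by omega), sup_bot_eq, eq_bot_iff,
        Submodule.map_le_iff_le_comap, box_le]
      rintro x hx y rfl
      simp

theorem consPiece_le (l : List ℕ) (a b n : ℕ) :
    (box (𝒜 a) (S.refine 𝒜 L l b n)).map (S.cons n).toLinearMap ≤
      S.refine 𝒜 L (b :: l) a (n + 1) := le_sup_left

theorem refine_add_le (l : List ℕ) (a b n : ℕ) :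
    S.refine 𝒜 L l (a + b) n ≤ S.refine 𝒜 L (b :: l) a n := by
  cases n with
  | zero => exact le_rfl
  | succ n => exact le_sup_right

variable [GradedAlgebra 𝒜] (hL : ∀ (i j : ℕ) (a : A) (x : M), a ∈ 𝒜 i → x ∈ L j →
  a • x ∈ L (i + j))

include hL in
theorem lmul_mem (l : List ℕ) (a b n : ℕ) {x : A} (hx : x ∈ 𝒜 a) {y : B n}
    (hy : y ∈ S.refine 𝒜 L l b n) : S.lmul n (x ⊗ₜ y) ∈ S.refine 𝒜 L l (a + b) n := by
  induction l generalizing b n with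
  | nil => cases n with
    | zero =>
      obtain ⟨m, hm, rfl⟩ := hy
      exact ⟨x • m, hL _ _ _ _ hx hm, (S.lmul_base x m).symm⟩
    | succ n =>
      obtain rfl : y = 0 := hy
      simp
  | cons c l ih => cases n with
    | zero =>
      have := ih (b + c) 0 hy
      rwa [← add_assoc] at this
    | succ n =>
      obtain ⟨_, ⟨ξ, hξ, rfl⟩, z, hz, rfl⟩ := Submodule.mem_sup.1 hy
      rw [TensorProduct.tmul_add, map_add]
      refine add_mem ?_ (S.refine_add_le l (a + b) c (n + 1) ?_)
      · apply S.consPiece_le l (a + b) c n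
        have h : box (𝒜 b) (S.refine 𝒜 L l c n) ≤
            ((box (𝒜 (a + b)) (S.refine 𝒜 L l c n)).map (S.cons n).toLinearMap).comap
              (S.lmul (n + 1) ∘ₗ TensorProduct.mk R _ _ x ∘ₗ (S.cons n).toLinearMap) := by
          rw [box_le]
          intro v hv w hw
          exact ⟨_, tmul_mem_box (SetLike.mul_mem_graded hx hv) hw, (S.lmul_cons n x v w).symm⟩
        exact h hξ
      · have := ih (b + c) (n + 1) hz
        rwa [← add_assoc] at this

include hL in
theorem map_lmul_le (l : List ℕ) (a b n : ℕ) {c : A ⊗[R] B n}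
    (hc : c ∈ box (𝒜 a) (S.refine 𝒜 L l b n)) : S.lmul n c ∈ S.refine 𝒜 L l (a + b) n := by
  have h : box (𝒜 a) (S.refine 𝒜 L l b n) ≤ (S.refine 𝒜 L l (a + b) n).comap (S.lmul n) := by
    rw [box_le]
    exact fun x hx y hy => S.lmul_mem hL l a b n hx hy
  exact h hc

include hL in
theorem d_mem (l : List ℕ) (a n : ℕ) {x : B (n + 1)} (hx : x ∈ S.refine 𝒜 L l a (n + 1)) :
    S.d n x ∈ S.refine 𝒜 L l a n := by
  induction l generalizing a n with
  | nil =>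
    obtain rfl : x = 0 := hx
    simp
  | cons b l ih =>
    obtain ⟨_, ⟨ξ, hξ, rfl⟩, z, hz, rfl⟩ := Submodule.mem_sup.1 hx
    rw [map_add]
    refine add_mem ?_ (S.refine_add_le l a b n (ih _ _ hz))
    have h1 := S.refine_add_le l a b n (S.map_lmul_le hL l a b n hξ)
    cases n with
    | zero => exact (S.d_cons_zero ξ).symm ▸ h1
    | succ n =>
      refine (S.d_cons_succ n ξ).symm ▸ sub_mem h1 (S.consPiece_le l a b n ⟨_, ?_, rfl⟩)
      have h : box (𝒜 a) (S.refine 𝒜 L l b (n + 1)) ≤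
          (box (𝒜 a) (S.refine 𝒜 L l b n)).comap ((S.d n).lTensor A) := by
        rw [box_le]
        exact fun x hx y hy => tmul_mem_box hx (ih _ _ hy)
      exact h hξ

variable (𝒜) in
/-- Projection to the part where the first tensor factor has degree `a`. -/
def projFirst (a n : ℕ) : B (n + 1) →ₗ[R] A ⊗[R] B n :=
  (GradedAlgebra.proj 𝒜 a).rTensor (B n) ∘ₗ (S.cons n).symm.toLinearMap

theorem projFirst_cons (a n : ℕ) {ξ : A ⊗[R] B n} (hξ : ξ ∈ box (𝒜 a) ⊤) :
    S.projFirst 𝒜 a n (S.cons n ξ) = ξ := by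
  have h : box (𝒜 a) ⊤ ≤ LinearMap.eqLocus
      (S.projFirst 𝒜 a n ∘ₗ (S.cons n).toLinearMap) LinearMap.id := by
    rw [box_le]
    intro x hx y _
    rw [LinearMap.mem_eqLocus]
    simp [projFirst, GradedAlgebra.proj_apply, DirectSum.decompose_of_mem_same 𝒜 hx]
  exact h hξ

/-- In the refinement complex of `(a', l)` all first tensor factors have degree at least `a'`. -/
theorem projFirst_refine (l : List ℕ) (a a' n : ℕ) (ha : a < a') {x : B (n + 1)}
    (hx : x ∈ S.refine 𝒜 L l a' (n + 1)) : S.projFirst 𝒜 a n x = 0 := by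
  induction l generalizing a' x with
  | nil =>
    obtain rfl : x = 0 := hx
    simp
  | cons b l ih =>
    obtain ⟨_, ⟨ξ, hξ, rfl⟩, z, hz, rfl⟩ := Submodule.mem_sup.1 hx
    rw [map_add, ih (a' + b) (by omega) hz, add_zero]
    have h : box (𝒜 a') (S.refine 𝒜 L l b n) ≤
        LinearMap.ker (S.projFirst 𝒜 a n ∘ₗ (S.cons n).toLinearMap) := by
      rw [box_le]
      intro x hx y _
      simp [projFirst, GradedAlgebra.proj_apply, DirectSum.decompose_of_mem_ne 𝒜 hx ha.ne']
    exact h hξ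

/-- Cycles of the mapping cone are cycles in the first factor of the cone. -/
theorem mem_box_cycles (hL : ∀ (i j : ℕ) (a : A) (x : M), a ∈ 𝒜 i → x ∈ L j → a • x ∈ L (i + j))
    (l : List ℕ) (a b n : ℕ) [Module.Flat R (𝒜 a)] (hb : n ≠ 0 → 0 < b) {c : A ⊗[R] B n}
    (hc : c ∈ box (𝒜 a) (S.refine 𝒜 L l b n))
    (hd : S.d n (S.cons n c) ∈ S.refine 𝒜 L l (a + b) n) :
    c ∈ box (𝒜 a) (cycles S.d (S.refine 𝒜 L l b) n) := by
  cases n with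
  | zero => exact hc
  | succ n =>
    refine box_inf_ker_le 𝒜 a _ _ hc ?_
    rw [d_cons_succ] at hd
    have h1 := S.projFirst_refine (L := L) l a (a + b) n (by have := hb (by omega); omega)
      (sub_mem hd (S.map_lmul_le hL l a b _ hc))
    rw [sub_sub_cancel_left, map_neg, neg_eq_zero, projFirst_cons] at h1
    · exact h1
    · have h : box (𝒜 a) (S.refine 𝒜 L l b (n + 1)) ≤
          (box (𝒜 a) ⊤).comap ((S.d n).lTensor A) := by
        rw [box_le]
        exact fun x hx y hy => tmul_mem_box hx trivial
      exact h hc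

theorem d_cons_of_mem_box_cycles (F : ∀ n, Submodule R (B n)) (a n : ℕ) {c : A ⊗[R] B n}
    (hc : c ∈ box (𝒜 a) (cycles S.d F n)) : S.d n (S.cons n c) = S.lmul n c := by
  cases n with
  | zero => exact S.d_cons_zero c
  | succ n =>
    rw [d_cons_succ, sub_eq_self]
    have h : box (𝒜 a) (cycles S.d F (n + 1)) ≤
        LinearMap.ker ((S.cons n).toLinearMap ∘ₗ (S.d n).lTensor A) := by
      rw [box_le]
      intro x hx y hy
      have : S.d n y = 0 := hy.2
      simp [this]
    exact h hc

theorem cycles_le (F : ∀ n, Submodule R (B n)) (n : ℕ) : cycles S.d F n ≤ F n := by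
  cases n with
  | zero => exact le_rfl
  | succ n => exact inf_le_left

/-- The map on top cycles whose surjectivity is, beside exactness of the refinement complexes of
`(b, l)` and `(a + b, l)`, equivalent to exactness of the refinement complex of `(a, b, l)`. -/
def TopSurjective (𝒜 : ℕ → Submodule R A) (L : ℕ → Submodule R M) (l : List ℕ) (a b : ℕ) : Prop :=
  cycles S.d (S.refine 𝒜 L l (a + b)) l.length ≤
    (box (𝒜 a) (cycles S.d (S.refine 𝒜 L l b) l.length)).map (S.lmul l.length)

include hL in
/-- From the long exact sequence of the mapping cone of `A_a ⊗ R(b, l) → R(a + b, l)`. As `R(b, l)`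
is exact and `A_a` is flat, the source has homology only in top degree; exactness of the cone hence
means that the target has the same property and that the map on top homology is surjective. -/
theorem refineExact_of_cons {l : List ℕ} {a b : ℕ} [Module.Flat R (𝒜 a)] (hb : l ≠ [] → 0 < b)
    (h1 : S.RefineExact 𝒜 L l b) (h : S.RefineExact 𝒜 L (b :: l) a) :
    S.RefineExact 𝒜 L l (a + b) ∧ S.TopSurjective 𝒜 L l a b := by
  have hcyc : ∀ n, cycles S.d (S.refine 𝒜 L l (a + b)) n ≤
      cycles S.d (S.refine 𝒜 L (b :: l) a) n := by
    rintro (_ | n)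
    · exact le_rfl
    · exact inf_le_inf_right _ (S.refine_add_le l a b (n + 1))
  have hbox : ∀ n ≤ l.length, ∀ z ∈ cycles S.d (S.refine 𝒜 L l (a + b)) n,
      ∃ c ∈ box (𝒜 a) (cycles S.d (S.refine 𝒜 L l b) n), ∃ y ∈ S.refine 𝒜 L l (a + b) (n + 1),
        z = S.d n (S.cons n c) + S.d n y := by
    intro n hn z hz
    obtain ⟨_, hx, rfl⟩ := h n (by rw [List.length_cons]; omega) (hcyc n hz)
    obtain ⟨_, ⟨c, hc, rfl⟩, y, hy, rfl⟩ := Submodule.mem_sup.1 hx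
    refine ⟨c, S.mem_box_cycles hL l a b n ?_ hc ?_, y, hy, map_add _ _ _⟩
    · rintro h0
      exact hb (by rintro rfl; simp at hn; omega)
    · have h2 := S.cycles_le _ _ hz
      rw [map_add] at h2
      exact (Submodule.add_mem_iff_left _ (S.d_mem hL l _ _ hy)).1 h2
  constructor
  · intro n hn z hz
    obtain ⟨c, hc, y, hy, rfl⟩ := hbox n hn.le z hz
    obtain ⟨c', hc', rfl⟩ := box_map_le _ _ _ (box_mono le_rfl (h1 n hn) hc)
    refine ⟨S.lmul _ c' + y, add_mem (S.map_lmul_le hL l a b _ hc') hy, ?_⟩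
    have h2 := S.d_d n (S.cons (n + 1) c')
    rw [d_cons_succ, map_sub, sub_eq_zero] at h2
    rw [map_add, h2]
  · intro z hz
    obtain ⟨c, hc, y, hy, rfl⟩ := hbox _ le_rfl z hz
    rw [S.refine_eq_bot _ _ _ (Nat.lt_succ_self _)] at hy
    obtain rfl : y = 0 := hy
    exact ⟨c, hc, by rw [S.d_cons_of_mem_box_cycles _ a _ hc, map_zero, add_zero]⟩

include hL in
/-- The converse of `refineExact_of_cons`. -/
theorem refineExact_cons {l : List ℕ} {a b : ℕ} [Module.Flat R (𝒜 a)] (hb : l ≠ [] → 0 < b)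
    (h1 : S.RefineExact 𝒜 L l b) (h2 : S.RefineExact 𝒜 L l (a + b))
    (h3 : S.TopSurjective 𝒜 L l a b) : S.RefineExact 𝒜 L (b :: l) a := by
  have key : ∀ n ≤ l.length, cycles S.d (S.refine 𝒜 L l (a + b)) n ≤
      (S.refine 𝒜 L (b :: l) a (n + 1)).map (S.d n) := by
    intro n hn z hz
    rcases hn.lt_or_eq with hn | rfl
    · obtain ⟨y, hy, rfl⟩ := h2 n hn hz
      exact ⟨y, S.refine_add_le l a b _ hy, rfl⟩
    · obtain ⟨c, hc, rfl⟩ := h3 hz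
      exact ⟨_, S.consPiece_le l a b _ ⟨c, box_mono le_rfl (S.cycles_le _ _) hc, rfl⟩,
        S.d_cons_of_mem_box_cycles _ a _ hc⟩
  rintro (_ | n) hn z hz
  · exact key 0 (by omega) hz
  · rw [List.length_cons] at hn
    obtain ⟨_, ⟨c, hc, rfl⟩, y, hy, rfl⟩ := Submodule.mem_sup.1 hz.1
    have hz2 : S.d n (S.cons n c + y) = 0 := hz.2
    rw [map_add] at hz2
    have hc2 := S.mem_box_cycles hL l a b n (fun h0 => hb (by rintro rfl; simp at hn)) hc (by
      rw [eq_neg_of_add_eq_zero_left hz2]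
      exact neg_mem (S.d_mem hL l _ _ hy))
    obtain ⟨c', hc', rfl⟩ := box_map_le _ _ _ (box_mono le_rfl (h1 n (by omega)) hc2)
    have h4 := S.d_cons_succ n c'
    obtain ⟨y', hy', h5⟩ := key (n + 1) (by omega)
      (show y + S.lmul (n + 1) c' ∈ _ from ⟨add_mem hy (S.map_lmul_le hL l a b _ hc'), by
        have h6 := S.d_d n (S.cons (n + 1) c')
        rw [h4, map_sub, sub_eq_zero] at h6
        change S.d n (y + _) = 0
        rw [map_add, h6, add_comm]
        exact hz2⟩)
    refine ⟨y' - S.cons (n + 1) c', sub_mem hy' (S.consPiece_le l a b _ ⟨c', hc', rfl⟩), ?_⟩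
    rw [map_sub, h5, h4]
    change _ = S.cons n ((S.d n).lTensor A c') + y
    abel

end BarModel

/-! ### Top cycles of the refinement complexes as submodules of tensor powers -/

theorem inf_cycles_top {R : Type*} [CommRing R] {B : ℕ → Type*} [∀ k, AddCommGroup (B k)]
    [∀ k, Module R (B k)] (d : ∀ k, B (k + 1) →ₗ[R] B k) (F : ∀ k, Submodule R (B k)) (n : ℕ) :
    cycles d F n = F n ⊓ cycles d (fun _ => ⊤) n := by
  cases n with
  | zero => exact inf_top_eq _ |>.symm
  | succ n => simp [cycles]

section TopCycles

variable {R : Type*} [CommRing R] {A : Type*} [Ring A] [Algebra R A] {𝒜 : ℕ → Submodule R A}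
  {M : Type*} [AddCommGroup M] [Module R M] [Module A M] [IsScalarTower R A M]
  {ℳ : ℤ → Submodule R M} {t : ℤ} {B : ℕ → Type*}
  [∀ n, AddCommGroup (B n)] [∀ n, Module R (B n)] (S : BarModel R A M B)

variable (𝒜 ℳ t) in
/-- The map splitting off the first `a` tensor factors. -/
def splitFirst (a : ℕ) : TM 𝒜 ℳ t →ₗ[R] TA 𝒜 ⊗[R] TM 𝒜 ℳ t :=
  (exists_split_tm_pow (𝒜 := 𝒜) ℳ t a).choose

theorem splitFirst_smul {a : ℕ} {x : TA 𝒜} (hx : x ∈ V 𝒜 ^ a) (u : TM 𝒜 ℳ t) :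
    splitFirst 𝒜 ℳ t a (x • u) = x ⊗ₜ u :=
  (exists_split_tm_pow (𝒜 := 𝒜) ℳ t a).choose_spec x hx u

variable (𝒜 ℳ t) in
/-- The map of `A_1^{⊗ n} ⊗ M_t` onto the term of lowest cohomological degree in the refinement
complex of `(a, l)`. -/
def toTop : ∀ (l : List ℕ) (_ : ℕ), TM 𝒜 ℳ t →ₗ[R] B l.length
  | [], _ => S.base.toLinearMap ∘ₗ canMod 𝒜 ℳ t
  | b :: l, a => (S.cons l.length).toLinearMap ∘ₗ
      TensorProduct.map (can 𝒜).toLinearMap (toTop l b) ∘ₗ splitFirst 𝒜 ℳ t a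

theorem toTop_cons_smul (l : List ℕ) (a b : ℕ) {x : TA 𝒜} (hx : x ∈ V 𝒜 ^ a) (u : TM 𝒜 ℳ t) :
    toTop 𝒜 ℳ t S (b :: l) a (x • u) =
      S.cons l.length (can 𝒜 x ⊗ₜ toTop 𝒜 ℳ t S l b u) := by
  simp only [toTop, LinearMap.comp_apply, splitFirst_smul hx]
  rfl

theorem smul_tmPow_induction {a m : ℕ} {p : TM 𝒜 ℳ t → Prop}
    (smul : ∀ x ∈ V 𝒜 ^ a, ∀ u ∈ tmPow (𝒜 := 𝒜) ℳ t m, p (x • u))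
    (add : ∀ x y, p x → p y → p (x + y)) {u : TM 𝒜 ℳ t}
    (hu : u ∈ tmPow (𝒜 := 𝒜) ℳ t (a + m)) : p u := by
  rw [← pow_smul_tmPow] at hu
  exact Submodule.smul_induction_on hu smul add

theorem toTop_smul (l : List ℕ) (a b : ℕ) {x : TA 𝒜} (hx : x ∈ V 𝒜 ^ a) {u : TM 𝒜 ℳ t}
    (hu : u ∈ tmPow (𝒜 := 𝒜) ℳ t (b + l.sum)) :
    toTop 𝒜 ℳ t S l (a + b) (x • u) =
      S.lmul l.length (can 𝒜 x ⊗ₜ toTop 𝒜 ℳ t S l b u) := by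
  cases l with
  | nil => simp [toTop, canMod_smul]
  | cons c l =>
    refine smul_tmPow_induction (a := b) (m := c + l.sum) (p := fun u =>
      toTop 𝒜 ℳ t S (c :: l) (a + b) (x • u) = S.lmul (c :: l).length
        (can 𝒜 x ⊗ₜ toTop 𝒜 ℳ t S (c :: l) b u)) (fun y hy w hw => ?_)
      (fun y z hy hz => ?_) hu
    · have hxy : x * y ∈ V 𝒜 ^ (a + b) := by rw [pow_add]; exact Submodule.mul_mem_mul hx hy
      rw [← mul_smul, toTop_cons_smul S l (a + b) c hxy, toTop_cons_smul S l b c hy, map_mul]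
      exact (S.lmul_cons l.length _ _ _).symm
    · rw [smul_add, map_add, map_add, TensorProduct.tmul_add, map_add, hy, hz]

theorem lmul_map_split (l : List ℕ) (a b : ℕ) {u : TM 𝒜 ℳ t}
    (hu : u ∈ tmPow (𝒜 := 𝒜) ℳ t (a + (b + l.sum))) :
    S.lmul l.length (TensorProduct.map (can 𝒜).toLinearMap (toTop 𝒜 ℳ t S l b)
      (splitFirst 𝒜 ℳ t a u)) = toTop 𝒜 ℳ t S l (a + b) u := by
  refine smul_tmPow_induction (p := fun u => S.lmul l.length (TensorProduct.map
    (can 𝒜).toLinearMap (toTop 𝒜 ℳ t S l b) (splitFirst 𝒜 ℳ t a u)) =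
      toTop 𝒜 ℳ t S l (a + b) u) (fun y hy w hw => ?_) (fun y z hy hz => ?_) hu
  · rw [splitFirst_smul hy, toTop_smul S l a b hy hw]
    rfl
  · rw [map_add, map_add, map_add, map_add, hy, hz]

variable (𝒜 ℳ t) in
/-- The kernel of `toTop` in the tensor power. -/
def topKer (l : List ℕ) (a : ℕ) : Submodule R (TM 𝒜 ℳ t) :=
  tmPow ℳ t (a + l.sum) ⊓ LinearMap.ker (toTop 𝒜 ℳ t S l a)

variable (𝒜 ℳ t) in
/-- The preimage in the tensor power of the cycles in lowest cohomological degree. -/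
def topCycles (l : List ℕ) (a : ℕ) : Submodule R (TM 𝒜 ℳ t) :=
  tmPow ℳ t (a + l.sum) ⊓ (cycles S.d (fun _ => ⊤) l.length).comap (toTop 𝒜 ℳ t S l a)

theorem topKer_le (l : List ℕ) (a : ℕ) : topKer 𝒜 ℳ t S l a ≤ tmPow ℳ t (a + l.sum) :=
  inf_le_left

theorem topCycles_le (l : List ℕ) (a : ℕ) : topCycles 𝒜 ℳ t S l a ≤ tmPow ℳ t (a + l.sum) :=
  inf_le_left

theorem topCycles_nil (a : ℕ) : topCycles 𝒜 ℳ t S [] a = tmPow ℳ t a := by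
  simp [topCycles, cycles]

theorem topKer_nil (a : ℕ) : topKer 𝒜 ℳ t S [] a = QMod 𝒜 ℳ t a := by
  have : LinearMap.ker (toTop 𝒜 ℳ t S [] a) = LinearMap.ker (canMod 𝒜 ℳ t) :=
    LinearEquiv.ker_comp _ _
  rw [topKer, this]
  rfl

variable [GradedAlgebra 𝒜] (hquad : IsQuadratic 𝒜) (hflat : ∀ n, Module.Flat R (𝒜 n))
  (hgen : ∀ d : ℕ, (tmPow (𝒜 := 𝒜) ℳ t d).map (canMod 𝒜 ℳ t) = ℳ (t + d))
  (hL : ∀ (i j : ℕ) (a : A) (x : M), a ∈ 𝒜 i → x ∈ ℳ (t + j) → a • x ∈ ℳ (t + (i + j : ℕ)))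

include hquad hgen in
/-- The map `toTop` is onto the top term `A_a ⊗ A_{l_1} ⊗ ⋯`. -/
theorem map_toTop (l : List ℕ) (a : ℕ) : (tmPow (𝒜 := 𝒜) ℳ t (a + l.sum)).map
    (toTop 𝒜 ℳ t S l a) = S.refine 𝒜 (fun n => ℳ (t + n)) l a l.length := by
  induction l generalizing a with
  | nil =>
    have h : S.refine 𝒜 (fun n => ℳ (t + n)) [] a ([] : List ℕ).length =
      (ℳ (t + a)).map S.base.toLinearMap := rfl
    rw [List.sum_nil, add_zero, h, ← hgen, ← Submodule.map_comp]
    rfl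
  | cons b l ih =>
    have h : S.refine 𝒜 (fun n => ℳ (t + n)) (b :: l) a (b :: l).length =
        (box (𝒜 a) (S.refine 𝒜 (fun n => ℳ (t + n)) l b l.length)).map
          (S.cons l.length).toLinearMap := by
      show _ ⊔ S.refine 𝒜 _ l (a + b) (l.length + 1) = _
      rw [S.refine_eq_bot l _ _ (Nat.lt_succ_self _), sup_bot_eq]
    rw [h]
    apply le_antisymm
    · rintro _ ⟨u, hu, rfl⟩
      refine smul_tmPow_induction (p := fun u => toTop 𝒜 ℳ t S (b :: l) a u ∈
        (box (𝒜 a) (S.refine 𝒜 (fun n => ℳ (t + n)) l b l.length)).map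
          (S.cons l.length).toLinearMap) (fun y hy w hw => ?_) (fun y z hy hz => ?_) hu
      · rw [toTop_cons_smul S l a b hy]
        refine ⟨_, tmul_mem_box (can_mem 𝒜 hy) ?_, rfl⟩
        rw [← ih]
        exact ⟨w, hw, rfl⟩
      · rw [map_add]; exact add_mem hy hz
    · rw [Submodule.map_le_iff_le_comap, box_le]
      intro x hx y hy
      rw [← map_can_pow hquad] at hx
      rw [← ih] at hy
      obtain ⟨x, hx, rfl⟩ := hx
      obtain ⟨y, hy, rfl⟩ := hy
      refine ⟨x • y, ?_, toTop_cons_smul S l a b hx y⟩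
      rw [List.sum_cons, ← pow_smul_tmPow]
      exact Submodule.smul_mem_smul hx hy

include hquad hgen in
theorem map_topCycles (l : List ℕ) (a : ℕ) : (topCycles 𝒜 ℳ t S l a).map (toTop 𝒜 ℳ t S l a) =
    cycles S.d (S.refine 𝒜 (fun n => ℳ (t + n)) l a) l.length := by
  rw [inf_cycles_top, ← map_toTop S hquad hgen]
  apply le_antisymm
  · rintro _ ⟨u, hu, rfl⟩
    exact ⟨⟨u, hu.1, rfl⟩, hu.2⟩
  · rintro _ ⟨⟨u, hu, rfl⟩, h⟩
    exact ⟨u, ⟨hu, h⟩, rfl⟩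

include hquad hflat in
/-- The kernel of `A_1^{⊗ a} ⊗ (A_1^{⊗ m} ⊗ M_t) → A_a ⊗ X` induced by a linear map `g` into `X`.
-/
theorem mem_of_map_can_split_eq_zero {a m : ℕ} {X : Type*} [AddCommGroup X] [Module R X]
    (g : TM 𝒜 ℳ t →ₗ[R] X) {u : TM 𝒜 ℳ t} (hu : u ∈ tmPow (𝒜 := 𝒜) ℳ t (a + m))
    (h : TensorProduct.map (can 𝒜).toLinearMap g (splitFirst 𝒜 ℳ t a u) = 0) :
    u ∈ relAlg 𝒜 a • tmPow ℳ t m ⊔ V 𝒜 ^ a • (tmPow ℳ t m ⊓ LinearMap.ker g) := by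
  rw [← pow_smul_tmPow, ← range_actMap] at hu
  obtain ⟨ξ, rfl⟩ := hu
  refine actMap_mem_of_map_eq_zero (can 𝒜).toLinearMap g ?_ ξ ?_
  · rw [map_can_pow hquad]
    have := hflat a
    exact mapIncl_injective_of_graded 𝒜 a _
  · rw [← h]
    clear h
    induction ξ with
    | zero => simp
    | add x y hx hy => rw [map_add, map_add, map_add, map_add, hx, hy]
    | tmul x y => rw [actMap_tmul, splitFirst_smul x.2]; rfl

theorem map_can_split_eq_zero {a m : ℕ} {X : Type*} [AddCommGroup X] [Module R X]
    (g : TM 𝒜 ℳ t →ₗ[R] X) {u : TM 𝒜 ℳ t}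
    (hu : u ∈ relAlg 𝒜 a • tmPow ℳ t m ⊔ V 𝒜 ^ a • (tmPow ℳ t m ⊓ LinearMap.ker g)) :
    TensorProduct.map (can 𝒜).toLinearMap g (splitFirst 𝒜 ℳ t a u) = 0 := by
  suffices h : relAlg 𝒜 a • tmPow ℳ t m ⊔ V 𝒜 ^ a • (tmPow ℳ t m ⊓ LinearMap.ker g) ≤
      LinearMap.ker (TensorProduct.map (can 𝒜).toLinearMap g ∘ₗ splitFirst 𝒜 ℳ t a) from h hu
  refine sup_le (Submodule.smul_le.2 fun x hx y _ => ?_) (Submodule.smul_le.2 fun x hx y hy => ?_)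
  · have h0 : (can 𝒜).toLinearMap x = 0 := hx.2
    rw [LinearMap.mem_ker, LinearMap.comp_apply, splitFirst_smul hx.1, TensorProduct.map_tmul, h0,
      TensorProduct.zero_tmul]
  · have h0 : g y = 0 := hy.2
    rw [LinearMap.mem_ker, LinearMap.comp_apply, splitFirst_smul hx, TensorProduct.map_tmul, h0,
      TensorProduct.tmul_zero]

theorem relAlg_smul_sup_le {a m : ℕ} {X : Submodule R (TM 𝒜 ℳ t)} (hX : X ≤ tmPow ℳ t m) :
    relAlg 𝒜 a • tmPow ℳ t m ⊔ V 𝒜 ^ a • X ≤ tmPow ℳ t (a + m) := by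
  rw [← pow_smul_tmPow]
  exact sup_le (Submodule.smul_mono (relAlg_le 𝒜 a) le_rfl) (Submodule.smul_mono le_rfl hX)

include hquad hflat in
theorem topKer_cons (l : List ℕ) (a b : ℕ) : topKer 𝒜 ℳ t S (b :: l) a =
    relAlg 𝒜 a • tmPow ℳ t (b + l.sum) ⊔ V 𝒜 ^ a • topKer 𝒜 ℳ t S l b := by
  apply le_antisymm
  · rintro u ⟨hu, h⟩
    exact mem_of_map_can_split_eq_zero hquad hflat _ hu ((S.cons l.length).map_eq_zero_iff.1 h)
  · intro u hu
    exact ⟨relAlg_smul_sup_le inf_le_left hu,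
      (S.cons l.length).map_eq_zero_iff.2 (map_can_split_eq_zero _ hu)⟩

include hquad hflat hgen hL in
/-- The component of the differential with first factor of degree greater than `a` merges the
first two blocks, the component with first factor of degree `a` is the differential of `R(b, l)`.
Both have to vanish on a cycle. -/
theorem topCycles_cons (l : List ℕ) (a b : ℕ) (hb : l ≠ [] → 0 < b) :
    topCycles 𝒜 ℳ t S (b :: l) a = topKer 𝒜 ℳ t S l (a + b) ⊓
      (relAlg 𝒜 a • tmPow ℳ t (b + l.sum) ⊔ V 𝒜 ^ a • topCycles 𝒜 ℳ t S l b) := by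
  cases l with
  | nil =>
    have h1 : relAlg 𝒜 a • tmPow ℳ t (b + [].sum) ⊔ V 𝒜 ^ a • topCycles 𝒜 ℳ t S [] b =
        tmPow ℳ t (a + b) := by
      rw [topCycles_nil, List.sum_nil, add_zero, pow_smul_tmPow, sup_eq_right, ← pow_smul_tmPow]
      exact Submodule.smul_mono (relAlg_le 𝒜 a) le_rfl
    have h3 : topKer 𝒜 ℳ t S [] (a + b) ≤ tmPow ℳ t (a + b) := topKer_le S [] (a + b)
    rw [h1, inf_eq_left.2 h3]
    ext u
    have e : a + [b].sum = a + b := by simp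
    have e' : a + b + ([] : List ℕ).sum = a + b := by simp
    simp only [topCycles, topKer, Submodule.mem_inf, e, e', and_congr_right_iff]
    intro hu
    have h2 := lmul_map_split S [] a b (u := u) (by simpa using hu)
    rw [LinearMap.mem_ker, ← h2]
    show _ ∈ (⊤ : Submodule R _) ⊓ LinearMap.ker (S.d 0) ↔ _
    rw [top_inf_eq, LinearMap.mem_ker]
    show S.d 0 (S.cons 0 _) = 0 ↔ _
    rw [S.d_cons_zero]
    rfl
  | cons c l =>
    have hb' := hb (by simp)
    ext u
    have key : ∀ u ∈ tmPow (𝒜 := 𝒜) ℳ t (a + (b + (c :: l).sum)),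
        S.d (l.length + 1) (toTop 𝒜 ℳ t S (b :: c :: l) a u) =
          toTop 𝒜 ℳ t S (c :: l) (a + b) u - S.cons l.length (TensorProduct.map
            (can 𝒜).toLinearMap (S.d l.length ∘ₗ toTop 𝒜 ℳ t S (c :: l) b)
              (splitFirst 𝒜 ℳ t a u)) := by
      intro u hu
      rw [← lmul_map_split S (c :: l) a b hu]
      show S.d (l.length + 1) (S.cons (l.length + 1) _) = _
      rw [S.d_cons_succ]
      congr 2
      show TensorProduct.map LinearMap.id (S.d l.length) (TensorProduct.map (can 𝒜).toLinearMap
        (toTop 𝒜 ℳ t S (c :: l) b) (splitFirst 𝒜 ℳ t a u)) = _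
      rw [← LinearMap.comp_apply, ← TensorProduct.map_comp, LinearMap.id_comp]
    have hH : topCycles 𝒜 ℳ t S (c :: l) b = tmPow ℳ t (b + (c :: l).sum) ⊓
        LinearMap.ker (S.d l.length ∘ₗ toTop 𝒜 ℳ t S (c :: l) b) := by
      simp [topCycles, cycles, LinearMap.ker_comp]
    have hH' : u ∈ topCycles 𝒜 ℳ t S (b :: c :: l) a ↔ u ∈ tmPow ℳ t (a + (b :: c :: l).sum) ∧
        S.d (l.length + 1) (toTop 𝒜 ℳ t S (b :: c :: l) a u) = 0 := by
      simp [topCycles, cycles]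
    have hsum : a + (b :: c :: l).sum = a + (b + (c :: l).sum) := by rw [List.sum_cons]
    have hsum' : a + b + (c :: l).sum = a + (b + (c :: l).sum) := by rw [add_assoc]
    rw [hH', hsum, hH, topKer, hsum', Submodule.mem_inf, Submodule.mem_inf]
    constructor
    · rintro ⟨hu, h⟩
      rw [key u hu] at h
      -- compare the components of first degree `a`, resp. of larger first degree
      have h1 : toTop 𝒜 ℳ t S (c :: l) (a + b) u ∈
          S.refine 𝒜 (fun n => ℳ (t + n)) (c :: l) (a + b) (l.length + 1) := by
        have h2 := map_toTop S hquad hgen (c :: l) (a + b)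
        rw [hsum'] at h2
        exact h2.le ⟨u, hu, rfl⟩
      have h2 := congrArg (S.projFirst 𝒜 a l.length) h
      rw [map_sub, S.projFirst_refine _ _ _ _ (by omega) h1, map_zero, zero_sub, neg_eq_zero,
        S.projFirst_cons] at h2
      · refine ⟨⟨hu, ?_⟩, mem_of_map_can_split_eq_zero hquad hflat _ hu h2⟩
        rw [h2, map_zero, sub_zero] at h
        exact h
      · refine smul_tmPow_induction (p := fun u => TensorProduct.map (can 𝒜).toLinearMap
          (S.d l.length ∘ₗ toTop 𝒜 ℳ t S (c :: l) b) (splitFirst 𝒜 ℳ t a u) ∈ box (𝒜 a) ⊤)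
          (fun y hy w hw => ?_) (fun y z hy hz => ?_) hu
        · rw [splitFirst_smul hy, TensorProduct.map_tmul]
          exact tmul_mem_box (can_mem 𝒜 hy) trivial
        · rw [map_add, map_add]; exact add_mem hy hz
    · rintro ⟨⟨hu, h1⟩, h2⟩
      refine ⟨hu, ?_⟩
      rw [key u hu, map_can_split_eq_zero _ h2, LinearMap.mem_ker.1 h1, map_zero, sub_zero]

include hquad hgen in
/-- Surjectivity on top cycles, pulled back to `A_1^{⊗ n} ⊗ M_t`. -/
theorem topSurjective_iff (l : List ℕ) (a b : ℕ) :
    S.TopSurjective 𝒜 (fun n => ℳ (t + n)) l a b ↔ topCycles 𝒜 ℳ t S l (a + b) ≤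
      V 𝒜 ^ a • topCycles 𝒜 ℳ t S l b ⊔ topKer 𝒜 ℳ t S l (a + b) := by
  have h1 : (box (𝒜 a) (cycles S.d (S.refine 𝒜 (fun n => ℳ (t + n)) l b) l.length)).map
      (S.lmul l.length) = (V 𝒜 ^ a • topCycles 𝒜 ℳ t S l b).map (toTop 𝒜 ℳ t S l (a + b)) := by
    rw [← map_topCycles S hquad hgen]
    apply le_antisymm
    · rw [Submodule.map_le_iff_le_comap, box_le]
      rintro x hx _ ⟨y, hy, rfl⟩
      rw [← map_can_pow hquad] at hx
      obtain ⟨x, hx, rfl⟩ := hx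
      exact ⟨x • y, Submodule.smul_mem_smul hx hy, toTop_smul S l a b hx hy.1⟩
    · rw [Submodule.map_le_iff_le_comap, Submodule.smul_le]
      intro x hx y hy
      exact ⟨_, tmul_mem_box (can_mem 𝒜 hx) ⟨y, hy, rfl⟩, (toTop_smul S l a b hx hy.1).symm⟩
  rw [BarModel.TopSurjective, h1, ← map_topCycles S hquad hgen, LinearMap.map_le_map_iff]
  have h2 : V 𝒜 ^ a • topCycles 𝒜 ℳ t S l b ≤ tmPow ℳ t (a + b + l.sum) := by
    rw [add_assoc, ← pow_smul_tmPow]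
    exact Submodule.smul_mono le_rfl (topCycles_le S l b)
  constructor
  · intro h x hx
    have h3 := h hx
    rw [topKer, inf_comm, ← sup_inf_assoc_of_le _ h2]
    exact ⟨h3, hx.1⟩
  · exact fun h => h.trans (sup_le_sup_left inf_le_right _)

end TopCycles

/-! ### Inner places and cuts of a composition -/

/-- The composition `(a, l)` decomposes an interval into blocks; these are the places between
neighbouring elements of a block. The last block is followed by the factor `M_t`, which accounts
for one more place. -/
def inner : List ℕ → ℕ → Finset ℕ
  | [], a => Finset.range a
  | b :: l, a => Finset.range (a - 1) ∪ (inner l b).image (a + ·)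

/-- The places between neighbouring blocks of the composition `(a, l)`. -/
def cuts : List ℕ → ℕ → Finset ℕ
  | [], _ => ∅
  | b :: l, a => insert (a - 1) ((cuts l b).image (a + ·))

/-- All parts of the composition `(a, l)` except possibly the last are positive. -/
def PosParts : List ℕ → ℕ → Prop
  | [], _ => True
  | b :: l, a => 0 < a ∧ PosParts l b

theorem PosParts.add {l : List ℕ} {b : ℕ} (a : ℕ) (h : PosParts l b) : PosParts l (a + b) := by
  cases l with
  | nil => trivial
  | cons c l => exact ⟨Nat.add_pos_right _ h.1, h.2⟩

theorem PosParts.pos {l : List ℕ} {b : ℕ} (h : PosParts l b) (hl : l ≠ []) : 0 < b := by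
  cases l with
  | nil => exact absurd rfl hl
  | cons c l => exact h.1

theorem lt_of_mem_inner {l : List ℕ} {a q : ℕ} (h : q ∈ inner l a) : q < a + l.sum := by
  induction l generalizing a q with
  | nil => simpa [inner] using h
  | cons b l ih =>
    simp only [inner, Finset.mem_union, Finset.mem_range, Finset.mem_image] at h
    rw [List.sum_cons]
    rcases h with h | ⟨q, hq, rfl⟩
    · omega
    · have := ih hq; omega

theorem lt_of_mem_cuts {l : List ℕ} {a q : ℕ} (hp : PosParts l a) (h : q ∈ cuts l a) :
    q < a + l.sum := by
  induction l generalizing a q with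
  | nil => simp [cuts] at h
  | cons b l ih =>
    simp only [cuts, Finset.mem_insert, Finset.mem_image] at h
    rw [List.sum_cons]
    have := hp.1
    rcases h with h | ⟨q, hq, rfl⟩
    · omega
    · have := ih hp.2 hq; omega

/-- Merging the first two blocks turns the cut between them into an inner place. -/
theorem inner_add (l : List ℕ) {a b : ℕ} (ha : 0 < a) (hb : PosParts l b) :
    inner l (a + b) = insert (a - 1) (inner (b :: l) a) := by
  cases l with
  | nil =>
    ext x
    simp only [inner, Finset.mem_insert, Finset.mem_union, Finset.mem_range, Finset.mem_image]
    constructor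
    · intro h
      by_cases hx : x < a
      · omega
      · exact Or.inr (Or.inr ⟨x - a, by omega, by omega⟩)
    · rintro (h | h | ⟨y, hy, rfl⟩) <;> omega
  | cons c l =>
    have := hb.1
    ext x
    simp only [inner, Finset.mem_insert, Finset.mem_union, Finset.mem_range, Finset.mem_image]
    constructor
    · rintro (h | ⟨y, hy, rfl⟩)
      · by_cases hx : x < a
        · omega
        · exact Or.inr (Or.inr ⟨x - a, Or.inl (by omega), by omega⟩)
      · exact Or.inr (Or.inr ⟨b + y, Or.inr ⟨y, hy, rfl⟩, by omega⟩)
    · rintro (h | h | ⟨y, hy | ⟨z, hz, rfl⟩, rfl⟩)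
      · omega
      · omega
      · omega
      · exact Or.inr ⟨z, hz, by omega⟩

theorem cuts_add (l : List ℕ) {a b : ℕ} (hb : PosParts l b) :
    cuts l (a + b) = (cuts l b).image (a + ·) := by
  cases l with
  | nil => simp [cuts]
  | cons c l =>
    have := hb.1
    have e : a + (b - 1) = a + b - 1 := by omega
    rw [cuts, cuts, Finset.image_insert, Finset.image_image, e]
    congr 2
    funext x
    exact add_assoc _ _ _

/-- The composition `(1, …, 1, 0)` with `k` ones. -/
abbrev onesZero (k : ℕ) : List ℕ := List.replicate k 1 ++ [0]

theorem sum_onesZero (k : ℕ) : (onesZero k).sum = k := by simp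

theorem inner_onesZero (k : ℕ) {a : ℕ} (ha : 0 < a) : inner (onesZero k) a =
    Finset.range (a - 1) := by
  induction k generalizing a with
  | zero =>
    have e : onesZero 0 = [0] := rfl
    simp [e, inner]
  | succ k ih =>
    have e : onesZero (k + 1) = 1 :: onesZero k := rfl
    rw [e, inner, ih one_pos]
    simp

theorem cuts_onesZero (k : ℕ) {a : ℕ} (ha : 0 < a) : cuts (onesZero k) a =
    Finset.Ico (a - 1) (a + k) := by
  induction k generalizing a with
  | zero =>
    have e : onesZero 0 = [0] := rfl
    ext x
    simp only [e, cuts, Finset.mem_insert, Finset.image_empty, Finset.notMem_empty,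
      Finset.mem_Ico, or_false]
    omega
  | succ k ih =>
    have e : onesZero (k + 1) = 1 :: onesZero k := rfl
    rw [e, cuts, ih one_pos]
    ext x
    simp only [Finset.mem_insert, Finset.mem_image, Finset.mem_Ico]
    constructor
    · rintro (h | ⟨y, hy, rfl⟩) <;> omega
    · intro h
      by_cases hx : x < a
      · omega
      · exact Or.inr ⟨x - a, by omega, by omega⟩

theorem posParts_onesZero (k : ℕ) {a : ℕ} (ha : 0 < a) : PosParts (onesZero k) a := by
  induction k generalizing a with
  | zero => exact ⟨ha, trivial⟩
  | succ k ih => exact ⟨ha, ih one_pos⟩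

/-! ### Koszul modules and distributivity -/

section Main

variable {R : Type*} [CommRing R] {A : Type*} [Ring A] [Algebra R A] {𝒜 : ℕ → Submodule R A}
  {M : Type*} [AddCommGroup M] [Module R M] [Module A M] [IsScalarTower R A M]
  {ℳ : ℤ → Submodule R M} {t : ℤ} {B : ℕ → Type*}
  [∀ n, AddCommGroup (B n)] [∀ n, Module R (B n)] (S : BarModel R A M B)
  [GradedAlgebra 𝒜] (hquad : IsQuadratic 𝒜) (hflat : ∀ n, Module.Flat R (𝒜 n))
  (hgen : ∀ d : ℕ, (tmPow (𝒜 := 𝒜) ℳ t d).map (canMod 𝒜 ℳ t) = ℳ (t + d))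
  (hrel : ∀ d : ℕ, QMod 𝒜 ℳ t d = (Finset.range d).sup (SMod 𝒜 ℳ t d))
  (hL : ∀ (i j : ℕ) (a : A) (x : M), a ∈ 𝒜 i → x ∈ ℳ (t + j) → a • x ∈ ℳ (t + (i + j : ℕ)))
  (hflatM : ∀ d : ℕ, Module.Flat R (ℳ (t + d)))

theorem pow_smul_sup_SMod (a m : ℕ) {s : Finset ℕ} (hs : ∀ q ∈ s, q < m) :
    V 𝒜 ^ a • s.sup (SMod 𝒜 ℳ t m) = (s.image (a + ·)).sup (SMod 𝒜 ℳ t (a + m)) := by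
  rw [smul_finset_sup, Finset.sup_image]
  exact Finset.sup_congr rfl fun q hq => pow_smul_SMod a m q (hs q hq)

include hquad hflat hrel in
/-- The kernel of `A_1^{⊗ n} ⊗ M_t → A_a ⊗ A_{l_1} ⊗ ⋯` is the sum of the `S_{A,M,q}` over the
places `q` inside the blocks. -/
theorem topKer_eq (l : List ℕ) (a : ℕ) : topKer 𝒜 ℳ t S l a =
    (inner l a).sup (SMod 𝒜 ℳ t (a + l.sum)) := by
  induction l generalizing a with
  | nil => rw [topKer_nil, hrel, List.sum_nil, add_zero, inner]
  | cons b l ih =>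
    rw [topKer_cons S hquad hflat, ih, relAlg_smul_tmPow hquad,
      pow_smul_sup_SMod _ _ fun q hq => lt_of_mem_inner hq, inner, Finset.sup_union, List.sum_cons]

include hquad hflat hgen hrel hflatM in
/-- All quotients of `A_1^{⊗ n} ⊗ M_t` by sums of the submodules `S_{A,M,i}` are flat, being
tensor products of components of `A` and `M`. -/
theorem flatQuot_sup_SMod (n : ℕ) {Z : Finset ℕ} (hZ : Z ⊆ Finset.range n) :
    FlatQuot (Z.sup (SMod 𝒜 ℳ t n)) (tmPow ℳ t n) := by
  induction n using Nat.strong_induction_on generalizing Z with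
  | _ n ih =>
    -- at the least place `p` missing from `Z` the quotient splits as the tensor product of
    -- `A_{p+1}` and a quotient of smaller degree
    by_cases h : ∃ p, p < n ∧ p ∉ Z
    · obtain ⟨hp, hpZ⟩ := Nat.find_spec h
      have hmin : ∀ q < Nat.find h, q ∈ Z := fun q hq => by
        have := Nat.find_min h hq
        by_contra hqZ
        exact this ⟨by omega, hqZ⟩
      generalize Nat.find h = p at hp hpZ hmin
      obtain ⟨m, rfl⟩ : ∃ m, n = p + 1 + m := ⟨n - (p + 1), by omega⟩
      let Z' := (Finset.range m).filter fun q => p + 1 + q ∈ Z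
      have hZ' : Z' ⊆ Finset.range m := Finset.filter_subset _ _
      have e : Z = Finset.range p ∪ Z'.image (p + 1 + ·) := by
        ext x
        simp only [Finset.mem_union, Finset.mem_range, Finset.mem_image, Z', Finset.mem_filter]
        constructor
        · intro hx
          have h1 := Finset.mem_range.1 (hZ hx)
          rcases lt_trichotomy x p with h2 | rfl | h2
          · exact Or.inl h2
          · exact absurd hx hpZ
          · have h3 : p + 1 + (x - (p + 1)) = x := by omega
            exact Or.inr ⟨x - (p + 1), ⟨by omega, h3.symm ▸ hx⟩, h3⟩
        · rintro (h | ⟨y, ⟨_, hy⟩, rfl⟩)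
          · exact hmin x h
          · exact hy
      have hlt : ∀ q ∈ Z', q < m := fun q hq => Finset.mem_range.1 (hZ' hq)
      have h1 := ih m (by omega) hZ'
      have h2 := flatQuot_relAlg hquad hflat (p + 1)
      have h3 := flatQuot_smul (actMap_V_pow_injective ℳ t (hflat 1) (p + 1) (tmPow ℳ t m))
        (relAlg_le 𝒜 (p + 1))
        (Finset.sup_le fun q hq => SMod_le m q (hlt q hq) : Z'.sup (SMod 𝒜 ℳ t m) ≤ _)
      rw [relAlg_smul_tmPow hquad, pow_smul_sup_SMod _ _ hlt, pow_smul_tmPow,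
        Nat.add_sub_cancel, ← Finset.sup_union, ← e] at h3
      exact h3
    · push Not at h
      have e : Z = Finset.range n :=
        Finset.Subset.antisymm hZ fun q hq => h q (Finset.mem_range.1 hq)
      have : Module.Flat R ((tmPow (𝒜 := 𝒜) ℳ t n).map (canMod 𝒜 ℳ t)) := by
        rw [hgen]; exact hflatM n
      rw [e, ← hrel]
      exact flatQuot_of_map_ker _ _

include hquad hflat hgen hrel hL in
/-- A tensor represents a top cycle if it dies after merging any two neighbouring blocks, and by
`topKer_eq` merging blocks amounts to dividing by the submodule of the cut between them. -/
theorem topCycles_eq (l : List ℕ) (a : ℕ) (hp : PosParts l a) : topCycles 𝒜 ℳ t S l a =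
    tmPow ℳ t (a + l.sum) ⊓ (cuts l a).inf fun p =>
      topKer 𝒜 ℳ t S l a ⊔ SMod 𝒜 ℳ t (a + l.sum) p := by
  induction l generalizing a with
  | nil => rw [topCycles_nil, cuts, Finset.inf_empty, inf_top_eq, List.sum_nil, add_zero]
  | cons b l ih =>
    obtain ⟨ha, hp⟩ := hp
    rw [topCycles_cons S hquad hflat hgen hL l a b (fun hl => hp.pos hl), ih b hp]
    have hlt := fun q hq => lt_of_mem_cuts (q := q) hp hq
    have hK : topKer 𝒜 ℳ t S l (a + b) =
        topKer 𝒜 ℳ t S (b :: l) a ⊔ SMod 𝒜 ℳ t (a + (b :: l).sum) (a - 1) := by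
      rw [topKer_eq S hquad hflat hrel, topKer_eq S hquad hflat hrel, inner_add l ha hp,
        Finset.sup_insert, sup_comm, List.sum_cons, add_assoc]
    have := flatQuot_relAlg hquad hflat a
    have e : relAlg 𝒜 a • tmPow ℳ t (b + l.sum) ⊔ V 𝒜 ^ a • (tmPow ℳ t (b + l.sum) ⊓
        (cuts l b).inf fun p => topKer 𝒜 ℳ t S l b ⊔ SMod 𝒜 ℳ t (b + l.sum) p) =
        tmPow ℳ t (a + (b :: l).sum) ⊓ ((cuts l b).image (a + ·)).inf fun p =>
          topKer 𝒜 ℳ t S (b :: l) a ⊔ SMod 𝒜 ℳ t (a + (b :: l).sum) p := by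
      have e' : (((cuts l b).image (a + ·)).inf fun p =>
          topKer 𝒜 ℳ t S (b :: l) a ⊔ SMod 𝒜 ℳ t (a + (b :: l).sum) p) =
          (cuts l b).inf fun p => relAlg 𝒜 a • tmPow ℳ t (b + l.sum) ⊔
            V 𝒜 ^ a • (topKer 𝒜 ℳ t S l b ⊔ SMod 𝒜 ℳ t (b + l.sum) p) := by
        rw [Finset.inf_image]
        refine Finset.inf_congr rfl fun q hq => ?_
        rw [Function.comp_apply, topKer_cons S hquad hflat, Submodule.smul_sup,
          pow_smul_SMod _ _ _ (hlt q hq), sup_assoc, List.sum_cons]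
      rw [e', List.sum_cons, ← pow_smul_tmPow a]
      apply le_antisymm
      · refine sup_le (le_inf (Submodule.smul_mono (relAlg_le 𝒜 a) le_rfl)
          (Finset.le_inf fun q hq => le_sup_left)) (le_inf (Submodule.smul_mono le_rfl inf_le_left)
          (Finset.le_inf fun q hq => ?_))
        exact (Submodule.smul_mono le_rfl (inf_le_right.trans (Finset.inf_le hq))).trans
          le_sup_right
      · exact finset_inf_smul_sup_le' (actMap_V_pow_injective ℳ t (hflat 1) a _) (cuts l b)
          (relAlg_le 𝒜 a) fun q hq => sup_le (topKer_le S l b) (SMod_le _ _ (hlt q hq))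
    rw [e, hK, cuts, Finset.inf_insert, inf_left_comm]

include hquad hflat hgen hrel hL in
/-- With `K` the kernel and `N p` the submodules of the cuts, the distributive law gives
`⋂ (K + N p) = K + ⋂ N p`, and `⋂ N p` comes from `A_1^{⊗ a} ⊗` the corresponding intersection
for `(b, l)`. -/
theorem topSurjective_of_isDistribSet (l : List ℕ) {a b : ℕ} (hp : PosParts l b)
    (hd : IsDistribSet (SMod 𝒜 ℳ t (a + b + l.sum) '' Finset.range (a + b + l.sum))) :
    S.TopSurjective 𝒜 (fun n => ℳ (t + n)) l a b := by
  rw [topSurjective_iff S hquad hgen]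
  obtain ⟨E, hE, hX, hb, ht⟩ := hd.exists_bounded
  have hlt := fun q hq => lt_of_mem_cuts (q := q) hp hq
  have hmem : ∀ q < a + b + l.sum, SMod 𝒜 ℳ t (a + b + l.sum) q ∈ E := fun q hq =>
    hX ⟨q, by simpa using hq, rfl⟩
  have hKE : topKer 𝒜 ℳ t S l (a + b) ∈ E := by
    rw [topKer_eq S hquad hflat hrel]
    exact Sublattice.finset_sup_mem hb _ fun q hq => hmem q (lt_of_mem_inner hq)
  have h1 : topCycles 𝒜 ℳ t S l (a + b) ≤ tmPow ℳ t (a + b + l.sum) ⊓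
      (topKer 𝒜 ℳ t S l (a + b) ⊔ (cuts l (a + b)).inf (SMod 𝒜 ℳ t (a + b + l.sum))) := by
    rw [topCycles_eq S hquad hflat hgen hrel hL l _ (hp.add a)]
    exact inf_le_inf_left _ (finset_inf_sup_le hE ht _
      (fun q hq => hmem q (lt_of_mem_cuts (hp.add a) hq)) hKE)
  refine h1.trans ?_
  rw [inf_comm, sup_inf_assoc_of_le _ (topKer_le S l (a + b)), sup_comm]
  refine sup_le_sup_right ?_ _
  -- `A_1^{⊗ a}` is flat, so that tensoring with it commutes with finite intersections
  have := flat_V_pow (hflat 1) a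
  rw [topCycles_eq S hquad hflat hgen hrel hL l _ hp, cuts_add l hp, Finset.inf_image, inf_comm,
    add_assoc, ← pow_smul_tmPow a]
  refine le_trans (inf_le_inf_left _ (Finset.inf_mono_fun fun q hq => ?_))
    (finset_inf_smul_le (actMap_V_pow_injective ℳ t (hflat 1) a _) (cuts l b)
      fun q hq => sup_le (topKer_le S l b) (SMod_le _ _ (hlt q hq)))
  rw [Function.comp_apply, ← pow_smul_SMod _ _ _ (hlt q hq)]
  exact Submodule.smul_mono le_rfl le_sup_right

include hquad hflat hgen hrel hL in
/-- Distributivity implies exactness of all refinement cochain complexes. -/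
theorem refineExact_of_isDistribSet
    (hd : ∀ n, IsDistribSet (SMod 𝒜 ℳ t n '' Finset.range n)) (l : List ℕ) (a : ℕ)
    (hp : PosParts l a) : S.RefineExact 𝒜 (fun n => ℳ (t + n)) l a := by
  induction l generalizing a with
  | nil => intro n hn; simp at hn
  | cons b l ih =>
    obtain ⟨_, hp⟩ := hp
    have := hflat a
    exact S.refineExact_cons hL (fun hl => hp.pos hl) (ih b hp) (ih _ (hp.add a))
      (topSurjective_of_isDistribSet S hquad hflat hgen hrel hL l hp (hd _))

section OfBar

variable (hbar : ∀ k, S.RefineExact 𝒜 (fun n => ℳ (t + n)) (onesZero k) 1)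

include hflat hL hbar in
/-- Exactness for `(a + 1, 1, …, 1, 0)` follows from that for `(1, …, 1, 0)` by induction on `a`,
merging the first two parts. -/
theorem refineExact_onesZero (k a : ℕ) :
    S.RefineExact 𝒜 (fun n => ℳ (t + n)) (onesZero k) (a + 1) ∧
      S.TopSurjective 𝒜 (fun n => ℳ (t + n)) (onesZero k) (a + 1) 1 := by
  have h : ∀ k, S.RefineExact 𝒜 (fun n => ℳ (t + n)) (onesZero k) (a + 1) := by
    induction a with
    | zero => exact fun k => hbar k
    | succ a ih =>
      have := hflat (a + 1)
      exact fun k => (S.refineExact_of_cons hL (fun _ => one_pos) (hbar k) (ih (k + 1))).1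
  have := hflat (a + 1)
  exact ⟨h k, (S.refineExact_of_cons hL (fun _ => one_pos) (hbar k) (h (k + 1))).2⟩

theorem canMod_tmul (x : TA 𝒜) (m : ℳ t) : canMod 𝒜 ℳ t (x ⊗ₜ m) = can 𝒜 x • (m : M) := rfl

include hquad hflat hL hbar in
/-- A Koszul module is generated in its initial degree. -/
theorem map_canMod_of_bar (d : ℕ) :
    (tmPow (𝒜 := 𝒜) ℳ t d).map (canMod 𝒜 ℳ t) = ℳ (t + d) := by
  have h0 : ∀ m : ℳ t, (m : M) ∈ ℳ (t + (0 : ℕ)) := fun m => by simp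
  apply le_antisymm
  · rw [Submodule.map_le_iff_le_comap, tens_le]
    intro x hx m
    have := hL d 0 _ _ (can_mem 𝒜 hx) (h0 m)
    rwa [add_zero] at this
  · rcases d with _ | d
    · intro m hm
      have hm' : m ∈ ℳ t := by simpa using hm
      refine ⟨1 ⊗ₜ ⟨m, hm'⟩, tmul_mem_tens (by simp [Submodule.one_le.1 le_rfl]) _, ?_⟩
      rw [canMod_tmul, map_one, one_smul]
    · intro m hm
      -- the refinement complex of `(d + 1, 0)` is the map `A_{d+1} ⊗ M_t → M_{t+d+1}`
      obtain ⟨x, hx, hxm⟩ := (refineExact_onesZero S hflat hL hbar 0 d).1 0 (by simp)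
        (show S.base m ∈ (ℳ (t + (d + 1 + 0 : ℕ))).map S.base.toLinearMap from ⟨m, hm, rfl⟩)
      have hx' : x ∈ (box (𝒜 (d + 1)) ((ℳ (t + (0 : ℕ))).map S.base.toLinearMap)).map
        (S.cons 0).toLinearMap ⊔ ⊥ := hx
      rw [sup_bot_eq] at hx'
      obtain ⟨ξ, hξ, rfl⟩ := hx'
      have h1 : box (𝒜 (d + 1)) ((ℳ (t + (0 : ℕ))).map S.base.toLinearMap) ≤
          (((tmPow (𝒜 := 𝒜) ℳ t (d + 1)).map (canMod 𝒜 ℳ t)).map S.base.toLinearMap).comap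
            (S.d 0 ∘ₗ (S.cons 0).toLinearMap) := by
        rw [box_le]
        rintro a ha _ ⟨y, hy, rfl⟩
        rw [← map_can_pow hquad] at ha
        obtain ⟨a, ha, rfl⟩ := ha
        have hy' : y ∈ ℳ t := by simpa using hy
        refine ⟨_, ⟨_, tmul_mem_tens ha ⟨y, hy'⟩, rfl⟩, ?_⟩
        exact (S.d_base _ _).symm
      obtain ⟨m', hm', e⟩ := h1 hξ
      have : S.base m' = S.base m := e.trans hxm
      rwa [S.base.injective this] at hm'

theorem SMod_le_QMod (n i : ℕ) (h : i < n) : SMod 𝒜 ℳ t n i ≤ QMod 𝒜 ℳ t n := by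
  refine le_inf (SMod_le n i h) ?_
  rw [SMod]
  split_ifs
  · rw [tens_le]
    intro x hx m
    have h0 : can 𝒜 x = 0 := SAlg_le_ker n i hx
    rw [LinearMap.mem_ker, canMod_tmul, h0, zero_smul]
  · rw [Submodule.smul_le]
    intro x hx y hy
    have h0 : canMod 𝒜 ℳ t y = 0 := hy.2
    rw [LinearMap.mem_ker, canMod_smul, h0, smul_zero]

theorem QMod_zero : QMod 𝒜 ℳ t 0 = ⊥ := by
  rw [eq_bot_iff]
  rintro u ⟨hu, h⟩
  obtain ⟨m, rfl⟩ : ∃ m : ℳ t, u = 1 ⊗ₜ m := by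
    refine tens_induction (p := fun u => ∃ m : ℳ t, u = 1 ⊗ₜ m) (fun x hx m => ?_)
      ⟨0, by simp⟩ ?_ hu
    · obtain ⟨r, rfl⟩ := Submodule.mem_one.1 (by simpa using hx)
      exact ⟨r • m, by rw [Algebra.algebraMap_eq_smul_one, TensorProduct.smul_tmul]⟩
    · rintro _ _ ⟨m, rfl⟩ ⟨m', rfl⟩
      exact ⟨m + m', by rw [TensorProduct.tmul_add]⟩
  have h1 : canMod 𝒜 ℳ t (1 ⊗ₜ m) = 0 := h
  rw [canMod_tmul, map_one, one_smul] at h1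
  have hm : m = 0 := Subtype.ext h1
  rw [hm, Submodule.mem_bot]
  exact TensorProduct.tmul_zero _ _

theorem SMod_succ_self (n : ℕ) : SMod 𝒜 ℳ t (n + 1) n = V 𝒜 ^ n • QMod 𝒜 ℳ t 1 := by
  rw [SMod, if_neg (by omega)]

include hquad hflat hL hbar in
/-- The relations of a Koszul module are generated by those of lowest degree. -/
theorem QMod_eq_of_bar (d : ℕ) :
    QMod 𝒜 ℳ t d = (Finset.range d).sup (SMod 𝒜 ℳ t d) := by
  apply le_antisymm
  · rcases d with _ | _ | a
    · rw [QMod_zero]; exact bot_le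
    · have : SMod 𝒜 ℳ t 1 0 = QMod 𝒜 ℳ t 1 := by
        rw [SMod_succ_self, pow_zero, Submodule.one_smul]
      simp [this]
    -- surjectivity on the cycles of the refinement complex of `(a + 2, 0)`, which are the relations
    · have hgen := map_canMod_of_bar S hquad hflat hL hbar
      have h := (topSurjective_iff S hquad hgen [0] (a + 1) 1).1
        (refineExact_onesZero S hflat hL hbar 0 a).2
      rw [topKer_cons S hquad hflat, topKer_nil, QMod_zero, Submodule.smul_bot, sup_bot_eq,
        relAlg_smul_tmPow hquad] at h
      have h1 : QMod 𝒜 ℳ t (a + 1 + 1) ≤ topCycles 𝒜 ℳ t S [0] (a + 1 + 1) := by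
        rw [topCycles_cons S hquad hflat hgen hL [] _ 0 (by simp), topKer_nil, topCycles_nil,
          pow_smul_tmPow]
        exact le_inf le_rfl (inf_le_left.trans le_sup_right)
      have h2 : topCycles 𝒜 ℳ t S [0] 1 ≤ QMod 𝒜 ℳ t 1 := by
        rw [topCycles_cons S hquad hflat hgen hL [] _ 0 (by simp), topKer_nil]
        exact inf_le_left
      refine (h1.trans h).trans ?_
      refine sup_le ?_ (Finset.sup_mono (Finset.range_mono (Nat.le_succ _)))
      refine (Submodule.smul_mono le_rfl h2).trans ?_
      rw [← SMod_succ_self]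
      exact Finset.le_sup (f := SMod 𝒜 ℳ t (a + 1 + 1)) (Finset.self_mem_range_succ _)
  · exact Finset.sup_le fun i hi => SMod_le_QMod d i (Finset.mem_range.1 hi)

include hquad hflat hL hflatM in
/-- Distributivity of the collection in degree `n` from distributivity in smaller degrees: proper
subcollections are tensor products of collections of smaller degree. -/
theorem isDistribSet_SMod_of_bar (n : ℕ)
    (hA : ∀ k ≤ n, IsDistribSet (SAlg 𝒜 k '' Finset.range (k - 1)))
    (hM : ∀ m < n, IsDistribSet (SMod 𝒜 ℳ t m '' Finset.range m))
    (hbar : ∀ k, S.RefineExact 𝒜 (fun n => ℳ (t + n)) (onesZero k) 1) :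
    IsDistribSet (SMod 𝒜 ℳ t n '' Finset.range n) := by
  have hgen := map_canMod_of_bar S hquad hflat hL hbar
  have hrel := QMod_eq_of_bar S hquad hflat hL hbar
  have hlt : ∀ m, ∀ q ∈ Finset.range m, SMod 𝒜 ℳ t m q ≤ tmPow ℳ t m :=
    fun m q hq => SMod_le m q (Finset.mem_range.1 hq)
  apply isDistribSet_of_proper
  -- without the `j`-th member the collection splits after `j + 1` tensor factors
  · intro j hj
    obtain ⟨m, rfl⟩ : ∃ m, n = j + 1 + m := ⟨n - (j + 1), by omega⟩
    have := flat_V_pow (hflat 1) (j + 1)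
    refine (isDistribSet_tensor (actMap_V_pow_injective ℳ t (hflat 1) (j + 1) (tmPow ℳ t m))
      (hA (j + 1) (by omega)) (hM m (by omega))
      (fun i hi => SAlg_le 𝒜 (j + 1) i (by have := Finset.mem_range.1 hi; omega)) (hlt m)
      fun Z hZ => flatQuot_sup_SMod hquad hflat hgen hrel hflatM m hZ).mono ?_
    rintro _ ⟨p, hp, rfl⟩
    obtain ⟨hpj, hp⟩ := Finset.mem_erase.1 hp
    rw [Finset.mem_range] at hp
    rcases lt_or_gt_of_ne hpj with h | h
    · exact Or.inl ⟨p, Finset.mem_coe.2 (Finset.mem_range.2 (by omega)),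
        SAlg_smul_tmPow (j + 1) m p (by omega)⟩
    · refine Or.inr ⟨p - (j + 1), Finset.mem_coe.2 (Finset.mem_range.2 (by omega)), ?_⟩
      have e : j + 1 + (p - (j + 1)) = p := by omega
      have h1 := pow_smul_SMod (𝒜 := 𝒜) (ℳ := ℳ) (t := t) (j + 1) m (p - (j + 1)) (by omega)
      rwa [e] at h1
  -- the remaining inequality is surjectivity on the top cycles of `R(a, 1, …, 1, 0)`, with the
  -- cycles and the kernel written in terms of the `S_{A,M,i}`
  · intro a ha han
    obtain ⟨k, rfl⟩ : ∃ k, n = a + 1 + k := ⟨n - (a + 1), by omega⟩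
    obtain ⟨a, rfl⟩ : ∃ a', a = a' + 1 := ⟨a - 1, by omega⟩
    have h := (topSurjective_iff S hquad hgen (onesZero k) (a + 1) 1).1
      (refineExact_onesZero S hflat hL hbar k a).2
    rw [topCycles_eq S hquad hflat hgen hrel hL _ _ (posParts_onesZero k (by omega)),
      topCycles_eq S hquad hflat hgen hrel hL _ _ (posParts_onesZero k one_pos),
      topKer_eq S hquad hflat hrel, topKer_eq S hquad hflat hrel, inner_onesZero k (by omega),
      inner_onesZero k one_pos, cuts_onesZero k (by omega), cuts_onesZero k one_pos,
      sum_onesZero, Nat.add_sub_cancel, Nat.sub_self, Finset.range_zero, Finset.sup_empty] at h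
    rw [sup_comm]
    refine le_trans (le_inf ?_ le_rfl) (h.trans (sup_le_sup_right (Finset.le_inf fun p hp => ?_) _))
    · refine (Finset.inf_le (Finset.left_mem_Ico.2 han)).trans
        (sup_le (Finset.sup_le fun i hi => hlt _ i ?_) (hlt _ _ ?_))
      · have := Finset.mem_range.1 hi
        exact Finset.mem_range.2 (by omega)
      · exact Finset.mem_range.2 (by omega)
    · have hp' := Finset.mem_Ico.1 hp
      have e : a + 1 + (p - (a + 1)) = p := by omega
      have h1 := pow_smul_SMod (𝒜 := 𝒜) (ℳ := ℳ) (t := t) (a + 1) (1 + k) (p - (a + 1)) (by omega)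
      rw [e, ← add_assoc] at h1
      rw [← h1]
      refine Submodule.smul_mono le_rfl (inf_le_right.trans ?_)
      refine (Finset.inf_le (b := p - (a + 1)) (Finset.mem_Ico.2 (by omega))).trans ?_
      rw [bot_sup_eq]

end OfBar

end Main

/-! ### Coarsenings of a composition -/

theorem isCoarsening_iff {α β : List ℕ} : IsCoarsening α β ↔
    ∃ e : List Bool, e.length = α.length - 1 ∧ β = merge e α := by
  constructor
  · rintro ⟨J, rfl⟩
    exact ⟨_, List.length_ofFn, rfl⟩
  · rintro ⟨e, he, rfl⟩
    refine ⟨Finset.univ.filter fun i => e[i]'(by omega) = true, ?_⟩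
    unfold sigma
    congr 1
    refine List.ext_getElem (by simp [he]) fun i h1 h2 => ?_
    simp

theorem isCoarsening_singleton {a : ℕ} {β : List ℕ} : IsCoarsening [a] β ↔ β = [a] := by
  rw [isCoarsening_iff]
  constructor
  · rintro ⟨e, he, rfl⟩
    obtain rfl : e = [] := List.length_eq_zero_iff.1 he
    simp [merge]
  · rintro rfl
    exact ⟨[], rfl, by simp [merge]⟩

/-- A coarsening of a composition either keeps the first part or merges the first two. -/
theorem isCoarsening_cons_cons {a b : ℕ} {l β : List ℕ} : IsCoarsening (a :: b :: l) β ↔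
    (∃ β', IsCoarsening (b :: l) β' ∧ β = a :: β') ∨ IsCoarsening ((a + b) :: l) β := by
  simp only [isCoarsening_iff]
  constructor
  · rintro ⟨e, he, rfl⟩
    match e, he with
    | true :: e, he => exact Or.inr ⟨e, by simpa using he, by rw [merge]⟩
    | false :: e, he => exact Or.inl ⟨_, ⟨e, by simpa using he, rfl⟩, by rw [merge]⟩
  · rintro (⟨_, ⟨e, he, rfl⟩, rfl⟩ | ⟨e, he, rfl⟩)
    · exact ⟨false :: e, by simpa using he, by rw [merge]⟩
    · exact ⟨true :: e, by simpa using he, by rw [merge]⟩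

theorem IsCoarsening.ne_nil {α β : List ℕ} (h : IsCoarsening α β) (hα : α ≠ []) : β ≠ [] := by
  obtain ⟨a, l, rfl⟩ := List.exists_cons_of_ne_nil hα
  clear hα
  induction l generalizing a β with
  | nil => rw [isCoarsening_singleton.1 h]; simp
  | cons b l ih =>
    rcases isCoarsening_cons_cons.1 h with ⟨β', _, rfl⟩ | h
    · simp
    · exact ih _ h

/-! ### Comparison of subcomplexes of the bar complex -/

theorem box_iSup {R : Type*} [CommRing R] {W₁ W₂ : Type*} [AddCommGroup W₁] [Module R W₁]
    [AddCommGroup W₂] [Module R W₂] {ι : Sort*} (P : Submodule R W₁) (X : ι → Submodule R W₂) :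
    box P (⨆ i, X i) = ⨆ i, box P (X i) := by
  apply le_antisymm
  · rw [box_le]
    intro x hx y hy
    have h : (⨆ i, X i) ≤ (⨆ i, box P (X i)).comap (TensorProduct.mk R W₁ W₂ x) :=
      iSup_le fun i y hy => Submodule.mem_iSup_of_mem i (tmul_mem_box hx hy)
    exact h hy
  · exact iSup_le fun i => box_mono le_rfl (le_iSup X i)

theorem sup_range_succ' {L : Type*} [SemilatticeSup L] [OrderBot L] (n : ℕ) (f : ℕ → L) :
    (Finset.range (n + 1)).sup f = f 0 ⊔ (Finset.range n).sup fun i => f (i + 1) := by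
  rw [Finset.range_add_one', Finset.sup_insert, Finset.sup_map]
  rfl

theorem subsingleton_homology_iff {R : Type*} [CommRing R] {B : ℕ → Type*}
    [∀ k, AddCommGroup (B k)] [∀ k, Module R (B k)] (d : ∀ k, B (k + 1) →ₗ[R] B k)
    (F : ∀ k, Submodule R (B k)) (n : ℕ) :
    Subsingleton (Homology d F n) ↔ cycles d F n ≤ (F (n + 1)).map (d n) := by
  rw [Submodule.Quotient.subsingleton_iff, Submodule.submoduleOf, Submodule.comap_subtype_eq_top]

namespace BarModel

variable {R : Type*} [CommRing R] {A : Type*} [Ring A] [Algebra R A] {M : Type*}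
  [AddCommGroup M] [Module R M] [Module A M] [IsScalarTower R A M] {B : ℕ → Type*}
  [∀ n, AddCommGroup (B n)] [∀ n, Module R (B n)] (S : BarModel R A M B)
  {𝒜 : ℕ → Submodule R A} {L : ℕ → Submodule R M}

/-- The sum over all coarsenings agrees with the recursive definition of the refinement complex.
The data `P β n` stands for the tensor product of the components indexed by the parts of `β`. -/
theorem iSup_coarsening_eq_refine (P : List ℕ → ∀ n, Submodule R (B n))
    (hbase : ∀ a, P [a] 0 = (L a).map S.base.toLinearMap)
    (hcons : ∀ a β n, P (a :: β) (n + 1) = (box (𝒜 a) (P β n)).map (S.cons n).toLinearMap)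
    (l : List ℕ) (a n : ℕ) :
    (⨆ (β : List ℕ) (_ : IsCoarsening (a :: l) β ∧ β.length = n + 1), P β n) =
      S.refine 𝒜 L l a n := by
  induction l generalizing a n with
  | nil =>
    simp only [isCoarsening_singleton]
    cases n with
    | zero =>
      rw [refine, ← hbase]
      exact le_antisymm (iSup₂_le fun β hβ => hβ.1 ▸ le_rfl) (le_iSup₂_of_le [a] ⟨rfl, rfl⟩ le_rfl)
    | succ n =>
      rw [refine, eq_bot_iff]
      refine iSup₂_le fun β hβ => ?_
      rw [hβ.1] at hβ
      simp at hβ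
  | cons b l ih =>
    cases n with
    | zero =>
      rw [refine, ← ih]
      apply le_antisymm
      · refine iSup₂_le fun β hβ => ?_
        rcases isCoarsening_cons_cons.1 hβ.1 with ⟨β', h, rfl⟩ | h
        · have := h.ne_nil (by simp)
          have h2 := hβ.2
          simp only [List.length_cons, zero_add, Nat.add_eq_right, List.length_eq_zero_iff] at h2
          exact absurd h2 this
        · exact le_iSup₂_of_le β ⟨h, hβ.2⟩ le_rfl
      · exact iSup₂_le fun β hβ =>
          le_iSup₂_of_le β ⟨isCoarsening_cons_cons.2 (Or.inr hβ.1), hβ.2⟩ le_rfl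
    | succ n =>
      rw [refine, ← ih, ← ih]
      apply le_antisymm
      · refine iSup₂_le fun β hβ => ?_
        rcases isCoarsening_cons_cons.1 hβ.1 with ⟨β', h, rfl⟩ | h
        · refine le_trans ?_ le_sup_left
          rw [hcons]
          exact Submodule.map_mono (box_mono le_rfl
            (le_iSup₂_of_le β' ⟨h, by simpa using hβ.2⟩ le_rfl))
        · exact le_trans (le_iSup₂_of_le β ⟨h, hβ.2⟩ le_rfl) le_sup_right
      · refine sup_le ?_ (iSup₂_le fun β hβ =>
          le_iSup₂_of_le β ⟨isCoarsening_cons_cons.2 (Or.inr hβ.1), hβ.2⟩ le_rfl)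
        simp only [box_iSup, Submodule.map_iSup]
        refine iSup₂_le fun β hβ => ?_
        rw [← hcons]
        exact le_iSup₂_of_le (a :: β) ⟨isCoarsening_cons_cons.2 (Or.inl ⟨β, hβ.1, rfl⟩),
          by rw [List.length_cons, hβ.2]⟩ le_rfl

theorem refine_onesZero_zero (k a : ℕ) :
    S.refine 𝒜 L (onesZero k) a 0 = (L (a + k)).map S.base.toLinearMap := by
  induction k generalizing a with
  | zero => rfl
  | succ k ih =>
    have e : a + (k + 1) = a + 1 + k := by omega
    rw [e]
    exact ih (a + 1)

/-- The strand of internal degree `j + 1` in the bar complex is the refinement complex of the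
composition `(1, …, 1, 0)` with `j + 1` ones. -/
theorem strand_eq_refine (D : ℕ → ∀ n, Submodule R (B n))
    (hbase : ∀ j, D j 0 = (L j).map S.base.toLinearMap)
    (hcons : ∀ j n, D j (n + 1) = (Finset.range j).sup fun c =>
      (box (𝒜 (c + 1)) (D (j - 1 - c) n)).map (S.cons n).toLinearMap) (n j : ℕ) :
    D (j + 1) n = S.refine 𝒜 L (onesZero j) 1 n := by
  induction n generalizing j with
  | zero => rw [hbase, refine_onesZero_zero, add_comm]
  | succ n ih =>
    have h0 : S.refine 𝒜 L [] 0 n = D 0 n := by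
      cases n with
      | zero => rw [hbase]; rfl
      | succ n => rw [hcons]; rfl
    have key : ∀ k a, S.refine 𝒜 L (onesZero k) a (n + 1) = (Finset.range (k + 1)).sup fun c =>
        (box (𝒜 (c + a)) (D (k - c) n)).map (S.cons n).toLinearMap := by
      intro k
      induction k with
      | zero =>
        intro a
        show (box (𝒜 a) (S.refine 𝒜 L [] 0 n)).map (S.cons n).toLinearMap ⊔ ⊥ = _
        rw [h0]
        simp
      | succ k ihk =>
        intro a
        show (box (𝒜 a) (S.refine 𝒜 L (onesZero k) 1 n)).map (S.cons n).toLinearMap ⊔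
          S.refine 𝒜 L (onesZero k) (a + 1) (n + 1) = _
        rw [ihk, ← ih, sup_range_succ' (k + 1), zero_add, Nat.sub_zero]
        have e : ∀ c, c + (a + 1) = c + 1 + a := fun c => by omega
        simp only [Nat.add_sub_add_right, e]
    rw [hcons, key]
    rfl

/-- Replacing the grading by a shifted one amounts to changing the last part of a composition. -/
theorem refine_shift (L' : ℕ → Submodule R M) (hL' : ∀ n, L' n = L (n + 1)) (l : List ℕ)
    (r a n : ℕ) : S.refine 𝒜 L (l ++ [r + 1]) a n = S.refine 𝒜 L' (l ++ [r]) a n := by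
  have h : ∀ b, S.refine 𝒜 L [] (b + 1) = S.refine 𝒜 L' [] b := by
    intro b
    funext n
    cases n with
    | zero =>
      show (L (b + 1)).map _ = (L' b).map _
      rw [hL']
    | succ n => rfl
  induction l generalizing a n with
  | nil =>
    cases n with
    | zero => exact congrFun (h (a + r)) 0
    | succ n =>
      show (box (𝒜 a) (S.refine 𝒜 L [] (r + 1) n)).map _ ⊔ ⊥ = _
      rw [h]
      rfl
  | cons b l ih =>
    cases n with
    | zero => exact ih _ _
    | succ n =>
      show (box (𝒜 a) (S.refine 𝒜 L (l ++ [r + 1]) b n)).map _ ⊔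
        S.refine 𝒜 L (l ++ [r + 1]) (a + b) (n + 1) = _
      rw [ih, ih]
      rfl

end BarModel

/-! ### The bar complexes on tensor powers -/

section Concrete

variable (R : Type*) [CommRing R] (A : Type*) [Ring A] [Algebra R A]

/-- The first element of `Fin (n + 1)`, and the others. -/
def unitSumFin (n : ℕ) : Unit ⊕ Fin n ≃ Fin (n + 1) where
  toFun := Sum.elim (fun _ => 0) Fin.succ
  invFun := Fin.cases (Sum.inl ()) Sum.inr
  left_inv := by rintro (_ | i) <;> simp
  right_inv := by
    intro i
    cases i using Fin.cases <;> simp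

/-- Splitting off the first factor of a tensor power. -/
def consTensor (n : ℕ) : A ⊗[R] (⨂[R] _ : Fin n, A) ≃ₗ[R] ⨂[R] _ : Fin (n + 1), A :=
  (TensorProduct.congr (PiTensorProduct.subsingletonEquiv (R := R) (s := fun _ : Unit => A) ()).symm
    (LinearEquiv.refl R _)) ≪≫ₗ PiTensorProduct.tmulEquiv R A ≪≫ₗ
      PiTensorProduct.reindex R (fun _ => A) (unitSumFin n)

variable {A}

@[simp]
theorem consTensor_tprod (n : ℕ) (a : A) (f : Fin n → A) :
    consTensor R A n (a ⊗ₜ PiTensorProduct.tprod R f) =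
      PiTensorProduct.tprod R (Fin.cons a f : Fin (n + 1) → A) := by
  rw [consTensor, LinearEquiv.trans_apply, LinearEquiv.trans_apply, TensorProduct.congr_tmul,
    PiTensorProduct.subsingletonEquiv_symm_apply', LinearEquiv.refl_apply,
    PiTensorProduct.tmulEquiv_apply, PiTensorProduct.reindex_tprod]
  congr 1
  funext i
  cases i using Fin.cases <;> simp [unitSumFin]

variable {R}

theorem mulFace_tprod {n : ℕ} (j : Fin n) (a : Fin (n + 1) → A) :
    mulFace R A j (PiTensorProduct.tprod R a) = PiTensorProduct.tprod R (mulAt j a) :=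
  PiTensorProduct.lift.tprod _

theorem mulAt_cons_zero {n : ℕ} (a : A) (f : Fin (n + 1) → A) :
    mulAt 0 (Fin.cons a f : Fin (n + 2) → A) = Fin.cons (a * f 0) (Fin.tail f) := by
  funext k
  cases k using Fin.cases with
  | zero => simp [mulAt]
  | succ k => simp [mulAt, Fin.tail, Fin.succ_ne_zero]

theorem mulAt_cons_succ {n : ℕ} (j : Fin n) (a : A) (f : Fin (n + 1) → A) :
    mulAt j.succ (Fin.cons a f : Fin (n + 2) → A) = Fin.cons a (mulAt j f) := by
  funext k
  cases k using Fin.cases with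
  | zero => simp [mulAt, Fin.succ_pos]
  | succ k =>
    simp only [mulAt, Fin.succ_lt_succ_iff, Fin.succ_inj, Fin.cons_succ, ← Fin.succ_castSucc]

theorem linearMap_zsmul_apply {P Q : Type*} [AddCommGroup P] [Module R P] [AddCommGroup Q]
    [Module R Q] (k : ℤ) (f : P →ₗ[R] Q) (x : P) : (k • f) x = k • f x := rfl

theorem barD_cons (n : ℕ) (a : A) (f : Fin (n + 1) → A) :
    barD R A (n + 1) (PiTensorProduct.tprod R (Fin.cons a f : Fin (n + 2) → A)) =
      PiTensorProduct.tprod R (Fin.cons (a * f 0) (Fin.tail f) : Fin (n + 1) → A) -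
        consTensor R A n (a ⊗ₜ barD R A n (PiTensorProduct.tprod R f)) := by
  simp only [barD, LinearMap.sum_apply, linearMap_zsmul_apply, mulFace_tprod]
  rw [Fin.sum_univ_succ, mulAt_cons_zero, TensorProduct.tmul_sum, map_sum, sub_eq_add_neg,
    ← Finset.sum_neg_distrib]
  simp only [Fin.val_zero, pow_zero, one_smul, mulAt_cons_succ, Fin.val_succ]
  congr 1
  refine Finset.sum_congr rfl fun j _ => ?_
  have e : ∀ x : ⨂[R] _ : Fin n, A, consTensor R A n (a ⊗ₜ ((-1 : ℤ) ^ (j : ℕ) • x)) =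
      (-1 : ℤ) ^ (j : ℕ) • consTensor R A n (a ⊗ₜ x) := fun x =>
    map_zsmul ((consTensor R A n).toLinearMap ∘ₗ TensorProduct.mk R _ _ a) _ _
  rw [e, consTensor_tprod, pow_succ, mul_neg, mul_one, neg_smul]

theorem piTensor_induction {n : ℕ} {p : (⨂[R] _ : Fin n, A) → Prop}
    (smul_tprod : ∀ (r : R) f, p (r • PiTensorProduct.tprod R f))
    (add : ∀ x y, p x → p y → p (x + y)) (x : ⨂[R] _ : Fin n, A) : p x :=
  PiTensorProduct.induction_on x smul_tprod add

/-- The bar complex of `A`, as the bar complex of the `A`-module `A_+`: the factor in the module is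
the last factor of the tensor power. -/
def algBarModel : BarModel R A A (fun n => ⨂[R] _ : Fin (n + 1), A) where
  base := (PiTensorProduct.subsingletonEquiv (R := R) (s := fun _ : Fin 1 => A) 0).symm
  cons n := consTensor R A (n + 1)
  d n := barD R A (n + 1)
  d_base a m := by
    rw [PiTensorProduct.subsingletonEquiv_symm_apply',
      PiTensorProduct.subsingletonEquiv_symm_apply', consTensor_tprod, barD_cons]
    have h : barD R A 0 = 0 := by simp [barD]
    rw [h, LinearMap.zero_apply, TensorProduct.tmul_zero, map_zero, sub_zero]
    congr 1
    funext i
    fin_cases i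
    rfl
  d_cons n a b x := by
    induction x using piTensor_induction with
    | smul_tprod r f =>
      simp only [TensorProduct.tmul_smul, map_smul, consTensor_tprod]
      rw [barD_cons (n + 1), smul_sub]
      simp only [Fin.cons_zero, Fin.tail_cons]
    | add x y hx hy =>
      simp only [TensorProduct.tmul_add, map_add, hx, hy]
      abel

variable {M : Type*} [AddCommGroup M] [Module R M] [Module A M] [IsScalarTower R A M]

theorem actFace_tmul (n : ℕ) (a : Fin (n + 1) → A) (m : M) :
    actFace R A M n (PiTensorProduct.tprod R a ⊗ₜ m) =
      PiTensorProduct.tprod R (Fin.init a) ⊗ₜ (a (Fin.last n) • m) := by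
  rw [actFace, TensorProduct.lift.tmul, PiTensorProduct.lift.tprod]
  rfl

theorem piTensor_tmul_induction {n : ℕ} {p : (⨂[R] _ : Fin n, A) ⊗[R] M → Prop}
    (tmul : ∀ f m, p (PiTensorProduct.tprod R f ⊗ₜ m)) (add : ∀ x y, p x → p y → p (x + y))
    (x : (⨂[R] _ : Fin n, A) ⊗[R] M) : p x := by
  induction x using TensorProduct.induction_on with
  | zero => simpa using tmul 0 0
  | add x y hx hy => exact add _ _ hx hy
  | tmul x m =>
    induction x using piTensor_induction with
    | smul_tprod r f =>
      rw [TensorProduct.smul_tmul]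
      exact tmul _ _
    | add x y hx hy => rw [TensorProduct.add_tmul]; exact add _ _ hx hy

variable (R A M) in
/-- Splitting off the first factor of `A^{⊗ (n + 1)} ⊗ M`. -/
def consTensorMod (n : ℕ) : A ⊗[R] ((⨂[R] _ : Fin n, A) ⊗[R] M) ≃ₗ[R]
    (⨂[R] _ : Fin (n + 1), A) ⊗[R] M :=
  (TensorProduct.assoc R A (⨂[R] _ : Fin n, A) M).symm ≪≫ₗ
    TensorProduct.congr (consTensor R A n) (LinearEquiv.refl R M)

@[simp]
theorem consTensorMod_tmul (n : ℕ) (a : A) (x : ⨂[R] _ : Fin n, A) (m : M) :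
    consTensorMod R A M n (a ⊗ₜ (x ⊗ₜ m)) = consTensor R A n (a ⊗ₜ x) ⊗ₜ m := rfl

/-- The bar complex of a module. -/
def modBarModel : BarModel R A M (fun n => (⨂[R] _ : Fin n, A) ⊗[R] M) where
  base := (TensorProduct.lid R M).symm ≪≫ₗ
    TensorProduct.congr (PiTensorProduct.isEmptyEquiv (Fin 0)).symm (LinearEquiv.refl R M)
  cons n := consTensorMod R A M n
  d n := barModD R A M n
  d_base a m := by
    have h : ∀ m : M, ((TensorProduct.lid R M).symm ≪≫ₗ TensorProduct.congr
        (PiTensorProduct.isEmptyEquiv (R := R) (s := fun _ => A) (Fin 0)).symm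
          (LinearEquiv.refl R M)) m = PiTensorProduct.tprod R Fin.elim0 ⊗ₜ m := by
      intro m
      rw [LinearEquiv.trans_apply, TensorProduct.lid_symm_apply, TensorProduct.congr_tmul,
        LinearEquiv.refl_apply]
      congr 1
      rw [LinearEquiv.symm_apply_eq, PiTensorProduct.isEmptyEquiv_apply_tprod]
    have h0 : barD R A 0 = 0 := by simp [barD]
    rw [h, h, consTensorMod_tmul, consTensor_tprod, barModD, h0, LinearMap.rTensor_zero,
      LinearMap.add_apply, LinearMap.zero_apply, linearMap_zsmul_apply, pow_zero, one_smul,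
      actFace_tmul, zero_add]
    congr 2
    exact Subsingleton.elim _ _
  d_cons n a b x := by
    induction x using piTensor_tmul_induction with
    | add x y hx hy =>
      simp only [TensorProduct.tmul_add, map_add, hx, hy]
      abel
    | tmul f m =>
      have hact : ∀ (n : ℕ) (a : A) (g : Fin (n + 1) → A), actFace R A M (n + 1)
          (PiTensorProduct.tprod R (Fin.cons a g : Fin (n + 2) → A) ⊗ₜ m) =
            consTensorMod R A M n (a ⊗ₜ actFace R A M n (PiTensorProduct.tprod R g ⊗ₜ m)) := by
        intro n a g
        rw [actFace_tmul, actFace_tmul, consTensorMod_tmul, consTensor_tprod]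
        congr 2
        funext i
        cases i using Fin.cases with
        | zero => rfl
        | succ i => rfl
      simp only [consTensorMod_tmul, consTensor_tprod, barModD, LinearMap.add_apply,
        linearMap_zsmul_apply, LinearMap.rTensor_tmul, hact n]
      rw [barD_cons, TensorProduct.sub_tmul, TensorProduct.tmul_add, map_add, consTensorMod_tmul]
      have e : ∀ x, consTensorMod R A M n (a ⊗ₜ ((-1 : ℤ) ^ n • x)) =
          (-1 : ℤ) ^ n • consTensorMod R A M n (a ⊗ₜ x) := fun x =>
        map_zsmul ((consTensorMod R A M n).toLinearMap ∘ₗ TensorProduct.mk R _ _ a) _ _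
      rw [e, pow_succ, mul_neg, mul_one, neg_smul]
      simp only [Fin.cons_zero, Fin.tail_cons]
      abel

theorem modBarModel_base (m : M) : (modBarModel (R := R) (A := A) (M := M)).base m =
    PiTensorProduct.tprod R Fin.elim0 ⊗ₜ m := by
  show ((TensorProduct.lid R M).symm ≪≫ₗ TensorProduct.congr
    (PiTensorProduct.isEmptyEquiv (R := R) (s := fun _ => A) (Fin 0)).symm
      (LinearEquiv.refl R M)) m = _
  rw [LinearEquiv.trans_apply, TensorProduct.lid_symm_apply, TensorProduct.congr_tmul,
    LinearEquiv.refl_apply]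
  congr 1
  rw [LinearEquiv.symm_apply_eq, PiTensorProduct.isEmptyEquiv_apply_tprod]

end Concrete

theorem box_span_le {R : Type*} [CommRing R] {W₁ W₂ : Type*} [AddCommGroup W₁] [Module R W₁]
    [AddCommGroup W₂] [Module R W₂] {P : Submodule R W₁} {s : Set W₂}
    {X : Submodule R (W₁ ⊗[R] W₂)} :
    box P (Submodule.span R s) ≤ X ↔ ∀ x ∈ P, ∀ y ∈ s, x ⊗ₜ y ∈ X := by
  rw [box_le]
  refine forall₂_congr fun x _ => ?_
  exact Submodule.span_le (p := X.comap (TensorProduct.mk R W₁ W₂ x))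

/-! ### The strands and the refinement complexes of a module -/

section ModuleStrands

variable {R : Type u} [CommRing R] {A : Type v} [Ring A] [Algebra R A]
  (𝒜 : ℕ → Submodule R A) {M : Type w} [AddCommGroup M] [Module R M] [Module A M]
  [IsScalarTower R A M] (ℳ : ℤ → Submodule R M) (t : ℤ)

local notation "S" => (modBarModel (R := R) (A := A) (M := M))

theorem modBarModel_cons_tprod (n : ℕ) (a : A) (f : Fin n → A) (m : M) :
    (S).cons n (a ⊗ₜ (PiTensorProduct.tprod R f ⊗ₜ m)) =
      PiTensorProduct.tprod R (Fin.cons a f : Fin (n + 1) → A) ⊗ₜ m := by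
  show consTensorMod R A M n _ = _
  rw [consTensorMod_tmul, consTensor_tprod]

theorem tensorModPiece_singleton (a : ℕ) : tensorModPiece 𝒜 ℳ t [a] 0 =
    (ℳ (t + a)).map (S).base.toLinearMap := by
  apply le_antisymm
  · refine Submodule.span_le.2 ?_
    rintro _ ⟨f, y, -, hy, rfl⟩
    exact ⟨y, hy, by rw [Subsingleton.elim f Fin.elim0]; exact modBarModel_base y⟩
  · rintro _ ⟨y, hy, rfl⟩
    exact Submodule.subset_span ⟨Fin.elim0, y, fun i => i.elim0, hy, modBarModel_base y⟩

theorem tensorModPiece_cons (a : ℕ) (β : List ℕ) (n : ℕ) :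
    tensorModPiece 𝒜 ℳ t (a :: β) (n + 1) =
      (box (𝒜 a) (tensorModPiece 𝒜 ℳ t β n)).map ((S).cons n).toLinearMap := by
  apply le_antisymm
  · refine Submodule.span_le.2 ?_
    rintro _ ⟨f, y, hf, hy, rfl⟩
    refine ⟨f 0 ⊗ₜ (PiTensorProduct.tprod R (Fin.tail f) ⊗ₜ y), tmul_mem_box (hf 0)
      (Submodule.subset_span ⟨_, y, fun i => hf i.succ, hy, rfl⟩), ?_⟩
    exact (modBarModel_cons_tprod _ _ _ _).trans (by rw [Fin.cons_self_tail])
  · rw [Submodule.map_le_iff_le_comap, tensorModPiece, box_span_le]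
    rintro x hx _ ⟨f, y, hf, hy, rfl⟩
    refine Submodule.subset_span ⟨Fin.cons x f, y, fun i => ?_, hy, modBarModel_cons_tprod _ _ _ _⟩
    cases i using Fin.cases with
    | zero => exact hx
    | succ i => exact hf i

theorem refModCochain_eq_refine (l : List ℕ) (a n : ℕ) : refModCochain 𝒜 ℳ t (a :: l) n =
    (S).refine 𝒜 (fun n => ℳ (t + n)) l a n :=
  BarModel.iSup_coarsening_eq_refine S (fun β n => tensorModPiece 𝒜 ℳ t β n)
    (tensorModPiece_singleton 𝒜 ℳ t) (tensorModPiece_cons 𝒜 ℳ t) l a n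

theorem refModCochainExact_iff (l : List ℕ) (a : ℕ) : RefModCochainExact 𝒜 ℳ t (a :: l) ↔
    (S).RefineExact 𝒜 (fun n => ℳ (t + n)) l a := by
  have h : refModCochain 𝒜 ℳ t (a :: l) = (S).refine 𝒜 (fun n => ℳ (t + n)) l a :=
    funext (refModCochain_eq_refine 𝒜 ℳ t l a)
  simp only [RefModCochainExact, subsingleton_homology_iff, h, List.length_cons,
    Nat.add_lt_add_iff_right]
  rfl

theorem barModStrand_zero (j : ℕ) : barModStrand 𝒜 ℳ (t + j) 0 =
    (ℳ (t + j)).map (S).base.toLinearMap := by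
  apply le_antisymm
  · refine Submodule.span_le.2 ?_
    rintro _ ⟨b, s, f, y, -, hs, -, hy, rfl⟩
    simp only [Finset.univ_eq_empty, Finset.sum_empty, zero_add] at hs
    exact ⟨y, hs ▸ hy, by rw [Subsingleton.elim f Fin.elim0]; exact modBarModel_base y⟩
  · rintro _ ⟨y, hy, rfl⟩
    exact Submodule.subset_span ⟨Fin.elim0, t + j, Fin.elim0, y, fun i => i.elim0, by simp,
      fun i => i.elim0, hy, modBarModel_base y⟩

variable {t} in
theorem barModStrand_succ (hbot : ∀ j < t, ℳ j = ⊥) (j n : ℕ) :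
    barModStrand 𝒜 ℳ (t + j) (n + 1) = (Finset.range j).sup fun c =>
      (box (𝒜 (c + 1)) (barModStrand 𝒜 ℳ (t + (j - 1 - c : ℕ)) n)).map
        ((S).cons n).toLinearMap := by
  apply le_antisymm
  · refine Submodule.span_le.2 ?_
    rintro _ ⟨b, s, f, y, hb, hs, hf, hy, rfl⟩
    rcases lt_or_ge s t with h | h
    · rw [hbot s h, Submodule.mem_bot] at hy
      rw [hy, TensorProduct.tmul_zero]
      exact zero_mem _
    · rw [Fin.sum_univ_succ] at hs
      have h0 := hb 0
      have h1 : (0 : ℤ) ≤ ∑ i : Fin n, (b i.succ : ℤ) := Finset.sum_nonneg fun i _ => by positivity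
      have hle : b 0 - 1 < j := by omega
      refine Finset.le_sup (f := fun c => (box (𝒜 (c + 1)) (barModStrand 𝒜 ℳ
        (t + (j - 1 - c : ℕ)) n)).map ((S).cons n).toLinearMap) (Finset.mem_range.2 hle) ?_
      refine ⟨f 0 ⊗ₜ (PiTensorProduct.tprod R (Fin.tail f) ⊗ₜ y), tmul_mem_box ?_
        (Submodule.subset_span ⟨fun i => b i.succ, s, _, y, fun i => hb i.succ, ?_,
          fun i => hf i.succ, hy, rfl⟩), ?_⟩
      · rw [Nat.sub_add_cancel h0]
        exact hf 0
      · beta_reduce; omega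
      · exact (modBarModel_cons_tprod _ _ _ _).trans (by rw [Fin.cons_self_tail])
  · refine Finset.sup_le fun c hc => ?_
    rw [Finset.mem_range] at hc
    rw [Submodule.map_le_iff_le_comap, barModStrand, box_span_le]
    rintro x hx _ ⟨b, s, f, y, hb, hs, hf, hy, rfl⟩
    refine Submodule.subset_span ⟨Fin.cons (c + 1) b, s, Fin.cons x f, y, fun i => ?_, ?_,
      fun i => ?_, hy, modBarModel_cons_tprod _ _ _ _⟩
    · cases i using Fin.cases with
      | zero => simp
      | succ i => exact hb i
    · rw [Fin.sum_univ_succ]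
      simp only [Fin.cons_zero, Fin.cons_succ]
      omega
    · cases i using Fin.cases with
      | zero => exact hx
      | succ i => exact hf i

variable {t} in
/-- Koszulness of a module is exactness of the refinement complexes of `(1, …, 1, 0)`. -/
theorem isKoszulModule_iff (hbot : ∀ j < t, ℳ j = ⊥) : IsKoszulModule 𝒜 ℳ t ↔
    ∀ k, (S).RefineExact 𝒜 (fun n => ℳ (t + n)) (onesZero k) 1 := by
  have h : ∀ k, barModStrand 𝒜 ℳ (t + (k + 1 : ℕ)) =
      (S).refine 𝒜 (fun n => ℳ (t + n)) (onesZero k) 1 := fun k => funext fun n =>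
    BarModel.strand_eq_refine S (fun j => barModStrand 𝒜 ℳ (t + j)) (barModStrand_zero 𝒜 ℳ t)
      (barModStrand_succ 𝒜 ℳ hbot) n k
  have hlen : ∀ k, (onesZero k).length = k + 1 := fun k => by simp
  constructor
  · intro hK k n hn
    rw [hlen] at hn
    have := hK n (k + 1) hn
    rw [subsingleton_homology_iff, h] at this
    exact this
  · intro hK i j hij
    obtain ⟨k, rfl⟩ : ∃ k, j = k + 1 := ⟨j - 1, by omega⟩
    rw [subsingleton_homology_iff, h]
    exact hK k i (by rwa [hlen])

end ModuleStrands

/-! ### The strands and the refinement complexes of an algebra -/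

section AlgebraStrands

variable {R : Type u} [CommRing R] {A : Type v} [Ring A] [Algebra R A]
  (𝒜 : ℕ → Submodule R A)

local notation "S" => (algBarModel (R := R) (A := A))

theorem algBarModel_base (x : A) : (S).base x = PiTensorProduct.tprod R fun _ => x :=
  PiTensorProduct.subsingletonEquiv_symm_apply' _ _

theorem algBarModel_cons_tprod (n : ℕ) (a : A) (f : Fin (n + 1) → A) :
    (S).cons n (a ⊗ₜ PiTensorProduct.tprod R f) =
      PiTensorProduct.tprod R (Fin.cons a f : Fin (n + 2) → A) := consTensor_tprod (R := R) _ a f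

theorem tensorPiece_singleton (a : ℕ) : tensorPiece 𝒜 [a] 1 =
    (𝒜 a).map (S).base.toLinearMap := by
  apply le_antisymm
  · refine Submodule.span_le.2 ?_
    rintro _ ⟨f, hf, rfl⟩
    refine ⟨f 0, hf 0, (algBarModel_base _).trans ?_⟩
    congr 1
    funext i
    fin_cases i
    rfl
  · rintro _ ⟨y, hy, rfl⟩
    refine Submodule.subset_span ⟨fun _ => y, fun i => ?_, algBarModel_base y⟩
    fin_cases i
    exact hy

theorem tensorPiece_cons (a : ℕ) (β : List ℕ) (n : ℕ) : tensorPiece 𝒜 (a :: β) (n + 2) =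
    (box (𝒜 a) (tensorPiece 𝒜 β (n + 1))).map ((S).cons n).toLinearMap := by
  apply le_antisymm
  · refine Submodule.span_le.2 ?_
    rintro _ ⟨f, hf, rfl⟩
    refine ⟨f 0 ⊗ₜ PiTensorProduct.tprod R (Fin.tail f), tmul_mem_box (hf 0)
      (Submodule.subset_span ⟨_, fun i => hf i.succ, rfl⟩), ?_⟩
    exact (algBarModel_cons_tprod _ _ _).trans (by rw [Fin.cons_self_tail])
  · rw [Submodule.map_le_iff_le_comap, tensorPiece, box_span_le]
    rintro x hx _ ⟨f, hf, rfl⟩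
    refine Submodule.subset_span ⟨Fin.cons x f, fun i => ?_, algBarModel_cons_tprod _ _ _⟩
    cases i using Fin.cases with
    | zero => exact hx
    | succ i => exact hf i

theorem refCochain_eq_refine (l : List ℕ) (a n : ℕ) : refCochain 𝒜 (a :: l) (n + 1) =
    (S).refine 𝒜 𝒜 l a n :=
  BarModel.iSup_coarsening_eq_refine S (fun β n => tensorPiece 𝒜 β (n + 1))
    (tensorPiece_singleton 𝒜) (tensorPiece_cons 𝒜) l a n

theorem barD_zero : barD R A 0 = 0 := by simp [barD]

/-- The bar complex of `A` starts in degree one: its differential from degree one to degree zero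
vanishes, so shifting by one does not change the cycles. -/
theorem cycles_barD (F : ∀ k, Submodule R (⨂[R] _ : Fin k, A)) (n : ℕ) :
    cycles (B := fun n => ⨂[R] _ : Fin n, A) (barD R A) F (n + 1) =
      cycles (B := fun n => ⨂[R] _ : Fin (n + 1), A) (fun n => barD R A (n + 1))
        (fun n => F (n + 1)) n := by
  cases n with
  | zero => simp [cycles, barD_zero]
  | succ n => rfl

theorem refCochainExact_of_refineExact {l : List ℕ} {a : ℕ} (h : (S).RefineExact 𝒜 𝒜 l a) :
    RefCochainExact 𝒜 (a :: l) := by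
  intro n hn
  rw [subsingleton_homology_iff]
  cases n with
  | zero =>
    refine le_trans (iSup₂_le fun β hβ => ?_) bot_le
    exact absurd (List.length_eq_zero_iff.1 hβ.2) (hβ.1.ne_nil (by simp))
  | succ n =>
    have e : (fun n => refCochain 𝒜 (a :: l) (n + 1)) = (S).refine 𝒜 𝒜 l a :=
      funext (refCochain_eq_refine 𝒜 l a)
    rw [cycles_barD, e, refCochain_eq_refine]
    exact h n (by simpa using hn)

theorem barStrand_one (j : ℕ) : barStrand 𝒜 (j + 1) 1 =
    (𝒜 (j + 1)).map (S).base.toLinearMap := by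
  apply le_antisymm
  · refine Submodule.span_le.2 ?_
    rintro _ ⟨b, f, -, hb, hf, rfl⟩
    simp only [Finset.univ_unique, Fin.default_eq_zero, Finset.sum_singleton] at hb
    refine ⟨f 0, hb ▸ hf 0, (algBarModel_base _).trans ?_⟩
    congr 1
    funext i
    fin_cases i
    rfl
  · rintro _ ⟨y, hy, rfl⟩
    exact Submodule.subset_span ⟨fun _ => j + 1, fun _ => y, fun _ => Nat.succ_pos j, by simp,
      fun _ => hy, algBarModel_base y⟩

theorem barStrand_add_two (j n : ℕ) : barStrand 𝒜 (j + 1) (n + 2) =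
    (Finset.range j).sup fun c =>
      (box (𝒜 (c + 1)) (barStrand 𝒜 (j - 1 - c + 1) (n + 1))).map ((S).cons n).toLinearMap := by
  apply le_antisymm
  · refine Submodule.span_le.2 ?_
    rintro _ ⟨b, f, hb, hs, hf, rfl⟩
    have h0 := hb 0
    have h1 : 0 < ∑ i : Fin (n + 1), b i.succ :=
      Finset.sum_pos (fun i _ => hb i.succ) Finset.univ_nonempty
    rw [Fin.sum_univ_succ] at hs
    have hle : b 0 - 1 < j := by omega
    refine Finset.le_sup (f := fun c => (box (𝒜 (c + 1)) (barStrand 𝒜 (j - 1 - c + 1) (n + 1))).map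
      ((S).cons n).toLinearMap) (Finset.mem_range.2 hle) ?_
    refine ⟨f 0 ⊗ₜ PiTensorProduct.tprod R (Fin.tail f), tmul_mem_box ?_
      (Submodule.subset_span ⟨fun i => b i.succ, _, fun i => hb i.succ, ?_,
        fun i => hf i.succ, rfl⟩), ?_⟩
    · rw [Nat.sub_add_cancel h0]
      exact hf 0
    · beta_reduce; omega
    · exact (algBarModel_cons_tprod _ _ _).trans (by rw [Fin.cons_self_tail])
  · refine Finset.sup_le fun c hc => ?_
    rw [Finset.mem_range] at hc
    rw [Submodule.map_le_iff_le_comap, barStrand, box_span_le]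
    rintro x hx _ ⟨b, f, hb, hs, hf, rfl⟩
    refine Submodule.subset_span ⟨Fin.cons (c + 1) b, Fin.cons x f, fun i => ?_, ?_,
      fun i => ?_, algBarModel_cons_tprod _ _ _⟩
    · cases i using Fin.cases with
      | zero => simp
      | succ i => exact hb i
    · rw [Fin.sum_univ_succ]
      simp only [Fin.cons_zero, Fin.cons_succ]
      omega
    · cases i using Fin.cases with
      | zero => exact hx
      | succ i => exact hf i

/-- Koszulness of the algebra is exactness of the refinement complexes of `(1, …, 1, 0)` for the
module `A_+`, whose part of degree `n` above its initial degree is `A_{n+1}`. -/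
theorem isKoszul_iff_refineExact : IsKoszul 𝒜 ↔
    ∀ k, (S).RefineExact 𝒜 (fun n => 𝒜 (n + 1)) (onesZero k) 1 := by
  have h : ∀ k n, barStrand 𝒜 (k + 2) (n + 1) =
      (S).refine 𝒜 (fun n => 𝒜 (n + 1)) (onesZero k) 1 n := fun k n =>
    BarModel.strand_eq_refine S (fun j n => barStrand 𝒜 (j + 1) (n + 1)) (barStrand_one 𝒜)
      (barStrand_add_two 𝒜) n k
  have e : ∀ k, (fun n => barStrand 𝒜 (k + 2) (n + 1)) =
      (S).refine 𝒜 (fun n => 𝒜 (n + 1)) (onesZero k) 1 := fun k => funext (h k)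
  have hlen : ∀ k, (onesZero k).length = k + 1 := fun k => by simp
  constructor
  · intro hK k n hn
    rw [hlen] at hn
    have := hK (n + 1) (k + 2) (by omega)
    rw [subsingleton_homology_iff, cycles_barD, e, h] at this
    exact this
  · intro hK i j hij
    rw [subsingleton_homology_iff]
    cases i with
    | zero =>
      refine le_trans (Submodule.span_le.2 ?_) bot_le
      rintro _ ⟨b, f, -, hb, -⟩
      simp only [Finset.univ_eq_empty, Finset.sum_empty] at hb
      omega
    | succ i =>
      obtain ⟨k, rfl⟩ : ∃ k, j = k + 2 := ⟨j - 2, by omega⟩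
      rw [cycles_barD, e, h]
      exact hK k i (by rw [hlen]; omega)

end AlgebraStrands

/-! ### Reversal of tensors -/

section AntiMap

variable {R : Type*} [CommRing R] {E : Type*} [AddCommGroup E] [Module R E] {E' : Type*}
  [AddCommGroup E'] [Module R E']

/-- The antihomomorphism of tensor algebras induced by a linear map:
`v_1 ⊗ ⋯ ⊗ v_n ↦ f v_n ⊗ ⋯ ⊗ f v_1`. -/
def antiMap (f : E →ₗ[R] E') : TensorAlgebra R E →ₗ[R] TensorAlgebra R E' :=
  (MulOpposite.opLinearEquiv R).symm.toLinearMap ∘ₗ (TensorAlgebra.lift R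
    ((MulOpposite.opLinearEquiv R).toLinearMap ∘ₗ TensorAlgebra.ι R ∘ₗ f)).toLinearMap

theorem antiMap_ι (f : E →ₗ[R] E') (v : E) :
    antiMap f (TensorAlgebra.ι R v) = TensorAlgebra.ι R (f v) := by
  simp [antiMap]

theorem antiMap_mul (f : E →ₗ[R] E') (x y : TensorAlgebra R E) :
    antiMap f (x * y) = antiMap f y * antiMap f x := by
  simp [antiMap]

theorem antiMap_algebraMap (f : E →ₗ[R] E') (r : R) :
    antiMap f (algebraMap R _ r) = algebraMap R _ r := by
  simp [antiMap]

theorem antiMap_antiMap (f : E →ₗ[R] E') (g : E' →ₗ[R] E) (h : ∀ v, g (f v) = v)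
    (x : TensorAlgebra R E) : antiMap g (antiMap f x) = x := by
  induction x using TensorAlgebra.induction with
  | algebraMap r => rw [antiMap_algebraMap, antiMap_algebraMap]
  | ι v => rw [antiMap_ι, antiMap_ι, h]
  | mul x y hx hy => rw [antiMap_mul, antiMap_mul, hx, hy]
  | add x y hx hy => rw [map_add, map_add, hx, hy]

theorem map_antiMap_mul (f : E →ₗ[R] E') (P Q : Submodule R (TensorAlgebra R E)) :
    (P * Q).map (antiMap f) = Q.map (antiMap f) * P.map (antiMap f) := by
  apply le_antisymm
  · rw [Submodule.map_le_iff_le_comap, Submodule.mul_le]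
    intro x hx y hy
    rw [Submodule.mem_comap, antiMap_mul]
    exact Submodule.mul_mem_mul (Submodule.mem_map_of_mem hy) (Submodule.mem_map_of_mem hx)
  · rw [Submodule.mul_le]
    rintro _ ⟨y, hy, rfl⟩ _ ⟨x, hx, rfl⟩
    rw [← antiMap_mul]
    exact Submodule.mem_map_of_mem (Submodule.mul_mem_mul hx hy)

theorem map_antiMap_pow (f : E →ₗ[R] E') (P : Submodule R (TensorAlgebra R E)) (n : ℕ) :
    (P ^ n).map (antiMap f) = P.map (antiMap f) ^ n := by
  induction n with
  | zero =>
    rw [pow_zero, pow_zero, Submodule.one_eq_range, Submodule.one_eq_range, ← LinearMap.range_comp]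
    congr 1
    ext
    exact antiMap_algebraMap f _
  | succ n ih => rw [pow_succ, map_antiMap_mul, ih, pow_succ']

/-- The last factor of a tensor can be split off. -/
theorem exists_split_last : ∃ D : TensorAlgebra R E →ₗ[R] TensorAlgebra R E ⊗[R] E,
    ∀ (x : TensorAlgebra R E) (v : E), D (x * TensorAlgebra.ι R v) = x ⊗ₜ v := by
  obtain ⟨D, hD⟩ := exists_split_first (R := R) (E := E)
  have hrev := antiMap_antiMap (R := R) (E := E) LinearMap.id LinearMap.id fun _ => rfl
  refine ⟨(TensorProduct.map (antiMap LinearMap.id) TensorAlgebra.ιInv) ∘ₗ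
    (TensorProduct.comm R _ _).toLinearMap ∘ₗ D ∘ₗ antiMap LinearMap.id, fun x v => ?_⟩
  have h : TensorAlgebra.ιInv (TensorAlgebra.ι R v) = v := TensorAlgebra.ι_leftInverse v
  rw [LinearMap.comp_apply, LinearMap.comp_apply, LinearMap.comp_apply, antiMap_mul, antiMap_ι, hD,
    LinearEquiv.coe_coe, TensorProduct.comm_tmul, TensorProduct.map_tmul, hrev, LinearMap.id_apply,
    h]

end AntiMap

/-! ### The algebra as a module over itself -/

section Regular

variable {R : Type u} [CommRing R] {A : Type v} [Ring A] [Algebra R A] (𝒜 : ℕ → Submodule R A)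

/-- The grading of the `A`-module `A`. Starting in degree one it is that of the module `A_+`. -/
def regGrading (j : ℤ) : Submodule R A := 𝒜 j.toNat

theorem regGrading_one_add (n : ℕ) : regGrading 𝒜 (1 + n) = 𝒜 (n + 1) := by
  rw [regGrading]; congr 1; omega

/-- The multiplication map `T(A_1) ⊗ A_1 → T(A_1)`, which identifies `A_1^{⊗ n} ⊗ A_1` with
`A_1^{⊗ (n + 1)}`. -/
def regMap : TM 𝒜 (regGrading 𝒜) 1 →ₗ[R] TA 𝒜 :=
  LinearMap.mul' R (TA 𝒜) ∘ₗ (TensorAlgebra.ι R : 𝒜 1 →ₗ[R] TA 𝒜).lTensor (TA 𝒜)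

theorem regMap_smul (x : TA 𝒜) (u : TM 𝒜 (regGrading 𝒜) 1) :
    regMap 𝒜 (x • u) = x * regMap 𝒜 u := by
  induction u using TensorProduct.induction_on with
  | zero => simp
  | add u v hu hv => rw [smul_add, map_add, hu, hv, map_add, mul_add]
  | tmul y v =>
    rw [TensorProduct.smul_tmul', smul_eq_mul]
    exact mul_assoc x y _

/-- Splitting off the last factor is a left inverse. -/
theorem regMap_injective : Function.Injective (regMap 𝒜) := by
  obtain ⟨D, hD⟩ := exists_split_last (R := R) (E := 𝒜 1)
  let D' : TA 𝒜 →ₗ[R] TM 𝒜 (regGrading 𝒜) 1 := D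
  refine Function.LeftInverse.injective (g := D') fun u => ?_
  induction u using TensorProduct.induction_on with
  | zero => simp
  | add u v hu hv => rw [map_add, map_add, hu, hv]
  | tmul y v => exact hD y v

theorem can_regMap (u : TM 𝒜 (regGrading 𝒜) 1) :
    can 𝒜 (regMap 𝒜 u) = canMod 𝒜 (regGrading 𝒜) 1 u := by
  induction u using TensorProduct.induction_on with
  | zero => simp
  | add u v hu hv => rw [map_add, map_add, hu, hv, map_add]
  | tmul y v =>
    refine (map_mul (can 𝒜) _ _).trans ?_
    exact congrArg (can 𝒜 y * ·) (can_ι 𝒜 v)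

theorem map_regMap_smul (P : Submodule R (TA 𝒜)) (X : Submodule R (TM 𝒜 (regGrading 𝒜) 1)) :
    (P • X).map (regMap 𝒜) = P * X.map (regMap 𝒜) := by
  apply le_antisymm
  · rw [Submodule.map_le_iff_le_comap, Submodule.smul_le]
    intro x hx y hy
    rw [Submodule.mem_comap, regMap_smul]
    exact Submodule.mul_mem_mul hx (Submodule.mem_map_of_mem hy)
  · rw [Submodule.mul_le]
    rintro x hx _ ⟨y, hy, rfl⟩
    rw [← regMap_smul]
    exact Submodule.mem_map_of_mem (Submodule.smul_mem_smul hx hy)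

theorem map_regMap_tens (P : Submodule R (TA 𝒜)) :
    (tens 𝒜 (regGrading 𝒜) 1 P).map (regMap 𝒜) = P * V 𝒜 := by
  apply le_antisymm
  · rw [Submodule.map_le_iff_le_comap, tens_le]
    intro x hx v
    exact Submodule.mul_mem_mul hx ⟨(show 𝒜 1 from v), rfl⟩
  · rw [Submodule.mul_le]
    rintro x hx _ ⟨v, rfl⟩
    exact ⟨x ⊗ₜ (show regGrading 𝒜 1 from v), tmul_mem_tens hx _, rfl⟩

theorem map_regMap_tmPow (n : ℕ) :
    (tmPow (𝒜 := 𝒜) (regGrading 𝒜) 1 n).map (regMap 𝒜) = V 𝒜 ^ (n + 1) := by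
  rw [map_regMap_tens, pow_succ]

theorem map_regMap_QMod (n : ℕ) :
    (QMod 𝒜 (regGrading 𝒜) 1 n).map (regMap 𝒜) = relAlg 𝒜 (n + 1) := by
  apply le_antisymm
  · rintro _ ⟨u, ⟨hu, h0⟩, rfl⟩
    refine ⟨?_, ?_⟩
    · rw [← map_regMap_tmPow]
      exact Submodule.mem_map_of_mem hu
    · exact (can_regMap 𝒜 u).trans h0
  · rintro x ⟨hx, h0⟩
    rw [← map_regMap_tmPow] at hx
    obtain ⟨u, hu, rfl⟩ := hx
    exact ⟨u, ⟨hu, (can_regMap 𝒜 u).symm.trans h0⟩, rfl⟩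

theorem map_regMap_SMod (n i : ℕ) (h : i < n) :
    (SMod 𝒜 (regGrading 𝒜) 1 n i).map (regMap 𝒜) = SAlg 𝒜 (n + 1) i := by
  rw [SMod]
  split_ifs with hi
  · rw [map_regMap_tens, ← SAlg_mul_pow 𝒜 n 1 i hi, pow_one]
  · obtain rfl : n = i + 1 := by omega
    have e : i + 1 + 1 - i - 2 = 0 := by omega
    rw [map_regMap_smul, map_regMap_QMod, SAlg, e, pow_zero, mul_one]
    rfl

theorem map_inf_finset_inf {W W' : Type*} [AddCommGroup W] [Module R W] [AddCommGroup W']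
    [Module R W'] {f : W →ₗ[R] W'} (hf : Function.Injective f) {ι : Type*} (F : Finset ι)
    (Y : Submodule R W) (N : ι → Submodule R W) :
    (Y ⊓ F.inf N).map f = Y.map f ⊓ F.inf fun i => (N i).map f := by
  classical
  induction F using Finset.induction_on with
  | empty => simp
  | insert a s ha ih =>
    rw [Finset.inf_insert, Finset.inf_insert, inf_left_comm, Submodule.map_inf f hf, ih,
      inf_left_comm]

theorem image_map_regMap_SMod (n : ℕ) :
    Submodule.map (regMap 𝒜) '' (SMod 𝒜 (regGrading 𝒜) 1 n '' Finset.range n) =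
      SAlg 𝒜 (n + 1) '' Finset.range (n + 1 - 1) := by
  rw [Set.image_image, Nat.add_sub_cancel]
  exact Set.image_congr fun i hi => map_regMap_SMod 𝒜 n i (by simpa using hi)

/-- The collections of the module `A_+` are those of `A`, one degree up. -/
theorem isDistribSet_SMod_regGrading (n : ℕ) :
    IsDistribSet (SMod 𝒜 (regGrading 𝒜) 1 n '' Finset.range n) ↔
      IsDistribSet (SAlg 𝒜 (n + 1) '' Finset.range (n + 1 - 1)) := by
  rw [← image_map_regMap_SMod, isDistribSet_map (regMap_injective 𝒜)]

variable {𝒜} [GradedAlgebra 𝒜] (hquad : IsQuadratic 𝒜) (hflat : ∀ n, Module.Flat R (𝒜 n))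

omit [GradedAlgebra 𝒜] in
theorem flat_regGrading (hflat : ∀ n, Module.Flat R (𝒜 n)) (j : ℤ) :
    Module.Flat R (regGrading 𝒜 j) := hflat _

theorem smul_mem_regGrading (i j : ℕ) (a x : A) (ha : a ∈ 𝒜 i) (hx : x ∈ regGrading 𝒜 (1 + j)) :
    a • x ∈ regGrading 𝒜 (1 + (i + j : ℕ)) := by
  rw [regGrading_one_add] at hx ⊢
  rw [add_assoc]
  exact SetLike.mul_mem_graded ha hx

include hquad

theorem map_canMod_regGrading (d : ℕ) :
    (tmPow (𝒜 := 𝒜) (regGrading 𝒜) 1 d).map (canMod 𝒜 (regGrading 𝒜) 1) =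
      regGrading 𝒜 (1 + d) := by
  have e : canMod 𝒜 (regGrading 𝒜) 1 = (can 𝒜).toLinearMap ∘ₗ regMap 𝒜 :=
    LinearMap.ext fun u => (can_regMap 𝒜 u).symm
  rw [e, Submodule.map_comp, map_regMap_tmPow, map_can_pow hquad, regGrading_one_add]

theorem QMod_regGrading (d : ℕ) : QMod 𝒜 (regGrading 𝒜) 1 d =
    (Finset.range d).sup (SMod 𝒜 (regGrading 𝒜) 1 d) := by
  apply Submodule.map_injective_of_injective (regMap_injective 𝒜)
  rw [map_regMap_QMod, relAlg_eq hquad, Finset.sup_eq_iSup, Finset.sup_eq_iSup, Nat.add_sub_cancel]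
  simp only [Submodule.map_iSup]
  refine biSup_congr fun i hi => ?_
  rw [map_regMap_SMod 𝒜 d i (Finset.mem_range.1 hi)]

include hflat

/-- A quadratic algebra with flat components is Koszul if and only if its collections are
distributive: the assertion for modules applied to `A_+`, whose collection of degree `n` is that of
`A` in degree `n + 1`. The induction on the degree provides both the collections of `A` and those
of the module in smaller degrees. -/
theorem isKoszul_iff_isDistribSet : IsKoszul 𝒜 ↔
    ∀ n, IsDistribSet (SAlg 𝒜 n '' Finset.range (n - 1)) := by
  have e : (fun n => 𝒜 (n + 1)) = fun n : ℕ => regGrading 𝒜 (1 + n) :=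
    funext fun n => (regGrading_one_add 𝒜 n).symm
  rw [isKoszul_iff_refineExact, e]
  constructor
  · intro hbar n
    induction n using Nat.strong_induction_on with
    | _ n ih =>
      cases n with
      | zero => simpa using IsDistribSet.empty
      | succ n =>
        rw [← isDistribSet_SMod_regGrading]
        refine isDistribSet_SMod_of_bar (algBarModel (R := R) (A := A)) hquad hflat
          smul_mem_regGrading (fun d => flat_regGrading hflat _) n (fun k hk => ih k (by omega))
          (fun m hm => (isDistribSet_SMod_regGrading 𝒜 m).2 (ih (m + 1) (by omega))) hbar
  · intro hd k
    exact refineExact_of_isDistribSet _ hquad hflat (map_canMod_regGrading hquad)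
      (QMod_regGrading hquad) smul_mem_regGrading
      (fun n => (isDistribSet_SMod_regGrading 𝒜 n).2 (hd _)) _ _ (posParts_onesZero k one_pos)

end Regular

/-- Besides the members of the collection indexed by the cube, any intersection of a fixed finite
subfamily may be imposed on all terms. -/
theorem IsDistribSet.cubeChainExact {R : Type u} [CommRing R] {W : Type v} [AddCommGroup W]
    [Module R W] {X : Set (Submodule R W)} (hX : IsDistribSet X) {Q : Submodule R W}
    (hQ : ∀ x ∈ X, x ≤ Q) {κ : Type*} {F : Finset κ} {N' : κ → Submodule R W}
    (hN' : ∀ i ∈ F, N' i ∈ X) {m : ℕ} {N : Fin m → Submodule R W} (hN : ∀ j, N j ∈ X) :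
    CubeChainExact (fun J => Q ⊓ F.inf N' ⊓ J.inf N) ∅ := by
  obtain ⟨E, hE, hXE, hb, ht⟩ := (hX.insert_of_ge hQ).exists_bounded
  have h := cubeChEx_of_isDistribSet hE hb (isConeSign_sgn (∅ : Finset (Fin m)))
    (fun j _ => hXE (Or.inr (hN j))) (E.inf_mem (hXE (Or.inl rfl))
      (Sublattice.finset_inf_mem ht (f := N') F fun i hi => hXE (Or.inr (hN' i hi))))
  refine cubeChainExact_of_cubeChEx ?_
  simpa only [Finset.empty_union] using h

/-! ### Blocks and cuts of coarsenings -/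

/-- The places inside the blocks of a composition. -/
def innerSet : List ℕ → Finset ℕ
  | [] => ∅
  | a :: l => inner l a

/-- All parts of a composition except possibly the last are positive. -/
def InitPos : List ℕ → Prop
  | [] => True
  | a :: l => PosParts l a

/-- The places between neighbouring blocks of a composition, from left to right. -/
def cutList : List ℕ → List ℕ
  | a :: b :: l => (a - 1) :: (cutList (b :: l)).map (a + ·)
  | _ => []

theorem innerSet_cons (a : ℕ) {β : List ℕ} (h : β ≠ []) :
    innerSet (a :: β) = Finset.range (a - 1) ∪ (innerSet β).image (a + ·) := by
  obtain ⟨b, l, rfl⟩ := List.exists_cons_of_ne_nil h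
  rfl

theorem initPos_cons {a : ℕ} {β : List ℕ} (h : β ≠ []) :
    InitPos (a :: β) ↔ 0 < a ∧ InitPos β := by
  obtain ⟨b, l, rfl⟩ := List.exists_cons_of_ne_nil h
  rfl

theorem length_cutList (α : List ℕ) : (cutList α).length = α.length - 1 := by
  induction α with
  | nil => rfl
  | cons a l ih =>
    cases l with
    | nil => rfl
    | cons b l => rw [cutList, List.length_cons, List.length_map, ih]; rfl

theorem cutList_add (l : List ℕ) {a b : ℕ} (hb : PosParts l b) :
    cutList ((a + b) :: l) = (cutList (b :: l)).map (a + ·) := by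
  cases l with
  | nil => rfl
  | cons c l =>
    have h : a + b - 1 = a + (b - 1) := by have := hb.1; omega
    simp [cutList, h, add_assoc]

theorem merge_ne_nil (e : List Bool) {α : List ℕ} (h : α ≠ []) : merge e α ≠ [] := by
  fun_induction merge e α with
  | case1 e a b l ih => exact ih (by simp)
  | case2 e a b l ih => simp
  | case3 => exact h

theorem sum_merge (e : List Bool) (α : List ℕ) : (merge e α).sum = α.sum := by
  fun_induction merge e α with
  | case1 e a b l ih => simp [ih, add_assoc]
  | case2 e a b l ih => simp [ih]
  | case3 => rfl

/-- Near-concatenation turns cuts into inner places. -/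
theorem mem_innerSet_merge (e : List Bool) {α : List ℕ} (h : InitPos α) :
    ∀ x, x ∈ innerSet (merge e α) ↔ x ∈ innerSet α ∨ (true, x) ∈ e.zip (cutList α) := by
  fun_induction merge e α with
  | case1 e a b l ih =>
    intro x
    rw [ih (PosParts.add a h.2), cutList, List.zip_cons_cons, List.mem_cons, cutList_add l h.2]
    show x ∈ inner l (a + b) ∨ _ ↔ x ∈ inner (b :: l) a ∨ _
    rw [inner_add l h.1 h.2, Finset.mem_insert, Prod.mk.injEq]
    tauto
  | case2 e a b l ih =>
    intro x
    rw [innerSet_cons a (merge_ne_nil e (by simp)), cutList, List.zip_cons_cons, List.mem_cons,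
      innerSet_cons a (by simp), Finset.mem_union, Finset.mem_union, Finset.mem_image,
      Finset.mem_image, List.zip_map_right, List.mem_map, or_assoc]
    refine or_congr Iff.rfl ?_
    simp only [ih h.2, Prod.mk.injEq, Bool.true_eq_false, false_and, false_or, or_and_right,
      exists_or, Prod.exists, Prod.map_apply, id_eq]
    refine or_congr Iff.rfl ⟨?_, ?_⟩
    · rintro ⟨y, hy, rfl⟩
      exact ⟨true, y, hy, rfl, rfl⟩
    · rintro ⟨c, y, hy, rfl, rfl⟩
      exact ⟨y, hy, rfl⟩
  | case3 e l h1 h2 =>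
    have : e.zip (cutList l) = [] := by
      match e, l with
      | [], _ => rfl
      | _, [] => simp [cutList]
      | _, [a] => simp [cutList]
      | true :: e, a :: b :: l => exact absurd rfl (h1 e a b l rfl)
      | false :: e, a :: b :: l => exact absurd rfl (h2 e a b l rfl)
    simp [this]

theorem innerSet_merge_ofFn {α : List ℕ} (h : InitPos α) {m : ℕ} (hm : m = α.length - 1)
    (J : Finset (Fin m)) : innerSet (merge (List.ofFn fun i => decide (i ∈ J)) α) =
      innerSet α ∪ J.image fun j : Fin m => (cutList α).getD j 0 := by
  ext x
  rw [mem_innerSet_merge _ h, Finset.mem_union, Finset.mem_image]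
  refine or_congr Iff.rfl ?_
  have hl := length_cutList α
  rw [List.mem_iff_getElem]
  constructor
  · rintro ⟨i, hi, hx⟩
    simp only [List.length_zip, List.length_ofFn, lt_inf_iff] at hi
    simp only [List.getElem_zip, List.getElem_ofFn, Prod.mk.injEq, decide_eq_true_eq] at hx
    exact ⟨⟨i, hi.1⟩, hx.1, by rw [← hx.2]; exact List.getD_eq_getElem _ _ hi.2⟩
  · rintro ⟨j, hj, rfl⟩
    have hj' : (j : ℕ) < (cutList α).length := by omega
    refine ⟨j, by simp [hj'], ?_⟩
    simp only [List.getElem_zip, List.getElem_ofFn, Prod.mk.injEq, decide_eq_true_eq]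
    exact ⟨hj, (List.getD_eq_getElem _ _ hj').symm⟩

theorem lt_of_mem_innerSet {α : List ℕ} {q : ℕ} (h : q ∈ innerSet α) : q < α.sum := by
  cases α with
  | nil => simp [innerSet] at h
  | cons a l => exact lt_of_mem_inner h

theorem cutList_getD_lt {α : List ℕ} (h : InitPos α) {i : ℕ} (hi : i < α.length - 1) :
    (cutList α).getD i 0 < α.sum := by
  have h1 := innerSet_merge_ofFn h rfl (Finset.univ : Finset (Fin (α.length - 1)))
  have h2 : (cutList α).getD i 0 ∈
      innerSet (merge (List.ofFn fun i : Fin (α.length - 1) => decide (i ∈ Finset.univ)) α) := by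
    rw [h1]
    exact Finset.mem_union_right _ (Finset.mem_image.2 ⟨⟨i, hi⟩, Finset.mem_univ _, rfl⟩)
  have h3 := lt_of_mem_innerSet h2
  rwa [sum_merge] at h3

/-! ### The refinement chain complexes of a module -/

section Chain

variable {R : Type u} [CommRing R] {A : Type v} [Ring A] [Algebra R A] {𝒜 : ℕ → Submodule R A}
  {M : Type w} [AddCommGroup M] [Module R M] [Module A M] [IsScalarTower R A M]
  {ℳ : ℤ → Submodule R M} {t : ℤ}

theorem coAlg_eq (n : ℕ) : coAlg 𝒜 n = V 𝒜 ^ n ⊓ (Finset.range (n - 1)).inf (SAlg 𝒜 n) := by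
  rw [coAlg, iInf_fin_eq_inf]

theorem coMod_eq (n : ℕ) :
    coMod 𝒜 ℳ t n = tmPow ℳ t n ⊓ (Finset.range n).inf (SMod 𝒜 ℳ t n) := by
  rw [coMod, iInf_fin_eq_inf]

variable [GradedAlgebra 𝒜] (hquad : IsQuadratic 𝒜) (hflat : ∀ n, Module.Flat R (𝒜 n))
  (hgen : ∀ d : ℕ, (tmPow (𝒜 := 𝒜) ℳ t d).map (canMod 𝒜 ℳ t) = ℳ (t + d))
  (hrel : ∀ d : ℕ, QMod 𝒜 ℳ t d = (Finset.range d).sup (SMod 𝒜 ℳ t d))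
  (hflatM : ∀ d : ℕ, Module.Flat R (ℳ (t + d)))
  (hd : ∀ n, IsDistribSet (SMod 𝒜 ℳ t n '' Finset.range n))

include hquad hflat hgen hrel hflatM

theorem flatQuot_bot_tmPow (n : ℕ) : FlatQuot ⊥ (tmPow (𝒜 := 𝒜) ℳ t n) := by
  have h := flatQuot_sup_SMod hquad hflat hgen hrel hflatM n (Finset.empty_subset _)
  rwa [Finset.sup_empty] at h

theorem flat_tmPow (n : ℕ) : Module.Flat R ↥(tmPow (𝒜 := 𝒜) ℳ t n) := by
  have := flatQuot_bot_tmPow hquad hflat hgen hrel hflatM n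
  have h : (⊥ : Submodule R (TM 𝒜 ℳ t)).submoduleOf (tmPow ℳ t n) = ⊥ := Submodule.ker_subtype _
  have e := Submodule.quotEquivOfEqBot (R := R) (M := ↥(tmPow (𝒜 := 𝒜) ℳ t n)) _ h
  exact Module.Flat.of_linearEquiv e.symm

include hd

theorem flatQuot_inf_SMod (n : ℕ) {F : Finset ℕ} (hF : F ⊆ Finset.range n) :
    FlatQuot (tmPow ℳ t n ⊓ F.inf (SMod 𝒜 ℳ t n)) (tmPow ℳ t n) := by
  have h := flatQuot_finset_inf (hd n) (fun q hq => SMod_le n q (Finset.mem_range.1 hq))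
    (fun Z hZ => flatQuot_sup_SMod hquad hflat hgen hrel hflatM n hZ) hF ∅ (Finset.empty_subset _)
  simpa using h

theorem flatQuot_inf_inner (l : List ℕ) (a : ℕ) :
    FlatQuot (tmPow ℳ t (a + l.sum) ⊓ (inner l a).inf (SMod 𝒜 ℳ t (a + l.sum)))
      (tmPow ℳ t (a + l.sum)) :=
  flatQuot_inf_SMod hquad hflat hgen hrel hflatM hd _ fun _ hq =>
    Finset.mem_range.2 (lt_of_mem_inner hq)

/-- The terms of the refinement chain complexes are intersections of the submodules
`S_{A,M,i}`. -/
theorem coModTerm_eq (l : List ℕ) (a : ℕ) : coModTerm 𝒜 ℳ t (a :: l) =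
    tmPow ℳ t (a + l.sum) ⊓ (inner l a).inf (SMod 𝒜 ℳ t (a + l.sum)) := by
  induction l generalizing a with
  | nil => rw [coModTerm, coMod_eq, inner, List.sum_nil, add_zero]
  | cons b l ih =>
    have hinj := actMap_V_pow_injective ℳ t (hflat 1) a (tmPow ℳ t (b + l.sum))
    have := flatQuot_bot_tmPow hquad hflat hgen hrel hflatM (b + l.sum)
    have := flatQuot_inf_inner hquad hflat hgen hrel hflatM hd l b
    have hV := flat_V_pow (𝒜 := 𝒜) (hflat 1) a
    have hlt : ∀ i ∈ Finset.range (a - 1), i + 1 < a := fun i hi => by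
      rw [Finset.mem_range] at hi; omega
    have e1 : (Finset.range (a - 1)).inf (SMod 𝒜 ℳ t (a + (b + l.sum))) =
        (Finset.range (a - 1)).inf fun i => SAlg 𝒜 a i • tmPow ℳ t (b + l.sum) :=
      Finset.inf_congr rfl fun i hi => (SAlg_smul_tmPow a _ i (hlt i hi)).symm
    have e2 : ((inner l b).image (a + ·)).inf (SMod 𝒜 ℳ t (a + (b + l.sum))) =
        (inner l b).inf fun q => V 𝒜 ^ a • SMod 𝒜 ℳ t (b + l.sum) q := by
      rw [Finset.inf_image]
      exact Finset.inf_congr rfl fun q hq => (pow_smul_SMod a _ q (lt_of_mem_inner hq)).symm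
    rw [coModTerm, ih, inner, Finset.inf_union, List.sum_cons, e1, e2, ← pow_smul_tmPow a, coAlg_eq]
    apply le_antisymm
    · refine le_inf (Submodule.smul_mono inf_le_left inf_le_left)
        (le_inf (Finset.le_inf fun i hi => Submodule.smul_mono
          (inf_le_right.trans (Finset.inf_le hi)) inf_le_left) (Finset.le_inf fun q hq =>
            Submodule.smul_mono inf_le_left (inf_le_right.trans (Finset.inf_le hq))))
    · have h1 := finset_inf_smul_sup_le hinj (Finset.range (a - 1)) (P := SAlg 𝒜 a)
        (fun i hi => SAlg_le 𝒜 a i (hlt i hi)) (Y := ⊥) bot_le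
      simp only [Submodule.smul_bot, sup_bot_eq] at h1
      have h2 := finset_inf_smul_le hinj (inner l b) (N := SMod 𝒜 ℳ t (b + l.sum))
        fun q hq => SMod_le _ _ (lt_of_mem_inner hq)
      exact le_trans (le_inf ((inf_le_inf_left _ inf_le_left).trans h1)
        ((inf_le_inf_left _ inf_le_right).trans h2)) (smul_inf_smul_le hinj inf_le_left inf_le_left)

/-- Merging blocks imposes the conditions at the cuts between them. -/
theorem coModTerm_merge {α : List ℕ} (hne : α ≠ []) (hp : InitPos α) {m : ℕ}
    (hm : m = α.length - 1) (J : Finset (Fin m)) :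
    coModTerm 𝒜 ℳ t (merge (List.ofFn fun i => decide (i ∈ J)) α) =
      tmPow ℳ t α.sum ⊓ (innerSet α).inf (SMod 𝒜 ℳ t α.sum) ⊓
        J.inf fun j => SMod 𝒜 ℳ t α.sum ((cutList α).getD j 0) := by
  have h1 := innerSet_merge_ofFn hp hm J
  have h2 := sum_merge (List.ofFn fun i => decide (i ∈ J)) α
  obtain ⟨b, l, e⟩ := List.exists_cons_of_ne_nil
    (merge_ne_nil (List.ofFn fun i => decide (i ∈ J)) hne)
  rw [e] at h1 h2 ⊢
  rw [coModTerm_eq hquad hflat hgen hrel hflatM hd, ← List.sum_cons, h2]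
  show _ ⊓ (innerSet (b :: l)).inf _ = _
  rw [h1, Finset.inf_union, Finset.inf_image, inf_assoc]
  rfl

theorem flat_coModTerm (l : List ℕ) (a : ℕ) : Module.Flat R (coModTerm 𝒜 ℳ t (a :: l)) := by
  rw [coModTerm_eq hquad hflat hgen hrel hflatM hd]
  have := flat_tmPow hquad hflat hgen hrel hflatM (a + l.sum)
  exact (flatQuot_inf_inner hquad hflat hgen hrel hflatM hd l a).flat inf_le_left

theorem smulMap_coModTerm_injective (a b : ℕ) (l : List ℕ) :
    Function.Injective (smulMap 𝒜 ℳ t (coAlg 𝒜 a) (coModTerm 𝒜 ℳ t (b :: l))) := by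
  have := flat_coModTerm hquad hflat hgen hrel hflatM hd l b
  have hle : coAlg 𝒜 a ≤ V 𝒜 ^ a := inf_le_left
  have e : smulMap 𝒜 ℳ t (coAlg 𝒜 a) (coModTerm 𝒜 ℳ t (b :: l)) =
      actMap (V 𝒜 ^ a) (coModTerm 𝒜 ℳ t (b :: l)) ∘ₗ
        (Submodule.inclusion hle).rTensor (coModTerm 𝒜 ℳ t (b :: l)) := by
    ext
    rfl
  rw [e]
  exact (actMap_V_pow_injective ℳ t (hflat 1) a _).comp
    (Module.Flat.rTensor_preserves_injective_linearMap _ (Submodule.inclusion_injective hle))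

theorem coModTermIsTensor (α : List ℕ) : CoModTermIsTensor 𝒜 ℳ t α := by
  induction α with
  | nil => trivial
  | cons a l ih =>
    cases l with
    | nil => trivial
    | cons b l => exact ⟨smulMap_coModTerm_injective hquad hflat hgen hrel hflatM hd a b l, ih⟩

/-- The refinement chain complex is the cube complex of the submodules `S_{A,M,i}` at the cuts of
the composition, inside the intersection of those at the inner places. -/
theorem refModChainExact_of_isDistribSet {α : List ℕ} (hne : α ≠ []) (hp : InitPos α) :
    RefModChainExact 𝒜 ℳ t α := by
  have hterm : ∀ J, coModTerm 𝒜 ℳ t (sigma α J) = _ := fun J =>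
    coModTerm_merge hquad hflat hgen hrel hflatM hd hne hp rfl J
  refine ⟨fun J => coModTermIsTensor hquad hflat hgen hrel hflatM hd _, fun J K hJK => ?_, ?_⟩
  · rw [hterm, hterm]
    exact inf_le_inf_left _ (Finset.inf_mono hJK)
  · simp only [hterm]
    refine (hd α.sum).cubeChainExact ?_ (fun i hi => ?_) fun j => ?_
    · rintro _ ⟨i, hi, rfl⟩
      exact SMod_le _ _ (by simpa using hi)
    · exact ⟨i, by simpa using lt_of_mem_innerSet hi, rfl⟩
    · exact ⟨_, by simpa using cutList_getD_lt hp j.2, rfl⟩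

end Chain

/-- Distributivity of a collection of submodules of `Q` does not depend on the module in which `Q`
lies. -/
theorem isDistributive_submoduleOf_iff {R : Type u} [CommRing R] {W : Type v} [AddCommGroup W]
    [Module R W] {Q : Submodule R W} {m : ℕ} {N : ℕ → Submodule R W} (hN : ∀ i < m, N i ≤ Q) :
    IsDistributive (fun i : Fin m => (N i).submoduleOf Q) ↔
      IsDistribSet (N '' Finset.range m) := by
  have e : Submodule.map Q.subtype '' Set.range (fun i : Fin m => (N i).submoduleOf Q) =
      N '' Finset.range m := by
    rw [← Set.range_comp]
    have h : ∀ i < m, Submodule.map Q.subtype ((N i).submoduleOf Q) = N i := fun i hi =>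
      (Submodule.map_comap_subtype _ _).trans (inf_eq_right.2 (hN i hi))
    ext X
    simp only [Set.mem_range, Function.comp_apply, Set.mem_image, Finset.coe_range, Set.mem_Iio]
    constructor
    · rintro ⟨i, rfl⟩
      exact ⟨i, i.2, (h i i.2).symm⟩
    · rintro ⟨i, hi, rfl⟩
      exact ⟨⟨i, hi⟩, h i hi⟩
  rw [isDistributive_iff_isDistribSet, ← e, isDistribSet_map Q.subtype_injective]

/-! ### Koszul modules over Koszul algebras -/

section ModuleTheorem

variable {R : Type u} [CommRing R] {A : Type v} [Ring A] [Algebra R A] {𝒜 : ℕ → Submodule R A}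

theorem isDistributive_SAlgColl_iff (n : ℕ) : IsDistributive (SAlgColl 𝒜 n) ↔
    IsDistribSet (SAlg 𝒜 n '' Finset.range (n - 1)) :=
  isDistributive_submoduleOf_iff fun i hi => SAlg_le 𝒜 n i (by omega)

variable {M : Type w} [AddCommGroup M] [Module R M] [Module A M] [IsScalarTower R A M]
  {ℳ : ℤ → Submodule R M} {t : ℤ}

theorem isDistributive_SModColl_iff (n : ℕ) :
    IsDistributive (W := TensorPowMod 𝒜 ℳ t n) (SModColl 𝒜 ℳ t (n + 1)) ↔
      IsDistribSet (SMod 𝒜 ℳ t n '' Finset.range n) :=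
  isDistributive_submoduleOf_iff fun i hi => SMod_le n i hi

theorem forall_isDistributive_SModColl_iff :
    (∀ n : ℕ, 0 < n → IsDistributive (W := TensorPowMod 𝒜 ℳ t (n - 1)) (SModColl 𝒜 ℳ t n)) ↔
      ∀ n, IsDistribSet (SMod 𝒜 ℳ t n '' Finset.range n) := by
  constructor
  · intro h n
    exact (isDistributive_SModColl_iff n).1 (h (n + 1) n.succ_pos)
  · intro h n hn
    obtain ⟨n, rfl⟩ : ∃ k, n = k + 1 := ⟨n - 1, by omega⟩
    exact (isDistributive_SModColl_iff n).2 (h n)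

theorem isQuadraticModule_iff : IsQuadraticModule 𝒜 ℳ t ↔
    (∀ d : ℕ, (tmPow (𝒜 := 𝒜) ℳ t d).map (canMod 𝒜 ℳ t) = ℳ (t + d)) ∧
      ∀ d : ℕ, QMod 𝒜 ℳ t d = (Finset.range d).sup (SMod 𝒜 ℳ t d) := by
  simp only [IsQuadraticModule, iSup_fin_eq_sup, forall_and]

theorem initPos_append {α : List ℕ} (hα : ∀ a ∈ α, 0 < a) (r : ℕ) : InitPos (α ++ [r]) := by
  induction α with
  | nil => trivial
  | cons a l ih =>
    rw [List.cons_append, initPos_cons (by simp)]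
    exact ⟨hα a (by simp), ih fun b hb => hα b (by simp [hb])⟩

variable [GradedAlgebra 𝒜] (hquad : IsQuadratic 𝒜) (hflat : ∀ n, Module.Flat R (𝒜 n))
  (hA : ∀ n, IsDistribSet (SAlg 𝒜 n '' Finset.range (n - 1)))
  (hM : IsGradedModule 𝒜 ℳ t) (hflatM : ∀ j, Module.Flat R (ℳ j))

omit [GradedAlgebra 𝒜] in
include hM in
theorem IsGradedModule.smul_mem_add (i j : ℕ) (a : A) (x : M) (ha : a ∈ 𝒜 i)
    (hx : x ∈ ℳ (t + j)) : a • x ∈ ℳ (t + (i + j : ℕ)) := by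
  have h := hM.smul_mem i (t + j) a x ha hx
  have e : (i : ℤ) + (t + j) = t + (i + j : ℕ) := by push_cast; ring
  rwa [e] at h

include hquad hflat hA hM hflatM

/-- Koszul modules over a Koszul algebra are the quadratic ones with distributive collections. -/
theorem isKoszulModule_iff_isDistributive : IsKoszulModule 𝒜 ℳ t ↔ IsQuadraticModule 𝒜 ℳ t ∧
    ∀ n : ℕ, 0 < n →
      IsDistributive (W := TensorPowMod 𝒜 ℳ t (n - 1)) (SModColl 𝒜 ℳ t n) := by
  rw [isKoszulModule_iff 𝒜 ℳ hM.eq_bot, isQuadraticModule_iff, forall_isDistributive_SModColl_iff]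
  constructor
  · intro hbar
    refine ⟨⟨map_canMod_of_bar _ hquad hflat hM.smul_mem_add hbar,
      QMod_eq_of_bar _ hquad hflat hM.smul_mem_add hbar⟩, fun n => ?_⟩
    induction n using Nat.strong_induction_on with
    | _ n ih =>
      exact isDistribSet_SMod_of_bar _ hquad hflat hM.smul_mem_add (fun d => hflatM _) n
        (fun k _ => hA k) ih hbar
  · rintro ⟨⟨hgen, hrel⟩, hd⟩ k
    exact refineExact_of_isDistribSet _ hquad hflat hgen hrel hM.smul_mem_add hd _ _
      (posParts_onesZero k one_pos)

theorem refModExact_of_isKoszulModule (hK : IsKoszulModule 𝒜 ℳ t) (α : List ℕ) (r : ℕ)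
    (hα : ∀ a ∈ α, 0 < a) : RefModCochainExact 𝒜 ℳ t (α ++ [r]) ∧
      RefModChainExact 𝒜 ℳ t (α ++ [r]) := by
  have h := (isKoszulModule_iff_isDistributive hquad hflat hA hM hflatM).1 hK
  rw [isQuadraticModule_iff, forall_isDistributive_SModColl_iff] at h
  obtain ⟨⟨hgen, hrel⟩, hd⟩ := h
  have hp := initPos_append hα r
  refine ⟨?_, refModChainExact_of_isDistribSet hquad hflat hgen hrel (fun d => hflatM _) hd
    (by simp) hp⟩
  obtain ⟨a, l, e⟩ := List.exists_cons_of_ne_nil (show α ++ [r] ≠ [] by simp)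
  rw [e] at hp ⊢
  rw [refModCochainExact_iff]
  exact refineExact_of_isDistribSet _ hquad hflat hgen hrel hM.smul_mem_add hd l a hp

end ModuleTheorem

/-! ### Lowering the last part of a composition -/

/-- The composition with last part lowered by one: a composition of an algebra, read as a
composition of the module `A_+` with initial degree one. -/
def decLast : List ℕ → List ℕ
  | [] => []
  | [r] => [r - 1]
  | a :: b :: l => a :: decLast (b :: l)

theorem length_decLast (α : List ℕ) : (decLast α).length = α.length := by
  fun_induction decLast α with
  | case1 => rfl
  | case2 => rfl
  | case3 a b l ih => rw [List.length_cons, ih]; rfl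

theorem decLast_ne_nil {α : List ℕ} (h : α ≠ []) : decLast α ≠ [] := fun h' => h
  (List.length_eq_zero_iff.1 (by rw [← length_decLast, h', List.length_nil]))

theorem decLast_cons (a : ℕ) {α : List ℕ} (h : α ≠ []) : decLast (a :: α) = a :: decLast α := by
  obtain ⟨b, l, rfl⟩ := List.exists_cons_of_ne_nil h
  rfl

theorem initPos_decLast {α : List ℕ} (hα : ∀ a ∈ α, 0 < a) : InitPos (decLast α) := by
  fun_induction decLast α with
  | case1 => trivial
  | case2 => trivial
  | case3 a b l ih =>
    exact (initPos_cons (decLast_ne_nil (by simp))).2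
      ⟨hα a (by simp), ih fun c hc => hα c (List.mem_cons_of_mem _ hc)⟩

theorem merge_pos (e : List Bool) {α : List ℕ} (hα : ∀ a ∈ α, 0 < a) :
    ∀ a ∈ merge e α, 0 < a := by
  fun_induction merge e α with
  | case1 e a b l ih =>
    refine ih fun c hc => ?_
    rcases List.mem_cons.1 hc with rfl | hc
    · exact Nat.add_pos_left (hα a (by simp)) b
    · exact hα c (by simp [hc])
  | case2 e a b l ih =>
    intro c hc
    rcases List.mem_cons.1 hc with rfl | hc
    · exact hα c (by simp)
    · exact ih (fun x hx => hα x (List.mem_cons_of_mem _ hx)) c hc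
  | case3 => exact hα

theorem merge_decLast (e : List Bool) {α : List ℕ} (hα : ∀ a ∈ α, 0 < a) :
    merge e (decLast α) = decLast (merge e α) := by
  fun_induction merge e α with
  | case1 e a b l ih =>
    have hb : 0 < b := hα b (by simp)
    rw [← ih]
    · cases l with
      | nil =>
        have h : a + b - 1 = a + (b - 1) := by omega
        simp [decLast, merge, h]
      | cons c l => simp [decLast, merge]
    · intro c hc
      rcases List.mem_cons.1 hc with rfl | hc
      · exact Nat.add_pos_left (hα a (by simp)) b
      · exact hα c (by simp [hc])
  | case2 e a b l ih =>
    rw [decLast_cons a (merge_ne_nil e (by simp)),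
      ← ih fun x hx => hα x (List.mem_cons_of_mem _ hx), decLast]
    obtain ⟨c, k, h⟩ := List.exists_cons_of_ne_nil (decLast_ne_nil (show b :: l ≠ [] by simp))
    rw [h, merge]
  | case3 e l h1 h2 =>
    match e, l with
    | [], _ => simp [merge]
    | _, [] => simp [merge, decLast]
    | _, [a] => simp [merge, decLast]
    | true :: e, a :: b :: l => exact absurd rfl (h1 e a b l rfl)
    | false :: e, a :: b :: l => exact absurd rfl (h2 e a b l rfl)

/-! ### The refinement complexes of a Koszul algebra -/

section AlgebraTheorem

variable {R : Type u} [CommRing R] {A : Type v} [Ring A] [Algebra R A] {𝒜 : ℕ → Submodule R A}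

theorem map_regMap_coMod (n : ℕ) :
    (coMod 𝒜 (regGrading 𝒜) 1 n).map (regMap 𝒜) = coAlg 𝒜 (n + 1) := by
  rw [coMod_eq, map_inf_finset_inf (regMap_injective 𝒜), map_regMap_tmPow, coAlg_eq,
    Nat.add_sub_cancel]
  congr 1
  exact Finset.inf_congr rfl fun i hi => map_regMap_SMod 𝒜 n i (Finset.mem_range.1 hi)

/-- The terms of the refinement chain complexes of `A` are those of the module `A_+`. -/
theorem map_regMap_coModTerm {β : List ℕ} (hne : β ≠ []) (hβ : ∀ b ∈ β, 0 < b) :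
    (coModTerm 𝒜 (regGrading 𝒜) 1 (decLast β)).map (regMap 𝒜) = coAlgTerm 𝒜 β := by
  fun_induction decLast β with
  | case1 => exact absurd rfl hne
  | case2 r =>
    have hr : r - 1 + 1 = r := Nat.sub_add_cancel (hβ r (by simp))
    rw [coModTerm, map_regMap_coMod, hr, coAlgTerm, coAlgTerm, mul_one]
  | case3 a b l ih =>
    have ih := ih (by simp) fun c hc => hβ c (List.mem_cons_of_mem _ hc)
    obtain ⟨c, k, h⟩ := List.exists_cons_of_ne_nil (decLast_ne_nil (show b :: l ≠ [] by simp))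
    rw [h] at ih ⊢
    rw [coModTerm, map_regMap_smul, ih]
    rfl

/-- The empty tensor product at the end of the recursion for the terms is `R`, embedded as the
scalars of the tensor algebra. -/
theorem mulMap_one_injective (P : Submodule R (TA 𝒜)) :
    Function.Injective (Submodule.mulMap P (1 : Submodule R (TA 𝒜))) := by
  have h1 : (1 : TA 𝒜) ∈ (1 : Submodule R (TA 𝒜)) := Submodule.one_le.1 le_rfl
  have h : ∀ ξ : P ⊗[R] (1 : Submodule R (TA 𝒜)), ∃ x : P, ξ = x ⊗ₜ ⟨1, h1⟩ := by
    intro ξ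
    induction ξ using TensorProduct.induction_on with
    | zero => exact ⟨0, by simp⟩
    | add a b ha hb =>
      obtain ⟨x, rfl⟩ := ha
      obtain ⟨y, rfl⟩ := hb
      exact ⟨x + y, (TensorProduct.add_tmul _ _ _).symm⟩
    | tmul x y =>
      obtain ⟨y, hy⟩ := y
      obtain ⟨r, rfl⟩ := Submodule.mem_one.1 hy
      refine ⟨r • x, ?_⟩
      rw [TensorProduct.smul_tmul]
      congr 1
      exact Subtype.ext (Algebra.algebraMap_eq_smul_one r)
  rw [injective_iff_map_eq_zero]
  intro ξ hξ
  obtain ⟨x, rfl⟩ := h ξ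
  rw [Submodule.mulMap_tmul, mul_one] at hξ
  have hx : x = 0 := Subtype.ext hξ
  rw [hx, TensorProduct.zero_tmul]

theorem mulMap_map_regMap_injective (P : Submodule R (TA 𝒜))
    (X : Submodule R (TM 𝒜 (regGrading 𝒜) 1))
    (h : Function.Injective (smulMap 𝒜 (regGrading 𝒜) 1 P X)) :
    Function.Injective (Submodule.mulMap P (X.map (regMap 𝒜))) := by
  let e := Submodule.equivMapOfInjective (regMap 𝒜) (regMap_injective 𝒜) X
  have h1 : Submodule.mulMap P (X.map (regMap 𝒜)) ∘ₗ e.toLinearMap.lTensor P =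
      regMap 𝒜 ∘ₗ smulMap 𝒜 (regGrading 𝒜) 1 P X := by
    ext x y
    exact (regMap_smul 𝒜 x.1 y.1).symm
  have h2 : Function.Injective (Submodule.mulMap P (X.map (regMap 𝒜)) ∘
      e.toLinearMap.lTensor P) := by
    rw [← LinearMap.coe_comp, h1]
    exact (regMap_injective 𝒜).comp h
  exact h2.of_comp_right (LinearEquiv.lTensor P e).surjective

variable [GradedAlgebra 𝒜] (hquad : IsQuadratic 𝒜) (hflat : ∀ n, Module.Flat R (𝒜 n))
  (hA : ∀ n, IsDistribSet (SAlg 𝒜 n '' Finset.range (n - 1)))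
include hquad hflat hA

theorem coAlgTermIsTensor {β : List ℕ} (hβ : ∀ b ∈ β, 0 < b) : CoAlgTermIsTensor 𝒜 β := by
  induction β with
  | nil => trivial
  | cons b l ih =>
    refine ⟨?_, ih fun c hc => hβ c (List.mem_cons_of_mem _ hc)⟩
    rcases eq_or_ne l [] with rfl | hl
    · exact mulMap_one_injective _
    · obtain ⟨c, k, h⟩ := List.exists_cons_of_ne_nil (decLast_ne_nil hl)
      rw [← map_regMap_coModTerm hl fun c hc => hβ c (List.mem_cons_of_mem _ hc), h]
      exact mulMap_map_regMap_injective _ _ (smulMap_coModTerm_injective hquad hflat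
        (map_canMod_regGrading hquad) (QMod_regGrading hquad) (fun d => flat_regGrading hflat _)
        (fun n => (isDistribSet_SMod_regGrading 𝒜 n).2 (hA _)) b c k)

theorem refChainExact_of_isDistribSet {α : List ℕ} (hne : α ≠ []) (hα : ∀ a ∈ α, 0 < a) :
    RefChainExact 𝒜 α := by
  have hd := fun n => (isDistribSet_SMod_regGrading 𝒜 n).2 (hA _)
  have hp := initPos_decLast hα
  have hterm : ∀ J, coAlgTerm 𝒜 (sigma α J) =
      (tmPow (regGrading 𝒜) 1 (decLast α).sum).map (regMap 𝒜) ⊓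
        ((innerSet (decLast α)).inf fun i =>
          (SMod 𝒜 (regGrading 𝒜) 1 (decLast α).sum i).map (regMap 𝒜)) ⊓
        J.inf fun j => (SMod 𝒜 (regGrading 𝒜) 1 (decLast α).sum
          ((cutList (decLast α)).getD j 0)).map (regMap 𝒜) := fun J => by
    have h1 := coModTerm_merge hquad hflat (map_canMod_regGrading hquad) (QMod_regGrading hquad)
      (fun d => flat_regGrading hflat _) hd (decLast_ne_nil hne) hp
      (by rw [length_decLast] : α.length - 1 = (decLast α).length - 1) J
    have h2 := map_regMap_coModTerm (𝒜 := 𝒜) (merge_ne_nil (List.ofFn fun i => decide (i ∈ J)) hne)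
      (merge_pos _ hα)
    rw [← merge_decLast _ hα, h1, map_inf_finset_inf (regMap_injective 𝒜),
      map_inf_finset_inf (regMap_injective 𝒜)] at h2
    exact h2.symm
  refine ⟨fun J => coAlgTermIsTensor hquad hflat hA (merge_pos _ hα), fun J K hJK => ?_, ?_⟩
  · rw [hterm, hterm]
    exact inf_le_inf_left _ (Finset.inf_mono hJK)
  · simp only [hterm]
    refine ((isDistribSet_map (regMap_injective 𝒜)).2 (hd (decLast α).sum)).cubeChainExact ?_
      (fun i hi => ?_) fun j => ?_
    · rintro _ ⟨_, ⟨i, hi, rfl⟩, rfl⟩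
      exact Submodule.map_mono (SMod_le _ _ (by simpa using hi))
    · exact ⟨_, ⟨i, by simpa using lt_of_mem_innerSet hi, rfl⟩, rfl⟩
    · exact ⟨_, ⟨_, by simpa using cutList_getD_lt hp (by rw [length_decLast]; exact j.2), rfl⟩,
        rfl⟩

theorem refCochainExact_of_isDistribSet {α : List ℕ} (hne : α ≠ []) (hα : ∀ a ∈ α, 0 < a) :
    RefCochainExact 𝒜 α := by
  obtain ⟨a, l, rfl⟩ := List.exists_cons_of_ne_nil hne
  apply refCochainExact_of_refineExact
  rcases List.eq_nil_or_concat l with rfl | ⟨l, r, rfl⟩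
  · intro n hn
    simp at hn
  · rw [List.concat_eq_append] at hα ⊢
    obtain ⟨r, rfl⟩ : ∃ k, r = k + 1 := ⟨r - 1, by have := hα r (by simp); omega⟩
    have h := refineExact_of_isDistribSet (algBarModel (R := R) (A := A)) hquad hflat
      (map_canMod_regGrading hquad) (QMod_regGrading hquad) smul_mem_regGrading
      (fun n => (isDistribSet_SMod_regGrading 𝒜 n).2 (hA _)) (l ++ [r]) a
      (initPos_append (α := a :: l) (fun b hb => hα b (by
        rw [← List.cons_append]; exact List.mem_append_left _ hb)) r)
    have e := fun n => (algBarModel (R := R) (A := A)).refine_shift (𝒜 := 𝒜) (L := 𝒜)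
      (fun n : ℕ => regGrading 𝒜 (1 + n)) (regGrading_one_add 𝒜) l r a n
    intro n hn
    have hn' : n < (l ++ [r]).length := by simpa using hn
    have := h n hn'
    rwa [← funext e] at this

end AlgebraTheorem

/-! ### The opposite algebra -/

section Opposite

variable {R : Type u} [CommRing R] {A : Type v} [Ring A] [Algebra R A] (𝒜 : ℕ → Submodule R A)

theorem op_mem_opGrading {n : ℕ} {a : A} : MulOpposite.op a ∈ opGrading 𝒜 n ↔ a ∈ 𝒜 n := by
  rw [opGrading, Submodule.mem_map]
  exact ⟨fun ⟨b, hb, h⟩ => MulOpposite.op_injective h ▸ hb, fun h => ⟨a, h, rfl⟩⟩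

theorem isInternal_opGrading [GradedAlgebra 𝒜] : DirectSum.IsInternal (opGrading 𝒜) := by
  have h := DirectSum.Decomposition.isInternal 𝒜
  rw [DirectSum.isInternal_submodule_iff_iSupIndep_and_iSup_eq_top] at h ⊢
  let e : Submodule R A ≃o Submodule R Aᵐᵒᵖ :=
    Submodule.orderIsoMapComap (MulOpposite.opLinearEquiv R : A ≃ₗ[R] Aᵐᵒᵖ)
  have he : opGrading 𝒜 = e ∘ 𝒜 := rfl
  rw [he]
  refine ⟨(iSupIndep_map_orderIso_iff e).2 h.1, ?_⟩
  show (⨆ i, e (𝒜 i)) = ⊤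
  rw [← map_iSup e, h.2, map_top]

instance gradedAlgebraOpGrading [GradedAlgebra 𝒜] : GradedAlgebra (opGrading 𝒜) where
  one_mem := (op_mem_opGrading 𝒜).2 (SetLike.GradedOne.one_mem (A := 𝒜))
  mul_mem := by
    intro i j a b ha hb
    induction a using MulOpposite.rec' with | _ a =>
    induction b using MulOpposite.rec' with | _ b =>
    rw [op_mem_opGrading] at ha hb
    rw [← MulOpposite.op_mul, op_mem_opGrading, add_comm]
    exact SetLike.mul_mem_graded hb ha
  toDecomposition := (isInternal_opGrading 𝒜).chooseDecomposition

theorem flat_opGrading (hflat : ∀ n, Module.Flat R (𝒜 n)) (n : ℕ) :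
    Module.Flat R (opGrading 𝒜 n) := by
  have := hflat n
  exact Module.Flat.of_linearEquiv
    (LinearEquiv.submoduleMap (MulOpposite.opLinearEquiv R : A ≃ₗ[R] Aᵐᵒᵖ) (𝒜 n)).symm

/-- `A_1` is the degree one part of the opposite algebra. -/
def opDegreeOne : 𝒜 1 ≃ₗ[R] opGrading 𝒜 1 :=
  LinearEquiv.submoduleMap (MulOpposite.opLinearEquiv R : A ≃ₗ[R] Aᵐᵒᵖ) (𝒜 1)

/-- The anti-isomorphism between the tensor algebras of an algebra and of its opposite. -/
def opTensor : TA 𝒜 →ₗ[R] TA (opGrading 𝒜) := antiMap (opDegreeOne 𝒜).toLinearMap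

theorem opTensor_bijective : Function.Bijective (opTensor 𝒜) := by
  refine Function.bijective_iff_has_inverse.2 ⟨antiMap (opDegreeOne 𝒜).symm.toLinearMap, ?_, ?_⟩
  · exact antiMap_antiMap _ _ (opDegreeOne 𝒜).symm_apply_apply
  · exact antiMap_antiMap _ _ (opDegreeOne 𝒜).apply_symm_apply

theorem can_opTensor (x : TA 𝒜) :
    can (opGrading 𝒜) (opTensor 𝒜 x) = MulOpposite.op (can 𝒜 x) := by
  induction x using TensorAlgebra.induction with
  | algebraMap r =>
    rw [opTensor, antiMap_algebraMap, AlgHom.commutes, AlgHom.commutes,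
      MulOpposite.algebraMap_apply]
  | ι v =>
    rw [opTensor, antiMap_ι, can_ι, can_ι]
    rfl
  | mul x y hx hy =>
    rw [opTensor] at hx hy ⊢
    rw [antiMap_mul, map_mul, map_mul, hx, hy, MulOpposite.op_mul]
  | add x y hx hy => rw [map_add, map_add, map_add, hx, hy, MulOpposite.op_add]

theorem map_opTensor_V : (V 𝒜).map (opTensor 𝒜) = V (opGrading 𝒜) := by
  apply le_antisymm
  · rintro _ ⟨_, ⟨v, rfl⟩, rfl⟩
    exact ⟨_, (antiMap_ι _ v).symm⟩
  · rintro _ ⟨v, rfl⟩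
    obtain ⟨v, rfl⟩ := (opDegreeOne 𝒜).surjective v
    exact ⟨_, ⟨v, rfl⟩, antiMap_ι _ v⟩

theorem map_opTensor_V_pow (n : ℕ) : (V 𝒜 ^ n).map (opTensor 𝒜) = V (opGrading 𝒜) ^ n := by
  rw [opTensor, map_antiMap_pow]
  exact congrArg (· ^ n) (map_opTensor_V 𝒜)

theorem map_opTensor_Q2 : (Q2 𝒜).map (opTensor 𝒜) = Q2 (opGrading 𝒜) := by
  apply le_antisymm
  · rintro _ ⟨x, ⟨hx, h0⟩, rfl⟩
    refine ⟨?_, ?_⟩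
    · rw [← map_opTensor_V_pow]
      exact Submodule.mem_map_of_mem hx
    · exact (can_opTensor 𝒜 x).trans (congrArg MulOpposite.op h0)
  · rintro x ⟨hx, h0⟩
    rw [← map_opTensor_V_pow] at hx
    obtain ⟨y, hy, rfl⟩ := hx
    exact ⟨y, ⟨hy, MulOpposite.op_injective ((can_opTensor 𝒜 y).symm.trans h0)⟩, rfl⟩

/-- Reversing tensors reverses the numbering of the places. -/
theorem map_opTensor_SAlg (n i : ℕ) (h : i + 2 ≤ n) :
    (SAlg 𝒜 n i).map (opTensor 𝒜) = SAlg (opGrading 𝒜) n (n - i - 2) := by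
  have e : n - (n - i - 2) - 2 = i := by omega
  rw [SAlg, SAlg, e, ← map_opTensor_V_pow, ← map_opTensor_V_pow, ← map_opTensor_Q2, opTensor,
    map_antiMap_mul, map_antiMap_mul, mul_assoc]

theorem isDistribSet_SAlg_opGrading (n : ℕ) :
    IsDistribSet (SAlg (opGrading 𝒜) n '' Finset.range (n - 1)) ↔
      IsDistribSet (SAlg 𝒜 n '' Finset.range (n - 1)) := by
  have e : Submodule.map (opTensor 𝒜) '' (SAlg 𝒜 n '' Finset.range (n - 1)) =
      SAlg (opGrading 𝒜) n '' Finset.range (n - 1) := by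
    rw [Set.image_image]
    ext X
    simp only [Set.mem_image, Finset.coe_range, Set.mem_Iio]
    constructor
    · rintro ⟨i, hi, rfl⟩
      exact ⟨n - i - 2, by omega, (map_opTensor_SAlg 𝒜 n i (by omega)).symm⟩
    · rintro ⟨i, hi, rfl⟩
      refine ⟨n - i - 2, by omega, ?_⟩
      rw [map_opTensor_SAlg 𝒜 n _ (by omega)]
      congr 1
      omega
  rw [← e, isDistribSet_map (opTensor_bijective 𝒜).1]

variable {𝒜}

/-- The opposite of a quadratic algebra is quadratic, by reversal of tensors. -/
theorem IsQuadratic.op (hquad : IsQuadratic 𝒜) : IsQuadratic (opGrading 𝒜) := by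
  refine ⟨fun b => ?_, le_antisymm ?_ ?_⟩
  · obtain ⟨x, hx⟩ := hquad.1 (MulOpposite.unop b)
    exact ⟨opTensor 𝒜 x, by rw [can_opTensor, hx, MulOpposite.op_unop]⟩
  · intro x hx
    rw [TwoSidedIdeal.mem_ker] at hx
    obtain ⟨y, rfl⟩ := (opTensor_bijective 𝒜).2 x
    rw [can_opTensor] at hx
    have hy : y ∈ TwoSidedIdeal.span (Q2 𝒜 : Set (TA 𝒜)) := by
      rw [← hquad.2, TwoSidedIdeal.mem_ker]
      exact MulOpposite.op_injective hx
    let J := TwoSidedIdeal.span (Q2 (opGrading 𝒜) :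
      Set (TA (opGrading 𝒜)))
    let I : TwoSidedIdeal (TA 𝒜) := TwoSidedIdeal.mk' {y | opTensor 𝒜 y ∈ J}
      (by simp)
      (fun h h' => by simpa using J.add_mem h h')
      (fun h => by simpa using J.neg_mem h)
      (fun {x y} h => by
        show opTensor 𝒜 (x * y) ∈ J
        rw [opTensor, antiMap_mul]
        exact J.mul_mem_right _ _ h)
      (fun {x y} h => by
        show opTensor 𝒜 (x * y) ∈ J
        rw [opTensor, antiMap_mul]
        exact J.mul_mem_left _ _ h)
    have hle : TwoSidedIdeal.span (Q2 𝒜 : Set (TA 𝒜)) ≤ I := by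
      rw [TwoSidedIdeal.span_le]
      intro z hz
      show z ∈ I
      rw [TwoSidedIdeal.mem_mk']
      refine TwoSidedIdeal.subset_span ?_
      rw [← map_opTensor_Q2]
      exact Submodule.mem_map_of_mem hz
    have := hle hy
    rwa [TwoSidedIdeal.mem_mk'] at this
  · rw [TwoSidedIdeal.span_le]
    intro x hx
    exact (TwoSidedIdeal.mem_ker _).2 hx.2

end Opposite

end

end KoszulDistributive

theorem mainTheorem5 {R : Type*} [CommRing R] {A : Type*} [Ring A] [Algebra R A]
    (𝒜 : ℕ → Submodule R A) [GradedAlgebra 𝒜] (hquad : IsQuadratic 𝒜)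
    (hflat : ∀ n, Module.Flat R (𝒜 n)) :
    -- Koszulness of the algebra is distributivity of the collections `S^n_{A,i}`
    (IsKoszul 𝒜 ↔ ∀ n : ℕ, 0 < n → IsDistributive (SAlgColl 𝒜 n)) ∧
    -- exactness of the refinement complexes of a Koszul algebra
    (IsKoszul 𝒜 → ∀ α : List ℕ, α ≠ [] → (∀ a ∈ α, 0 < a) →
      RefCochainExact 𝒜 α ∧ RefChainExact 𝒜 α) ∧
    -- left modules over a Koszul algebra
    (IsKoszul 𝒜 → ∀ {M : Type*} [AddCommGroup M] [Module R M] [Module A M] [IsScalarTower R A M]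
      (ℳ : ℤ → Submodule R M) (t : ℤ), IsGradedModule 𝒜 ℳ t → (∀ j, Module.Flat R (ℳ j)) →
      (IsKoszulModule 𝒜 ℳ t ↔
        IsQuadraticModule 𝒜 ℳ t ∧
          ∀ n : ℕ, 0 < n →
            IsDistributive (W := TensorPowMod 𝒜 ℳ t (n - 1)) (SModColl 𝒜 ℳ t n)) ∧
      (IsKoszulModule 𝒜 ℳ t → ∀ (α : List ℕ) (r : ℕ), (∀ a ∈ α, 0 < a) →
        RefModCochainExact 𝒜 ℳ t (α ++ [r]) ∧ RefModChainExact 𝒜 ℳ t (α ++ [r]))) ∧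
    -- right modules over a Koszul algebra, i.e. left modules over the opposite algebra
    (IsKoszul 𝒜 → ∀ {M : Type*} [AddCommGroup M] [Module R M] [Module Aᵐᵒᵖ M]
      [IsScalarTower R Aᵐᵒᵖ M] (ℳ : ℤ → Submodule R M) (t : ℤ),
      IsGradedModule (opGrading 𝒜) ℳ t → (∀ j, Module.Flat R (ℳ j)) →
      (IsKoszulModule (opGrading 𝒜) ℳ t ↔
        IsQuadraticModule (opGrading 𝒜) ℳ t ∧
          ∀ n : ℕ, 0 < n →
            IsDistributive (W := TensorPowMod (opGrading 𝒜) ℳ t (n - 1))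
              (SModColl (opGrading 𝒜) ℳ t n)) ∧
      (IsKoszulModule (opGrading 𝒜) ℳ t → ∀ (α : List ℕ) (r : ℕ), (∀ a ∈ α, 0 < a) →
        RefModCochainExact (opGrading 𝒜) ℳ t (α ++ [r]) ∧
          RefModChainExact (opGrading 𝒜) ℳ t (α ++ [r]))) := by
  have hiff : IsKoszul 𝒜 ↔ ∀ n, IsDistribSet (SAlg 𝒜 n '' Finset.range (n - 1)) :=
    isKoszul_iff_isDistribSet hquad hflat
  refine ⟨?_, ?_, ?_, ?_⟩
  · simp only [isDistributive_SAlgColl_iff]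
    refine hiff.trans ⟨fun h n _ => h n, fun h n => ?_⟩
    rcases Nat.eq_zero_or_pos n with rfl | hn
    · simpa using IsDistribSet.empty
    · exact h n hn
  · intro hK α hne hα
    exact ⟨refCochainExact_of_isDistribSet hquad hflat (hiff.1 hK) hne hα,
      refChainExact_of_isDistribSet hquad hflat (hiff.1 hK) hne hα⟩
  · intro hK M _ _ _ _ ℳ t hM hflatM
    exact ⟨isKoszulModule_iff_isDistributive hquad hflat (hiff.1 hK) hM hflatM,
      fun h α r hα => refModExact_of_isKoszulModule hquad hflat (hiff.1 hK) hM hflatM h α r hα⟩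
  · intro hK M _ _ _ _ ℳ t hM hflatM
    have hA := fun n => (isDistribSet_SAlg_opGrading 𝒜 n).2 (hiff.1 hK n)
    have hq := hquad.op
    have hf := flat_opGrading 𝒜 hflat
    exact ⟨isKoszulModule_iff_isDistributive hq hf hA hM hflatM,
      fun h α r hα => refModExact_of_isKoszulModule hq hf hA hM hflatM h α r hα⟩
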